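/- **Conventions.** Paulis are taken modulo phase. Circuits are Clifford circuits: finite sequences of time steps, each consisting of operations in parallel, where an operation is a preparation of a stabiliser state, a Clifford gate, a Pauli correction controlled by earlier outcomes, a multi-qubit Pauli measurement, or a destructive single-qubit $Z$- or $X$-measurement. The fault locations of a circuit $C$ are the qubits at each time (before, between and after the time steps); those of a ZX diagram (spiders with phases in $\frac{\pi}{2}\mathbb{Z}$, Hadamard boxes, and outcome-dependent phases $q\pi$, where $q$ is a Boolean function of the outcomes) are its edges. A fault $F$ assigns a Pauli to each location; $C^F$ denotes the circuit or diagram with these Paulis inserted, regarded as a family of linear maps indexed by the measurement outcomes. $C^F=D^G$ means equality up to one common positive normalisation and a global phase for each outcome. A noise model $\mathcal F$ is a set of atomic faults; the weight of a fault in $\langle\mathcal F\rangle$ is the least number of atomic faults generating it. A fault on a circuit is detectable if it flips the parity of a set of measurements whose parity is predetermined in the fault-free circuit; a fault on a ZX diagram is detectable if it anticommutes with a Pauli web that highlights no input or output edge. $C_1$ under $\mathcal F_1$ is fault-equivalent to $C_2$ under $\mathcal F_2$ if for every $w$, each $F_1\in\langle\mathcal F_1\rangle$ with $wt(F_1)<w$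 is detectable or admits $F_2\in\langle\mathcal F_2\rangle$ with $wt(F_2)\le wt(F_1)$ and $C_1^{F_1}=C_2^{F_2}$, and likewise with the roles exchanged. Edge-flip noise on a diagram, some of whose edges are idealised as fault-free, consists of all weight-one Paulis on the other edges. A fault gadget for a Pauli $P$ on the edges of a diagram puts on each edge in the support of $P$ a Pauli box of the corresponding type, joins the boxes to one red spider, and joins that spider to a one-legged green spider; all new edges are fault-free except the last one. **(1)** For every Clifford circuit $C$ there are a ZX diagram $D$ with all edges idealised and an injection of the fault locations of $C$ into the edges of $D$ such that $C^F=D^F$ for every fault $F$ on $C$ (transported along the injection) and such that, for every noise model $\mathcal F$ on $C$, the circuit $C$ under $\mathcal F$ is fault-equivalent to the diagram obtained from $D$ by inserting exactly one fault gadget for each atomic fault in $\mathcal F$, under edge-flip noise (on the non-idealised edges, one per gadget). **(2)** Let $C$ be the circuit consisting of one CNOT and let $D$ be its ZX diagram: a phase-free $Z$-spider on the control wire joined by an edge to a phase-free $X$-spider on the target wire, with none of its five edges idealised. Then $C$ under circuit-level noise (all single-wire faults, and all faults on the two outputs of the gate) is fault-equivalent, under edge-flip noise, to $D$ with four fault gadgets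 inserted on its output edges, namely for $X\otimes Y$, $X\otimes Z$, $Y\otimes Y$ and $Y\otimes Z$ (control $\otimes$ target). Moreover, of the $15$ non-trivial faults on the two outputs of the CNOT, exactly $11$ have the same effect as a single edge flip of $D$ (without gadgets), and the remaining four are those for which gadgets were inserted. -/

import Mathlib

/-! ## Pauli operators modulo phase -/

/-- Single-qubit Pauli operators modulo phase, written additively: `(x, z)` stands for
`X ^ x * Z ^ z`, so `0` is the identity and `(1, 1)` is `Y` up to phase. -/
abbrev Pauli : Type := ZMod 2 × ZMod 2

/-- The Pauli operators `X`, `Y` and `Z`. -/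
abbrev Pauli.X : Pauli := (1, 0)
abbrev Pauli.Y : Pauli := (1, 1)
abbrev Pauli.Z : Pauli := (0, 1)

/-- Two Pauli strings anticommute iff the symplectic form below equals `1`. -/
def symplectic {Q : Type} [Fintype Q] (P R : Q → Pauli) : ZMod 2 :=
  ∑ q, ((P q).1 * (R q).2 + (P q).2 * (R q).1)

/-- The sign `(-1) ^ a`. -/
def sgn (a : ZMod 2) : ℂ := if a = 0 then 1 else -1

/-- Matrix entry `⟨a| X ^ x Z ^ z |b⟩`. -/
def pauliEntry (P : Pauli) (a b : ZMod 2) : ℂ := if a = b + P.1 then sgn (P.2 * b) else 0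

/-- The operator of a Pauli string, in the computational basis. Its `Y`s are written `X Z`. -/
def pauliMat {Q : Type} [Fintype Q] (P : Q → Pauli) : Matrix (Q → ZMod 2) (Q → ZMod 2) ℂ :=
  Matrix.of fun a b => ∏ q, pauliEntry (P q) (a q) (b q)

/-- The Hermitian operator of a Pauli string: every `Y` is `i X Z`. -/
noncomputable def pauliHerm {Q : Type} [Fintype Q] (P : Q → Pauli) :
    Matrix (Q → ZMod 2) (Q → ZMod 2) ℂ :=
  (∏ q, if P q = Pauli.Y then Complex.I else 1) • pauliMat P

/-- Clifford unitaries on `k` qubits: unitaries that conjugate Pauli strings to Pauli strings,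
up to a scalar. -/
def IsClifford {k : ℕ} (U : Matrix (Fin k → ZMod 2) (Fin k → ZMod 2) ℂ) : Prop :=
  U ∈ Matrix.unitaryGroup (Fin k → ZMod 2) ℂ ∧
    ∀ P : Fin k → Pauli, ∃ (Q : Fin k → Pauli) (c : ℂ),
      U * pauliMat P * U.conjTranspose = c • pauliMat Q

/-! ## Maps with measurement outcomes, noise, and fault equivalence -/

/-- A family of linear maps from `n` qubits to `m` qubits, one for each assignment of values to
the measurement outcomes `O`. -/
abbrev OutcomeMap (n m : ℕ) (O : Type) : Type :=
  (O → ZMod 2) → Matrix (Fin m → ZMod 2) (Fin n → ZMod 2) ℂ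

/-- Equality of maps with outcomes, up to one common normalisation factor and, for each outcome,
a global phase. -/
def SameMap {n m : ℕ} {O : Type} (A B : OutcomeMap n m O) : Prop :=
  ∃ (r : ℝ) (c : (O → ZMod 2) → ℂ), 0 < r ∧ (∀ k, ‖c k‖ = r) ∧ ∀ k, A k = c k • B k

/-- The weight of a fault: the least number of atomic faults that generate it. (Meaningful for
faults in the group generated by the atomic faults.) -/
noncomputable def faultWeight {L : Type} (N : Set (L → Pauli)) (F : L → Pauli) : ℕ :=
  sInf {w | ∃ l : List (L → Pauli), (∀ f ∈ l, f ∈ N) ∧ l.sum = F ∧ l.length = w}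

/-- A circuit or a diagram under a noise model, as far as fault equivalence sees it: its fault
locations, the map obtained by applying a fault, which faults are detectable, and the set of
atomic faults. -/
structure NoisyMap (n m : ℕ) (O : Type) where
  Loc : Type
  eval : (Loc → Pauli) → OutcomeMap n m O
  Detectable : (Loc → Pauli) → Prop
  noise : Set (Loc → Pauli)

/-- One direction of `w`-fault equivalence. -/
def FaultBounded {n m : ℕ} {O : Type} (w : ℕ) (A B : NoisyMap n m O) : Prop :=
  ∀ F ∈ AddSubgroup.closure A.noise, faultWeight A.noise F < w →
    A.Detectable F ∨ ∃ G ∈ AddSubgroup.closure B.noise,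
      faultWeight B.noise G ≤ faultWeight A.noise F ∧ SameMap (A.eval F) (B.eval G)

/-- `w`-fault equivalence. -/
def WFaultEquiv {n m : ℕ} {O : Type} (w : ℕ) (A B : NoisyMap n m O) : Prop :=
  FaultBounded w A B ∧ FaultBounded w B A

/-- Fault equivalence. -/
def FaultEquiv {n m : ℕ} {O : Type} (A B : NoisyMap n m O) : Prop :=
  ∀ w : ℕ, WFaultEquiv w A B

/-- The faults that act nontrivially on exactly one location. -/
def singleFaults (L : Type) : Set (L → Pauli) :=
  {f | ∃ l, f l ≠ 0 ∧ ∀ l', l' ≠ l → f l' = 0}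

/-! ## Clifford circuits with Pauli measurements -/

/-- The operations of a circuit whose earlier measurements have outcomes `O`: preparation of the
stabiliser state `U |0…0⟩`, Clifford gates, Pauli corrections controlled by a Boolean function of
earlier outcomes, multi-qubit Pauli measurements, and destructive single-qubit `Z` and `X`
measurements. -/
inductive Gate (O : Type) : Type
  | prep (k : ℕ) (U : Matrix (Fin k → ZMod 2) (Fin k → ZMod 2) ℂ) (hU : IsClifford U)
  | clifford (k : ℕ) (U : Matrix (Fin k → ZMod 2) (Fin k → ZMod 2) ℂ) (hU : IsClifford U)
  | correction (k : ℕ) (P : Fin k → Pauli) (q : (O → ZMod 2) → ZMod 2)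
  | measure (k : ℕ) (P : Fin k → Pauli)
  | destroyZ
  | destroyX

namespace Gate

/-- Number of input wires. -/
def ins {O : Type} : Gate O → ℕ
  | prep _ _ _ => 0
  | clifford k _ _ => k
  | correction k _ _ => k
  | measure k _ => k
  | destroyZ => 1
  | destroyX => 1

/-- Number of output wires. -/
def outs {O : Type} : Gate O → ℕ
  | prep k _ _ => k
  | clifford k _ _ => k
  | correction k _ _ => k
  | measure k _ => k
  | destroyZ => 0
  | destroyX => 0

/-- Number of measurement outcomes. -/
def arity {O : Type} : Gate O → ℕ
  | prep _ _ _ => 0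
  | clifford _ _ _ => 0
  | correction _ _ _ => 0
  | measure _ _ => 1
  | destroyZ => 1
  | destroyX => 1

/-- The projection `(1 + (-1) ^ t P) / 2` onto an eigenspace of a Pauli operator. -/
noncomputable def projection {k : ℕ} (P : Fin k → Pauli) (t : ZMod 2) :
    Matrix (Fin k → ZMod 2) (Fin k → ZMod 2) ℂ :=
  (1 / 2 : ℂ) • (1 + sgn t • pauliHerm P)

/-- A Pauli operator that is applied iff `a = 1`. -/
noncomputable def controlledPauli {k : ℕ} (P : Fin k → Pauli) (a : ZMod 2) :
    Matrix (Fin k → ZMod 2) (Fin k → ZMod 2) ℂ :=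
  if a = 0 then 1 else pauliMat P

/-- The linear map of an operation, given the earlier outcomes `s` and its own outcome `t`. -/
noncomputable def mat {O : Type} : (g : Gate O) → (s : O → ZMod 2) → (t : Fin g.arity → ZMod 2) →
    Matrix (Fin g.outs → ZMod 2) (Fin g.ins → ZMod 2) ℂ
  | prep _ U _, _, _ => Matrix.of fun o _ => U o 0
  | clifford _ U _, _, _ => U
  | correction _ P q, s, _ => controlledPauli P (q s)
  | measure _ P, _, t => projection P (t (0 : Fin 1))
  | destroyZ, _, t => Matrix.of fun _ i => if i (0 : Fin 1) = t (0 : Fin 1) then 1 else 0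
  | destroyX, _, t => Matrix.of fun _ i =>
      ((1 / Real.sqrt 2 : ℝ) : ℂ) * sgn (t (0 : Fin 1) * i (0 : Fin 1))

/-- The atomic faults that circuit-level noise attaches to an operation, as pairs of Paulis on its
input wires and on its output wires: any fault on the outputs and, for a Pauli measurement, also a
measurement flip (an anticommuting Pauli before and after) times any fault on the outputs. -/
def faults {O : Type} : (g : Gate O) → Set ((Fin g.ins → Pauli) × (Fin g.outs → Pauli))
  | prep _ _ _ => {p | p.1 = 0}
  | clifford _ _ _ => {p | p.1 = 0}
  | correction _ _ _ => {p | p.1 = 0}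
  | measure k P => {p | p.1 = 0} ∪
      {p | ∃ R Q : Fin k → Pauli, symplectic R P = 1 ∧ p = (R, R + Q)}
  | destroyZ => {p | p.2 = 0 ∧ symplectic p.1 (fun _ => Pauli.Z) = 1}
  | destroyX => {p | p.2 = 0 ∧ symplectic p.1 (fun _ => Pauli.X) = 1}

end Gate

/-- One time step, from `n` qubits to `m` qubits: finitely many operations in parallel, each qubit
of the step being an input (an output) wire of exactly one of them. A qubit that idles passes
through an identity gate. -/
structure Layer (O : Type) (n m : ℕ) : Type where
  size : ℕ
  gate : Fin size → Gate O
  wireIn : (Σ g, Fin (gate g).ins) ≃ Fin n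
  wireOut : (Σ g, Fin (gate g).outs) ≃ Fin m

namespace Layer

/-- The measurement outcomes of a time step. -/
abbrev Outcome {O : Type} {n m : ℕ} (L : Layer O n m) : Type :=
  Σ g, Fin (L.gate g).arity

/-- The linear map of a time step: the tensor product of its operations. -/
noncomputable def mat {O : Type} {n m : ℕ} (L : Layer O n m) (s : O → ZMod 2)
    (t : L.Outcome → ZMod 2) : Matrix (Fin m → ZMod 2) (Fin n → ZMod 2) ℂ :=
  Matrix.of fun o i => ∏ g, (L.gate g).mat s (fun j => t ⟨g, j⟩)
    (fun j => o (L.wireOut ⟨g, j⟩)) (fun j => i (L.wireIn ⟨g, j⟩))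

end Layer

/-- Circuits from `n` qubits to `m` qubits with measurement outcomes `O`, as sequences of time
steps. -/
inductive Circuit (n : ℕ) : ℕ → Type → Type 1
  | nil : Circuit n n Empty
  | snoc {m k : ℕ} {O : Type} (C : Circuit n m O) (L : Layer O m k) :
      Circuit n k (O ⊕ L.Outcome)

namespace Circuit

/-- The fault locations: the qubits at each time, before, between and after the time steps. -/
def Loc {n : ℕ} : {m : ℕ} → {O : Type} → Circuit n m O → Type
  | _, _, nil => Fin n
  | k, _, snoc C _ => C.Loc ⊕ Fin k

/-- The fault locations on the output wires of the circuit. -/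
def last {n : ℕ} : {m : ℕ} → {O : Type} → (C : Circuit n m O) → Fin m → C.Loc
  | _, _, nil => id
  | _, _, snoc _ _ => Sum.inr

/-- The map of the circuit after applying a fault: the Paulis of the fault are placed at their
locations. -/
noncomputable def eval {n : ℕ} : {m : ℕ} → {O : Type} → (C : Circuit n m O) → (C.Loc → Pauli) →
    OutcomeMap n m O
  | _, _, nil, F => fun _ => pauliMat (Q := Fin n) F
  | _, _, snoc C L, F => fun s =>
      pauliMat (fun q => F (Sum.inr q)) *
        (L.mat (fun o => s (Sum.inl o)) (fun o => s (Sum.inr o)) *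
          C.eval (fun l => F (Sum.inl l)) (fun o => s (Sum.inl o)))

/-- A fault is detectable if there is a detecting set `S`, that is a set of measurements whose
outcomes have a predetermined parity `b` in the fault-free circuit, whose parity is flipped by the
fault. An outcome is possible iff the linear map belonging to it is nonzero. -/
def Detectable {n m : ℕ} {O : Type} (C : Circuit n m O) (F : C.Loc → Pauli) : Prop :=
  ∃ (S : Finset O) (b : ZMod 2),
    (∀ s, C.eval 0 s ≠ 0 → ∑ o ∈ S, s o = b) ∧ (∀ s, C.eval F s ≠ 0 → ∑ o ∈ S, s o = b + 1)

/-- The circuit under a noise model, an arbitrary set of atomic faults. -/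
noncomputable def under {n m : ℕ} {O : Type} (C : Circuit n m O) (N : Set (C.Loc → Pauli)) :
    NoisyMap n m O where
  Loc := C.Loc
  eval := C.eval
  Detectable := C.Detectable
  noise := N

/-- Circuit-level noise: all faults on a single wire and, for every operation, its gate faults and
measurement flips. -/
noncomputable def circuitLevelNoise {n : ℕ} : {m : ℕ} → {O : Type} → (C : Circuit n m O) →
    Set (C.Loc → Pauli)
  | _, _, nil => singleFaults (Fin n)
  | k, _, snoc C L =>
      {f | ∃ f₀ ∈ C.circuitLevelNoise, f = Sum.elim f₀ 0} ∪
      singleFaults (C.Loc ⊕ Fin k) ∪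
      {f | ∃ g, ∃ p ∈ (L.gate g).faults,
        f = Sum.elim
          (Function.extend (fun j => C.last (L.wireIn ⟨g, j⟩)) p.1 0)
          (Function.extend (fun j => L.wireOut ⟨g, j⟩) p.2 0)}

end Circuit

/-! ## ZX diagrams -/

/-- The nodes of a ZX diagram with outcomes: Z-spiders and X-spiders with phase
`a * (π / 2) + q * π`, where `q` is a Boolean function (equivalently, a polynomial) of the
outcomes, and Hadamard boxes. -/
inductive Node (O : Type) : Type
  | z (a : ZMod 4) (q : (O → ZMod 2) → ZMod 2)
  | x (a : ZMod 4) (q : (O → ZMod 2) → ZMod 2)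
  | had

/-- The phase factor `exp (i (a * (π / 2) + b * π))`. -/
noncomputable def phaseFactor (a : ZMod 4) (b : ZMod 2) : ℂ := Complex.I ^ a.val * sgn b

/-- The tensor of a node whose set of legs is `S`, at the basis state `b` of the legs. -/
noncomputable def Node.tensor {O H : Type} (v : Node O) (s : O → ZMod 2) (S : Finset H)
    (b : H → ZMod 2) : ℂ :=
  open Classical in
  match v with
  | z a q => (if ∀ h ∈ S, b h = 0 then 1 else 0) +
      phaseFactor a (q s) * (if ∀ h ∈ S, b h = 1 then 1 else 0)
  | x a q => (∏ _h ∈ S, ((1 / Real.sqrt 2 : ℝ) : ℂ)) +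
      phaseFactor a (q s) * ∏ h ∈ S, ((1 / Real.sqrt 2 : ℝ) : ℂ) * sgn (b h)
  | had => ((1 / Real.sqrt 2 : ℝ) : ℂ) * (if ∀ h ∈ S, b h = 1 then -1 else 1)

/-- The rule that a Pauli web obeys at a node whose set of legs is `S`, where `P h` is the
highlighting of the leg `h`. At a Z-spider, either no leg (`t = 0`) or every leg (`t = 1`) is
highlighted in the opposite colour `X`; the number of legs highlighted in the own colour `Z` is
even, except that it is odd if `t = 1` and the phase is `± π / 2`. X-spiders have the colours
reversed, and Hadamard boxes exchange the colours. -/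
def Node.WebRule {O H : Type} (v : Node O) (S : Finset H) (P : H → Pauli) : Prop :=
  match v with
  | z a _ => ∃ t : ZMod 2, (∀ h ∈ S, (P h).1 = t) ∧ ∑ h ∈ S, (P h).2 = t * (a.val : ZMod 2)
  | x a _ => ∃ t : ZMod 2, (∀ h ∈ S, (P h).2 = t) ∧ ∑ h ∈ S, (P h).1 = t * (a.val : ZMod 2)
  | had => ∀ h ∈ S, ∀ h' ∈ S, h ≠ h' → P h = (P h').swap

/-- A ZX diagram from `n` qubits to `m` qubits with outcomes `O`, some of whose edges may be
idealised as fault-free, up to moving nodes around: an open multigraph. Each edge `e` has the two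
ends `(e, false)` and `(e, true)`; an end is attached to a node, an input or an output. Every
input and every output carries exactly one end, and every Hadamard box has two legs. -/
structure ZXDiagram (n m : ℕ) (O : Type) : Type 1 where
  V : Type
  E : Type
  [fintypeV : Fintype V]
  [fintypeE : Fintype E]
  [decEqV : DecidableEq V]
  [decEqE : DecidableEq E]
  kind : V → Node O
  ends : E × Bool → V ⊕ (Fin n ⊕ Fin m)
  noisy : E → Prop
  boundary : ∀ p, ∃! h, ends h = Sum.inr p
  hadamard : ∀ v, kind v = Node.had → (Finset.univ.filter fun h => ends h = Sum.inl v).card = 2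

namespace ZXDiagram

attribute [instance] fintypeV fintypeE decEqV decEqE

/-- The legs of a node. -/
def legs {n m : ℕ} {O : Type} (D : ZXDiagram n m O) (v : D.V) : Finset (D.E × Bool) :=
  Finset.univ.filter fun h => D.ends h = Sum.inl v

/-- The map of the diagram after applying a fault: the tensor network contraction, in which each
edge carries its Pauli (the identity if there is no fault). The orientation of edges matters only
for `Y`, by a sign. -/
noncomputable def eval {n m : ℕ} {O : Type} (D : ZXDiagram n m O) (F : D.E → Pauli) :
    OutcomeMap n m O :=
  fun s => Matrix.of fun o i => ∑ b : D.E × Bool → ZMod 2,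
    (∏ h, match D.ends h with
      | Sum.inl _ => (1 : ℂ)
      | Sum.inr (Sum.inl j) => if b h = i j then 1 else 0
      | Sum.inr (Sum.inr j) => if b h = o j then 1 else 0) *
    (∏ v, (D.kind v).tensor s (D.legs v) b) *
    ∏ e, pauliEntry (F e) (b (e, true)) (b (e, false))

/-- Pauli webs. -/
def IsPauliWeb {n m : ℕ} {O : Type} (D : ZXDiagram n m O) (P : D.E → Pauli) : Prop :=
  ∀ v, (D.kind v).WebRule (D.legs v) (fun h => P h.1)

/-- Detecting regions: Pauli webs that highlight no input or output edge. -/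
def IsDetectingRegion {n m : ℕ} {O : Type} (D : ZXDiagram n m O) (P : D.E → Pauli) : Prop :=
  D.IsPauliWeb P ∧ ∀ h p, D.ends h = Sum.inr p → P h.1 = 0

/-- A fault is detectable if it anticommutes with some detecting region. -/
def Detectable {n m : ℕ} {O : Type} (D : ZXDiagram n m O) (F : D.E → Pauli) : Prop :=
  ∃ P, D.IsDetectingRegion P ∧ symplectic F P = 1

/-- Edge-flip noise on the edges that are not idealised: all Paulis of weight one on them. -/
def edgeFlip {n m : ℕ} {O : Type} (D : ZXDiagram n m O) : Set (D.E → Pauli) :=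
  {f | f ∈ singleFaults D.E ∧ ∀ e, f e ≠ 0 → D.noisy e}

/-- The diagram under edge-flip noise on the edges that are not idealised. -/
noncomputable def underEdgeFlip {n m : ℕ} {O : Type} (D : ZXDiagram n m O) : NoisyMap n m O where
  Loc := D.E
  eval := D.eval
  Detectable := D.Detectable
  noise := D.edgeFlip

end ZXDiagram

/-! ## Fault gadgets -/

/-- The edges on which a fault acts nontrivially. -/
abbrev FaultSupport {E : Type} (P : E → Pauli) : Type := {e : E // P e ≠ 0}

/-- The nodes that a fault gadget adds: on each edge `e` of the support a Pauli box, which consists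
of a green spider `core e` with a leg and of its neighbours `pre e` and `post e` on the wire, which
conjugate it; the red spider `hub`; and the one-legged green spider `tip`. -/
inductive GadgetNode (S : Type) : Type
  | pre (e : S)
  | core (e : S)
  | post (e : S)
  | hub
  | tip
  deriving DecidableEq, Fintype

/-- The edges that a fault gadget adds: `enter e`, `left e`, `right e` on the wire, the leg
`link e` from the Pauli box to the hub, and the edge `flip` from the hub to the tip. -/
inductive GadgetEdge (S : Type) : Type
  | enter (e : S)
  | left (e : S)
  | right (e : S)
  | link (e : S)
  | flip
  deriving DecidableEq, Fintype

/-- The spiders before and after the green spider of a Pauli box: Hadamards for `X`, red spiders of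
phase `π / 2` and `- π / 2` for `Y`, and plain wires (phase-free spiders) for `Z`. -/
def boxBefore {O : Type} (P : Pauli) : Node O :=
  if P = Pauli.X then Node.had else if P = Pauli.Y then Node.x 1 0 else Node.z 0 0

def boxAfter {O : Type} (P : Pauli) : Node O :=
  if P = Pauli.X then Node.had else if P = Pauli.Y then Node.x (-1) 0 else Node.z 0 0

namespace ZXDiagram

/-- The kinds of nodes after inserting a fault gadget. -/
def gadgetKind {n m : ℕ} {O : Type} (D : ZXDiagram n m O) (P : D.E → Pauli) :
    D.V ⊕ GadgetNode (FaultSupport P) → Node O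
  | Sum.inl v => D.kind v
  | Sum.inr (GadgetNode.pre e) => boxBefore (P e.1)
  | Sum.inr (GadgetNode.core _) => Node.z 0 0
  | Sum.inr (GadgetNode.post e) => boxAfter (P e.1)
  | Sum.inr GadgetNode.hub => Node.x 0 0
  | Sum.inr GadgetNode.tip => Node.z 0 0

/-- An end of an old edge, seen among the nodes after inserting a fault gadget. -/
def gadgetLift {n m : ℕ} {O : Type} (D : ZXDiagram n m O) (P : D.E → Pauli) (h : D.E × Bool) :
    (D.V ⊕ GadgetNode (FaultSupport P)) ⊕ (Fin n ⊕ Fin m) :=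
  Sum.map Sum.inl id (D.ends h)

/-- The ends of edges after inserting a fault gadget: the Pauli box on `e` is placed at the end
`(e, false)` of the edge, and the remaining part of the edge is still called `e`. -/
def gadgetEnds {n m : ℕ} {O : Type} (D : ZXDiagram n m O) (P : D.E → Pauli) :
    (D.E ⊕ GadgetEdge (FaultSupport P)) × Bool →
      (D.V ⊕ GadgetNode (FaultSupport P)) ⊕ (Fin n ⊕ Fin m)
  | (Sum.inl e, true) => D.gadgetLift P (e, true)
  | (Sum.inl e, false) =>
      if he : P e ≠ 0 then Sum.inl (Sum.inr (GadgetNode.post ⟨e, he⟩))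
      else D.gadgetLift P (e, false)
  | (Sum.inr (GadgetEdge.enter e), false) => D.gadgetLift P (e.1, false)
  | (Sum.inr (GadgetEdge.enter e), true) => Sum.inl (Sum.inr (GadgetNode.pre e))
  | (Sum.inr (GadgetEdge.left e), false) => Sum.inl (Sum.inr (GadgetNode.pre e))
  | (Sum.inr (GadgetEdge.left e), true) => Sum.inl (Sum.inr (GadgetNode.core e))
  | (Sum.inr (GadgetEdge.right e), false) => Sum.inl (Sum.inr (GadgetNode.core e))
  | (Sum.inr (GadgetEdge.right e), true) => Sum.inl (Sum.inr (GadgetNode.post e))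
  | (Sum.inr (GadgetEdge.link e), false) => Sum.inl (Sum.inr (GadgetNode.core e))
  | (Sum.inr (GadgetEdge.link _), true) => Sum.inl (Sum.inr GadgetNode.hub)
  | (Sum.inr GadgetEdge.flip, false) => Sum.inl (Sum.inr GadgetNode.hub)
  | (Sum.inr GadgetEdge.flip, true) => Sum.inl (Sum.inr GadgetNode.tip)

/-- Where the end of an old edge has gone. -/
def gadgetEnd {n m : ℕ} {O : Type} (D : ZXDiagram n m O) (P : D.E → Pauli) :
    D.E × Bool → (D.E ⊕ GadgetEdge (FaultSupport P)) × Bool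
  | (e, true) => (Sum.inl e, true)
  | (e, false) => if he : P e ≠ 0 then (Sum.inr (GadgetEdge.enter ⟨e, he⟩), false)
      else (Sum.inl e, false)

theorem gadgetEnds_gadgetEnd {n m : ℕ} {O : Type} (D : ZXDiagram n m O) (P : D.E → Pauli)
    (h : D.E × Bool) : D.gadgetEnds P (D.gadgetEnd P h) = D.gadgetLift P h := by
  rcases h with ⟨e, _ | _⟩
  · by_cases he : P e = 0 <;> simp [gadgetEnd, gadgetEnds, he]
  · simp [gadgetEnd, gadgetEnds]

theorem gadgetEnd_injective {n m : ℕ} {O : Type} (D : ZXDiagram n m O) (P : D.E → Pauli) :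
    Function.Injective (D.gadgetEnd P) := by
  rintro ⟨e, _ | _⟩ ⟨e', _ | _⟩ h
  · by_cases he : P e = 0 <;> by_cases he' : P e' = 0 <;> simp_all [gadgetEnd]
  · by_cases he : P e = 0 <;> simp_all [gadgetEnd]
  · by_cases he : P e' = 0 <;> simp_all [gadgetEnd]
  · simp_all [gadgetEnd]

theorem gadgetEnds_eq_lift {n m : ℕ} {O : Type} (D : ZXDiagram n m O) (P : D.E → Pauli)
    (h : (D.E ⊕ GadgetEdge (FaultSupport P)) × Bool) (x : D.V ⊕ (Fin n ⊕ Fin m)) :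
    D.gadgetEnds P h = Sum.map Sum.inl id x ↔ ∃ h₀, D.gadgetEnd P h₀ = h ∧ D.ends h₀ = x := by
  have inj : Function.Injective
      (Sum.map Sum.inl id : D.V ⊕ (Fin n ⊕ Fin m) →
        (D.V ⊕ GadgetNode (FaultSupport P)) ⊕ (Fin n ⊕ Fin m)) :=
    Sum.map_injective.2 ⟨Sum.inl_injective, Function.injective_id⟩
  have hx : ∀ y : GadgetNode (FaultSupport P),
      (Sum.inl (Sum.inr y) : (D.V ⊕ GadgetNode (FaultSupport P)) ⊕ (Fin n ⊕ Fin m)) ≠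
        Sum.map Sum.inl id x := by
    intro y; rcases x with v | p <;> simp
  constructor
  · intro hh
    have key : ∃ h₀, D.gadgetEnd P h₀ = h := by
      rcases h with ⟨e | e, _ | _⟩
      · by_cases he : P e = 0
        · exact ⟨(e, false), by simp [gadgetEnd, he]⟩
        · exact absurd hh (by simpa [gadgetEnds, he] using hx _)
      · exact ⟨(e, true), by simp [gadgetEnd]⟩
      · rcases e with e | e | e | e | _
        · exact ⟨(e.1, false), by simp [gadgetEnd, e.2]⟩
        all_goals exact absurd hh (hx _)
      · rcases e with e | e | e | e | _
        all_goals exact absurd hh (hx _)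
    obtain ⟨h₀, rfl⟩ := key
    rw [gadgetEnds_gadgetEnd] at hh
    exact ⟨h₀, rfl, inj hh⟩
  · rintro ⟨h₀, rfl, rfl⟩
    exact D.gadgetEnds_gadgetEnd P h₀

theorem gadget_boundary {n m : ℕ} {O : Type} (D : ZXDiagram n m O) (P : D.E → Pauli)
    (p : Fin n ⊕ Fin m) : ∃! h, D.gadgetEnds P h = Sum.inr p := by
  obtain ⟨h₀, h1, h2⟩ := D.boundary p
  refine ⟨D.gadgetEnd P h₀, (D.gadgetEnds_eq_lift P _ (Sum.inr p)).2 ⟨h₀, rfl, h1⟩, ?_⟩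
  intro h hh
  obtain ⟨h', rfl, h3⟩ := (D.gadgetEnds_eq_lift P h (Sum.inr p)).1 hh
  rw [h2 h' h3]

theorem gadget_hadamard {n m : ℕ} {O : Type} (D : ZXDiagram n m O) (P : D.E → Pauli)
    (v : D.V ⊕ GadgetNode (FaultSupport P)) (hv : D.gadgetKind P v = Node.had) :
    (Finset.univ.filter fun h => D.gadgetEnds P h = Sum.inl v).card = 2 := by
  rcases v with v | v
  · refine Eq.trans (Eq.symm ?_) (D.hadamard v hv)
    refine Finset.card_bij (fun h _ => D.gadgetEnd P h) ?_ ?_ ?_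
    · intro h hh
      simp only [Finset.mem_filter, Finset.mem_univ, true_and] at hh ⊢
      exact (D.gadgetEnds_eq_lift P _ (Sum.inl v)).2 ⟨h, rfl, hh⟩
    · intro h _ h' _ e
      exact D.gadgetEnd_injective P e
    · intro h hh
      simp only [Finset.mem_filter, Finset.mem_univ, true_and] at hh
      obtain ⟨h', e, h3⟩ := (D.gadgetEnds_eq_lift P h (Sum.inl v)).1 hh
      exact ⟨h', by simpa using h3, e⟩
  · have lift : ∀ h, D.gadgetLift P h ≠ Sum.inl (Sum.inr v) := by
      intro h
      unfold gadgetLift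
      rcases D.ends h with x | x <;> simp
    rcases v with e | e | e | _ | _
    · rw [Finset.card_eq_two]
      refine ⟨(Sum.inr (GadgetEdge.enter e), true), (Sum.inr (GadgetEdge.left e), false),
        by simp, ?_⟩
      ext ⟨f | f, b⟩
      · rcases b with _ | _
        · by_cases he : P f = 0 <;> simp [gadgetEnds, he, lift]
        · simp [gadgetEnds, lift]
      · rcases f with f | f | f | f | _ <;> rcases b with _ | _ <;> simp [gadgetEnds, lift]
    · simp [gadgetKind] at hv
    · rw [Finset.card_eq_two]
      refine ⟨(Sum.inl e.1, false), (Sum.inr (GadgetEdge.right e), true), by simp, ?_⟩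
      ext ⟨f | f, b⟩
      · rcases b with _ | _
        · by_cases he : P f = 0
          · have : f ≠ e.1 := fun h => e.2 (h ▸ he)
            simp [gadgetEnds, he, lift, this]
          · simp [gadgetEnds, he, Subtype.ext_iff]
        · simp [gadgetEnds, lift]
      · rcases f with f | f | f | f | _ <;> rcases b with _ | _ <;> simp [gadgetEnds, lift]
    · simp [gadgetKind] at hv
    · simp [gadgetKind] at hv

/-- Inserting a fault gadget for `P`. All its edges are fault-free except the edge between its hub
and its tip. -/
def insertGadget {n m : ℕ} {O : Type} (D : ZXDiagram n m O) (P : D.E → Pauli) :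
    ZXDiagram n m O where
  V := D.V ⊕ GadgetNode (FaultSupport P)
  E := D.E ⊕ GadgetEdge (FaultSupport P)
  kind := D.gadgetKind P
  ends := D.gadgetEnds P
  noisy := Sum.elim D.noisy fun e => e = GadgetEdge.flip
  boundary := D.gadget_boundary P
  hadamard := D.gadget_hadamard P

/-- Inserting fault gadgets for the faults `P 0, …, P (k - 1)`, one after the other. -/
def insertGadgets : {n m : ℕ} → {O : Type} → (k : ℕ) → (D : ZXDiagram n m O) →
    (Fin k → D.E → Pauli) → ZXDiagram n m O
  | _, _, _, 0, D, _ => D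
  | _, _, _, k + 1, D, P =>
      insertGadgets k (D.insertGadget (P 0)) fun i => Sum.elim (P i.succ) 0

end ZXDiagram

/-! ## The CNOT -/

/-- The CNOT gate; qubit `0` is the control and qubit `1` the target. -/
def cnotMat : Matrix (Fin 2 → ZMod 2) (Fin 2 → ZMod 2) ℂ :=
  Matrix.of fun o i => if o 0 = i 0 ∧ o 1 = i 0 + i 1 then 1 else 0

/-- The permutation of basis states that the CNOT performs. -/
def cnotFun (b : Fin 2 → ZMod 2) : Fin 2 → ZMod 2 := ![b 0, b 0 + b 1]

theorem cnotMat_mul (M : Matrix (Fin 2 → ZMod 2) (Fin 2 → ZMod 2) ℂ) (o i : Fin 2 → ZMod 2) :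
    (cnotMat * M) o i = M (cnotFun o) i := by
  have h : ∀ o j : Fin 2 → ZMod 2, (o 0 = j 0 ∧ o 1 = j 0 + j 1) ↔ cnotFun o = j := by decide
  simp [Matrix.mul_apply, cnotMat, h]

theorem mul_cnotMat (M : Matrix (Fin 2 → ZMod 2) (Fin 2 → ZMod 2) ℂ) (o i : Fin 2 → ZMod 2) :
    (M * cnotMat) o i = M o (cnotFun i) := by
  have h : ∀ j i : Fin 2 → ZMod 2, (j 0 = i 0 ∧ j 1 = i 0 + i 1) ↔ j = cnotFun i := by decide
  simp [Matrix.mul_apply, cnotMat, h]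

theorem isClifford_cnotMat : IsClifford cnotMat := by
  have hs : cnotMat.conjTranspose = cnotMat := by
    have h : ∀ o i : Fin 2 → ZMod 2,
        (o 0 = i 0 ∧ o 1 = i 0 + i 1) ↔ (i 0 = o 0 ∧ i 1 = o 0 + o 1) := by decide
    ext o i
    rw [Matrix.conjTranspose_apply]
    simp only [cnotMat, Matrix.of_apply, h o i]
    split_ifs <;> simp
  have hu : cnotMat * cnotMat = 1 := by
    have h : ∀ o i : Fin 2 → ZMod 2,
        (cnotFun o 0 = i 0 ∧ cnotFun o 1 = i 0 + i 1) ↔ o = i := by decide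
    ext o i
    rw [cnotMat_mul]
    simp only [cnotMat, Matrix.of_apply, h o i, Matrix.one_apply]
  refine ⟨?_, fun P => ⟨![((P 0).1, (P 0).2 + (P 1).2), ((P 0).1 + (P 1).1, (P 1).2)], 1, ?_⟩⟩
  · rw [Matrix.mem_unitaryGroup_iff, Matrix.star_eq_conjTranspose, hs, hu]
  · have hs1 : ∀ a b : ZMod 2, sgn (a + b) = sgn a * sgn b := by
      intro a b
      have h : ∀ a b : ZMod 2, (a + b = 0) ↔ (a = 0 ↔ b = 0) := by decide
      simp only [sgn, h a b]
      by_cases ha : a = 0 <;> by_cases hb : b = 0 <;> simp [ha, hb]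
    have hc : cnotMat * pauliMat P =
        pauliMat ![((P 0).1, (P 0).2 + (P 1).2), ((P 0).1 + (P 1).1, (P 1).2)] * cnotMat := by
      ext o i
      rw [cnotMat_mul, mul_cnotMat]
      have h1 : ∀ o0 o1 i0 i1 x0 x1 : ZMod 2, (o0 = i0 + x0 ∧ o0 + o1 = i1 + x1) ↔
          (o0 = i0 + x0 ∧ o1 = i0 + i1 + (x0 + x1)) := by decide
      have h2 : ∀ i0 i1 z0 z1 : ZMod 2,
          z0 * i0 + z1 * i1 = (z0 + z1) * i0 + z1 * (i0 + i1) := by decide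
      have h3 : ∀ (p q : Prop) [Decidable p] [Decidable q] (u v : ℂ),
          (if p then u else 0) * (if q then v else 0) = if p ∧ q then u * v else 0 := by
        intro p q _ _ u v
        by_cases hp : p <;> by_cases hq : q <;> simp [hp, hq]
      have key : ∀ x0 z0 x1 z1 o0 o1 i0 i1 : ZMod 2,
          pauliEntry (x0, z0) o0 i0 * pauliEntry (x1, z1) (o0 + o1) i1 =
            pauliEntry (x0, z0 + z1) o0 i0 * pauliEntry (x0 + x1, z1) o1 (i0 + i1) := by
        intro x0 z0 x1 z1 o0 o1 i0 i1
        unfold pauliEntry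
        rw [h3, h3, ← hs1, ← hs1, ← h2]
        simp only [h1]
      have h4 : ∀ (R : Fin 2 → Pauli) (a b : Fin 2 → ZMod 2),
          pauliMat R a b = pauliEntry (R 0) (a 0) (b 0) * pauliEntry (R 1) (a 1) (b 1) :=
        fun R a b => by simp [pauliMat, Fin.prod_univ_two]
      rw [h4, h4]
      exact key _ _ _ _ _ _ _ _
    rw [hs, hc, Matrix.mul_assoc, hu, Matrix.mul_one, one_smul]

/-- The circuit that consists of a single CNOT. -/
def cnotCircuit : Circuit 2 2 (Empty ⊕ Σ _ : Fin 1, Fin 0) :=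
  Circuit.snoc Circuit.nil
    { size := 1
      gate := fun _ => Gate.clifford 2 cnotMat isClifford_cnotMat
      wireIn := Equiv.uniqueSigma fun _ : Fin 1 => Fin 2
      wireOut := Equiv.uniqueSigma fun _ : Fin 1 => Fin 2 }

/-- The edges of the ZX diagram of a CNOT. -/
inductive CnotEdge : Type
  | controlIn
  | targetIn
  | middle
  | controlOut
  | targetOut
  deriving DecidableEq

instance : Fintype CnotEdge where
  elems := {CnotEdge.controlIn, CnotEdge.targetIn, CnotEdge.middle, CnotEdge.controlOut,
    CnotEdge.targetOut}
  complete := by rintro (_ | _) <;> decide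

/-- The spiders of the ZX diagram of a CNOT. -/
inductive CnotNode : Type
  | green
  | red
  deriving DecidableEq

instance : Fintype CnotNode where
  elems := {CnotNode.green, CnotNode.red}
  complete := by rintro (_ | _) <;> decide

/-- The ends of the edges in the ZX diagram of a CNOT. -/
def cnotEnds : CnotEdge × Bool → CnotNode ⊕ (Fin 2 ⊕ Fin 2)
  | (CnotEdge.controlIn, false) => Sum.inr (Sum.inl 0)
  | (CnotEdge.controlIn, true) => Sum.inl CnotNode.green
  | (CnotEdge.targetIn, false) => Sum.inr (Sum.inl 1)
  | (CnotEdge.targetIn, true) => Sum.inl CnotNode.red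
  | (CnotEdge.middle, false) => Sum.inl CnotNode.green
  | (CnotEdge.middle, true) => Sum.inl CnotNode.red
  | (CnotEdge.controlOut, false) => Sum.inl CnotNode.green
  | (CnotEdge.controlOut, true) => Sum.inr (Sum.inr 0)
  | (CnotEdge.targetOut, false) => Sum.inl CnotNode.red
  | (CnotEdge.targetOut, true) => Sum.inr (Sum.inr 1)

/-- The ZX diagram of a CNOT: a phase-free Z-spider on the control wire, joined by an edge to a
phase-free X-spider on the target wire. No edge is idealised. -/
def cnotDiagram (O : Type) : ZXDiagram 2 2 O where
  V := CnotNode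
  E := CnotEdge
  kind := fun v => match v with
    | CnotNode.green => Node.z 0 0
    | CnotNode.red => Node.x 0 0
  ends := cnotEnds
  noisy := fun _ => True
  boundary := by
    unfold ExistsUnique; decide
  hadamard := by
    rintro (_ | _) h <;> simp at h

/-- The fault of the CNOT circuit that acts by `Q` on the two output wires. -/
def cnotOutputFault (Q : Fin 2 → Pauli) : cnotCircuit.Loc → Pauli :=
  Sum.elim (0 : Fin 2 → Pauli) Q

/-- The edge flips of the CNOT diagram that act by `Q` on the two output edges. -/
def cnotEdgeFault (Q : Fin 2 → Pauli) : CnotEdge → Pauli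
  | CnotEdge.controlOut => Q 0
  | CnotEdge.targetOut => Q 1
  | _ => 0

/-- The output faults `X ⊗ Y`, `X ⊗ Z`, `Y ⊗ Y` and `Y ⊗ Z`. -/
def cnotGadgetFaults : Fin 4 → Fin 2 → Pauli :=
  ![![Pauli.X, Pauli.Y], ![Pauli.X, Pauli.Z], ![Pauli.Y, Pauli.Y], ![Pauli.Y, Pauli.Z]]

/-! ## Signs and Pauli operators -/

/-! Part (1) rests on one computation. The tensor of the red hub of a fault gadget is a sum of two
characters of its legs: the constant one and the parity sign. Under the first character every Pauli
box is a plain wire; under the second it acts as its Pauli, up to a power of i. Hence a diagram `D`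
with a gadget for `P` evaluates, up to a positive scale, to α · D + β · D^P, where α and β depend
only on the tip and on the fault at the tip (`exists_netEval_gadget`). For the phase-free green tip
exactly one of α and β is nonzero, and the Z-component of the fault on the last edge decides which.
So a Z or Y flip there has the effect of `P`, and an X flip is absorbed (`insertGadget_eval`).

The same formula produces the diagrams of circuits. A red tip gives a superposition with prescribed
relative phase, so the maps that have a diagram are closed under A ↦ A + i^a (-1)^q Q A P
(`add_phase_smul`). Pauli projections are of this form with A = 1, and a green tip of phase qπ gives
controlled corrections. For a Clifford unitary U no set of generators is needed. One starts from N
with U N a matrix unit and twirls N, replacing it by N + P N P, for every single-qubit Z and then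
every single-qubit X. This turns N into a nonzero multiple of the identity, so U itself is reached.
Each step is admissible because U P = i^a Q U (`clifford_twirl`). Sequential and parallel
composition assemble the circuit, with a row of bare wires after every time step whose edges are the
fault locations (`Circuit.exists_diagram`).

Fault equivalence follows from a criterion (`faultEquiv_of_generators`): if effects of faults are
homomorphisms into a common group, equal effects give equal maps, and every atomic fault on one side
is trivial or has the effect of an atomic fault on the other, then replacing atomic faults one by
one never increases the weight. Detectability is not needed. In part (1) the group is that of all
faults on the circuit.

In part (2) it is the group of Paulis on the two outputs, to which all faults of the CNOT and of its
diagram can be pushed. The circuit has every output Pauli as an atomic fault. The single edge flips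
of the diagram realise eleven of the fifteen nontrivial ones, by a finite check
(`exists_cnotDiagramEffect_single_iff`), and the gadgets supply the other four. Since the CNOT is
unitary, different output Paulis give different maps, so the count is exact. -/

theorem sgn_zero : sgn 0 = 1 := if_pos rfl

theorem sgn_one : sgn 1 = -1 := if_neg one_ne_zero

theorem sgn_add (a b : ZMod 2) : sgn (a + b) = sgn a * sgn b := by
  have h : ∀ a b : ZMod 2, (a + b = 0) ↔ (a = 0 ↔ b = 0) := by decide
  simp only [sgn, h a b]
  by_cases ha : a = 0 <;> by_cases hb : b = 0 <;> simp [ha, hb]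

theorem sgn_mul_self (a : ZMod 2) : sgn a * sgn a = 1 := by
  rw [← sgn_add, CharTwo.add_self_eq_zero, sgn_zero]

theorem norm_sgn (a : ZMod 2) : ‖sgn a‖ = 1 := by
  unfold sgn; split_ifs <;> simp

theorem sgn_sum {ι : Type*} (s : Finset ι) (f : ι → ZMod 2) :
    sgn (∑ i ∈ s, f i) = ∏ i ∈ s, sgn (f i) := by
  classical
  induction s using Finset.induction_on with
  | empty => simp [sgn_zero]
  | insert a s ha ih => rw [Finset.sum_insert ha, Finset.prod_insert ha, sgn_add, ih]

theorem zmod_two_cases (a : ZMod 2) : a = 0 ∨ a = 1 := by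
  revert a; decide

theorem sum_zmod_two {M : Type*} [AddCommMonoid M] (f : ZMod 2 → M) :
    ∑ a, f a = f 0 + f 1 := Fin.sum_univ_two f

theorem prod_ite_zero' {ι : Type*} [Fintype ι] (p : ι → Prop) [DecidablePred p]
    [Decidable (∀ i, p i)] (f : ι → ℂ) :
    ∏ i, (if p i then f i else 0) = if ∀ i, p i then ∏ i, f i else 0 := by
  rw [Finset.prod_ite_zero]
  simp

theorem pi_zmod_two_add_self {Q : Type*} (x : Q → ZMod 2) : x + x = 0 :=
  funext fun _ => CharTwo.add_self_eq_zero _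

theorem pauli_add_self {Q : Type*} (P : Q → Pauli) : P + P = 0 :=
  funext fun _ => Prod.ext (CharTwo.add_self_eq_zero _) (CharTwo.add_self_eq_zero _)

section Pauli

variable {Q : Type} [Fintype Q]

theorem pauliMat_apply (P : Q → Pauli) (a b : Q → ZMod 2) :
    pauliMat P a b = if a = b + fun q => (P q).1 then sgn (∑ q, (P q).2 * b q) else 0 := by
  simp only [pauliMat, Matrix.of_apply, pauliEntry]
  rw [prod_ite_zero', sgn_sum]
  simp only [funext_iff, Pi.add_apply]

theorem pauliMat_zero : pauliMat (0 : Q → Pauli) = 1 := by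
  ext a b
  rw [pauliMat_apply, Matrix.one_apply]
  have : (fun q => ((0 : Q → Pauli) q).1) = 0 := rfl
  rw [this, add_zero]
  simp [sgn_zero]

variable [DecidableEq Q]

/-- A Pauli matrix is a signed permutation matrix: each row has one nonzero entry, so the product
collapses to one term. -/
theorem pauliMat_mul_apply {β : Type*} (P : Q → Pauli) (M : Matrix (Q → ZMod 2) β ℂ)
    (a : Q → ZMod 2) (b : β) : (pauliMat P * M) a b =
      sgn (∑ q, (P q).2 * (a q + (P q).1)) * M (a + fun q => (P q).1) b := by
  rw [Matrix.mul_apply, Finset.sum_eq_single (a + fun q => (P q).1)]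
  · rw [pauliMat_apply, if_pos]
    · rfl
    · rw [add_assoc, pi_zmod_two_add_self, add_zero]
  · intro c _ hc
    rw [pauliMat_apply, if_neg, zero_mul]
    rintro rfl
    rw [add_assoc, pi_zmod_two_add_self, add_zero] at hc
    exact hc rfl
  · simp

theorem mul_pauliMat_apply {α : Type*} (P : Q → Pauli) (M : Matrix α (Q → ZMod 2) ℂ)
    (a : α) (b : Q → ZMod 2) : (M * pauliMat P) a b =
      M a (b + fun q => (P q).1) * sgn (∑ q, (P q).2 * b q) := by
  rw [Matrix.mul_apply, Finset.sum_eq_single (b + fun q => (P q).1)]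
  · rw [pauliMat_apply, if_pos rfl]
  · intro c _ hc
    rw [pauliMat_apply, if_neg hc, mul_zero]
  · simp

/-- The sign comes from moving the Z-part of `P` past the X-part of `R`. -/
theorem pauliMat_mul (P R : Q → Pauli) :
    pauliMat P * pauliMat R = sgn (∑ q, (P q).2 * (R q).1) • pauliMat (P + R) := by
  ext a b
  rw [mul_pauliMat_apply, Matrix.smul_apply, pauliMat_apply, pauliMat_apply]
  have h : (b + fun q => (R q).1) + (fun q => (P q).1) = b + fun q => ((P + R) q).1 := by
    ext q; simp only [Pi.add_apply, Prod.fst_add]; ring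
  rw [h]
  split_ifs
  · rw [smul_eq_mul, ← sgn_add, ← sgn_add, ← Finset.sum_add_distrib, ← Finset.sum_add_distrib]
    congr 1
    refine Finset.sum_congr rfl fun q _ => ?_
    simp only [Pi.add_apply, Prod.snd_add]
    ring
  · simp

theorem pauliMat_mul_self (P : Q → Pauli) :
    pauliMat P * pauliMat P = sgn (∑ q, (P q).2 * (P q).1) • (1 : Matrix _ _ ℂ) := by
  rw [pauliMat_mul, pauli_add_self, pauliMat_zero]

/-- Paulis that agree up to a scalar are equal modulo phase. -/
theorem eq_of_pauliMat_eq_smul {P R : Q → Pauli} {c : ℂ} (h : pauliMat P = c • pauliMat R) :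
    P = R := by
  have h1 : ∀ b, pauliMat P (b + fun q => (P q).1) b = c * pauliMat R (b + fun q => (P q).1) b :=
    fun b => by rw [h]; rfl
  -- Column 0 of `pauliMat P` has its only nonzero entry, 1, in the row given by the X-part. If the
  -- X-parts differed, that entry would read 1 = c * 0.
  have hx : (fun q => (P q).1) = fun q => (R q).1 := by
    by_contra hne
    have := h1 0
    rw [pauliMat_apply, pauliMat_apply, if_pos rfl, if_neg (by simpa using hne)] at this
    simp [sgn_zero] at this
  have h2 : ∀ b : Q → ZMod 2, sgn (∑ q, (P q).2 * b q) = c * sgn (∑ q, (R q).2 * b q) := by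
    intro b
    have := h1 b
    rwa [pauliMat_apply, pauliMat_apply, if_pos rfl, if_pos (by rw [hx])] at this
  have hc : c = 1 := by simpa [sgn_zero] using (h2 0).symm
  funext q
  refine Prod.ext (congrFun hx q) ?_
  -- A standard basis vector isolates the Z-bit of a single qubit.
  have := h2 (Pi.single q 1)
  simp only [Pi.single_apply, mul_ite, mul_one, mul_zero, Finset.sum_ite_eq', Finset.mem_univ,
    if_true, hc, one_mul] at this
  rcases zmod_two_cases (P q).2 with h | h <;> rcases zmod_two_cases (R q).2 with h' | h' <;>
    rw [h, h'] at this ⊢ <;> norm_num [sgn_zero, sgn_one] at this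

end Pauli

/-! ## Equality of maps up to normalisation and phases -/

namespace SameMap

variable {n m k : ℕ} {O : Type}

theorem refl (A : OutcomeMap n m O) : SameMap A A :=
  ⟨1, fun _ => 1, one_pos, by simp, by simp⟩

theorem of_eq {A B : OutcomeMap n m O} (h : A = B) : SameMap A B := h ▸ refl A

theorem symm {A B : OutcomeMap n m O} : SameMap A B → SameMap B A := by
  rintro ⟨r, c, hr, hc, h⟩
  refine ⟨r⁻¹, fun s => (c s)⁻¹, inv_pos.2 hr, fun s => by rw [norm_inv, hc], fun s => ?_⟩
  have : c s ≠ 0 := by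
    rw [← norm_ne_zero_iff, hc]; exact hr.ne'
  rw [h s, smul_smul, inv_mul_cancel₀ this, one_smul]

theorem trans {A B C : OutcomeMap n m O} : SameMap A B → SameMap B C → SameMap A C := by
  rintro ⟨r, c, hr, hc, h⟩ ⟨r', c', hr', hc', h'⟩
  refine ⟨r * r', fun s => c s * c' s, mul_pos hr hr', fun s => by rw [norm_mul, hc, hc'],
    fun s => ?_⟩
  rw [h, h', smul_smul]

theorem mul {A A' : OutcomeMap m k O} {B B' : OutcomeMap n m O} :
    SameMap A A' → SameMap B B' → SameMap (fun s => A s * B s) (fun s => A' s * B' s) := by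
  rintro ⟨r, c, hr, hc, h⟩ ⟨r', c', hr', hc', h'⟩
  refine ⟨r * r', fun s => c s * c' s, mul_pos hr hr', fun s => by rw [norm_mul, hc, hc'],
    fun s => ?_⟩
  simp only [h, h', Matrix.smul_mul, Matrix.mul_smul, smul_smul, mul_comm (c' _)]

theorem comap {O' : Type} {A B : OutcomeMap n m O} (h : SameMap A B)
    (f : (O' → ZMod 2) → O → ZMod 2) : SameMap (fun s => A (f s)) (fun s => B (f s)) := by
  obtain ⟨r, c, hr, hc, h⟩ := h
  exact ⟨r, fun s => c (f s), hr, fun s => hc _, fun s => h _⟩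

theorem smul (c : ℂ) (hc : c ≠ 0) (A : OutcomeMap n m O) : SameMap (fun s => c • A s) A :=
  ⟨‖c‖, fun _ => c, norm_pos_iff.2 hc, fun _ => rfl, fun _ => rfl⟩

end SameMap

/-! ## Tensors of nodes -/

namespace Node

variable {O H H' : Type}

/-- A tensor looks at the assignment only on its legs, and injectivity makes each leg count once.
This identifies the nodes of a diagram with their copies in every larger diagram below. -/
theorem tensor_of_image (v : Node O) (s : O → ZMod 2) {f : H → H'} (hf : Function.Injective f)
    {S : Finset H} {S' : Finset H'} (h : ∀ x, x ∈ S' ↔ ∃ y, y ∈ S ∧ f y = x) (b : H' → ZMod 2) :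
    v.tensor s S' b = v.tensor s S fun y => b (f y) := by
  obtain rfl : S' = S.map ⟨f, hf⟩ := by
    ext x; simp [h]
  cases v <;> simp [tensor, Finset.prod_map]

theorem tensor_z_zero_pair (s : O → ZMod 2) [DecidableEq H] (x y : H) (b : H → ZMod 2) :
    (Node.z 0 0).tensor s {x, y} b = if b x = b y then 1 else 0 := by
  simp only [tensor, Finset.mem_insert, Finset.mem_singleton, forall_eq_or_imp, forall_eq]
  rcases zmod_two_cases (b x) with h | h <;> rcases zmod_two_cases (b y) with h' | h' <;>
    simp [h, h', phaseFactor, sgn_zero]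

theorem tensor_z_single (s : O → ZMod 2) (a : ZMod 4) (q : (O → ZMod 2) → ZMod 2) (x : H)
    (b : H → ZMod 2) :
    (Node.z a q).tensor s {x} b = if b x = 0 then 1 else phaseFactor a (q s) := by
  simp only [tensor, Finset.mem_singleton, forall_eq]
  rcases zmod_two_cases (b x) with h | h <;> simp [h]

theorem tensor_x_single (s : O → ZMod 2) (a : ZMod 4) (q : (O → ZMod 2) → ZMod 2) (x : H)
    (b : H → ZMod 2) : (Node.x a q).tensor s {x} b =
      ((1 / Real.sqrt 2 : ℝ) : ℂ) * (1 + phaseFactor a (q s) * sgn (b x)) := by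
  simp only [tensor, Finset.prod_singleton]
  ring

/-- The node with its outcome-dependent phase pulled back along a map of outcomes. -/
def comap {O' : Type} (f : (O' → ZMod 2) → O → ZMod 2) : Node O → Node O'
  | z a q => z a fun s => q (f s)
  | x a q => x a fun s => q (f s)
  | had => had

theorem comap_eq_had {O' : Type} {f : (O' → ZMod 2) → O → ZMod 2} {v : Node O} :
    v.comap f = had ↔ v = had := by
  cases v <;> simp [comap]

theorem tensor_comap {O' : Type} (f : (O' → ZMod 2) → O → ZMod 2) (v : Node O) (s : O' → ZMod 2)
    (S : Finset H) (b : H → ZMod 2) : (v.comap f).tensor s S b = v.tensor (f s) S b := by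
  cases v <;> rfl

end Node

/-! ## Building diagrams -/

theorem sum_sum_prod_bool {A B : Type} [Fintype A] [Fintype B] [DecidableEq A] [DecidableEq B]
    (f : ((A ⊕ B) × Bool → ZMod 2) → ℂ) :
    ∑ b, f b = ∑ b₁ : A × Bool → ZMod 2, ∑ b₂ : B × Bool → ZMod 2,
      f fun h => Sum.elim (fun e => b₁ (e, h.2)) (fun e => b₂ (e, h.2)) h.1 := by
  rw [← Fintype.sum_prod_type']
  refine Fintype.sum_equiv
    { toFun := fun b => (fun h => b (Sum.inl h.1, h.2), fun h => b (Sum.inr h.1, h.2))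
      invFun := fun p h => Sum.elim (fun e => p.1 (e, h.2)) (fun e => p.2 (e, h.2)) h.1
      left_inv := fun b => by ext ⟨e | e, x⟩ <;> rfl
      right_inv := fun p => rfl } _ _ fun b => ?_
  congr 1
  ext ⟨e | e, x⟩ <;> rfl

/-- The contraction of a tensor network whose open ends `port` carry the values `x`. -/
noncomputable def netEval {V E P O : Type} [Fintype V] [Fintype E] [DecidableEq V]
    [DecidableEq E] [Fintype P] [DecidableEq P] (kind : V → Node O) (ends : E × Bool → V ⊕ P)
    (port : P → E × Bool) (F : E → Pauli) (s : O → ZMod 2) (x : P → ZMod 2) : ℂ :=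
  ∑ b : E × Bool → ZMod 2, if ∀ p, b (port p) = x p then
    (∏ v, (kind v).tensor s (Finset.univ.filter fun h => ends h = Sum.inl v) b) *
      ∏ e, pauliEntry (F e) (b (e, true)) (b (e, false))
  else 0

namespace ZXDiagram

variable {n m k : ℕ} {O : Type}

/-- The end of an edge that an input or an output carries. -/
noncomputable def port (D : ZXDiagram n m O) (p : Fin n ⊕ Fin m) : D.E × Bool :=
  (D.boundary p).choose

theorem ends_eq_inr_iff (D : ZXDiagram n m O) {h : D.E × Bool} {p : Fin n ⊕ Fin m} :
    D.ends h = Sum.inr p ↔ h = D.port p :=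
  ⟨fun e => (D.boundary p).choose_spec.2 h e, fun e => e ▸ (D.boundary p).choose_spec.1⟩

theorem ends_port (D : ZXDiagram n m O) (p : Fin n ⊕ Fin m) : D.ends (D.port p) = Sum.inr p :=
  D.ends_eq_inr_iff.2 rfl

/-- Each input and output carries exactly one end, so the boundary factors in `eval` amount to
fixing the values at the ports. Leaving the choice of ports free lets each construction use its own
explicit ones. -/
theorem eval_eq_netEval (D : ZXDiagram n m O) {port : Fin n ⊕ Fin m → D.E × Bool}
    (hport : ∀ p, D.ends (port p) = Sum.inr p) (F : D.E → Pauli) (s : O → ZMod 2)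
    (o : Fin m → ZMod 2) (i : Fin n → ZMod 2) :
    D.eval F s o i = netEval D.kind D.ends port F s (Sum.elim i o) := by
  simp only [eval, Matrix.of_apply, netEval]
  refine Finset.sum_congr rfl fun b _ => ?_
  split_ifs with hb
  · rw [Finset.prod_eq_one, one_mul]
    · rfl
    intro h _
    rcases hp : D.ends h with v | p
    · rfl
    · obtain rfl : h = port p := (D.boundary p).unique hp (hport p)
      rcases p with p | p <;> simp [hb]
  · push Not at hb
    obtain ⟨p, hp⟩ := hb
    rw [Finset.prod_eq_zero (Finset.mem_univ (port p)), zero_mul, zero_mul]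
    rw [hport]
    rcases p with p | p <;> simpa using hp

/-- The diagram with its outcome-dependent phases pulled back along a map of outcomes. -/
def comap (D : ZXDiagram n m O) {O' : Type} (f : (O' → ZMod 2) → O → ZMod 2) :
    ZXDiagram n m O' where
  V := D.V
  E := D.E
  kind := fun v => (D.kind v).comap f
  ends := D.ends
  noisy := D.noisy
  boundary := D.boundary
  hadamard := fun v hv => D.hadamard v (Node.comap_eq_had.1 hv)

theorem eval_comap (D : ZXDiagram n m O) {O' : Type} (f : (O' → ZMod 2) → O → ZMod 2)
    (F : D.E → Pauli) (s : O' → ZMod 2) : (D.comap f).eval F s = D.eval F (f s) := by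
  ext o i
  refine ((D.comap f).eval_eq_netEval D.ends_port F s o i).trans ?_
  rw [D.eval_eq_netEval D.ends_port]
  change netEval (fun v => (D.kind v).comap f) D.ends D.port F s _ = _
  simp only [netEval, Node.tensor_comap]

/-! ### Sequential composition -/

/-- The ends of the edges in a sequential composition. -/
def compEnds (D : ZXDiagram n m O) (D' : ZXDiagram m k O) :
    (D.E ⊕ D'.E) × Bool → (D.V ⊕ (D'.V ⊕ Fin m)) ⊕ (Fin n ⊕ Fin k)
  | (Sum.inl e, x) => Sum.elim (fun v => Sum.inl (Sum.inl v))
      (Sum.elim (fun i => Sum.inr (Sum.inl i))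
      fun j => Sum.inl (Sum.inr (Sum.inr j))) (D.ends (e, x))
  | (Sum.inr e, x) => Sum.elim (fun v => Sum.inl (Sum.inr (Sum.inl v)))
      (Sum.elim (fun j => Sum.inl (Sum.inr (Sum.inr j))) fun i => Sum.inr (Sum.inr i))
      (D'.ends (e, x))

section comp

variable (D : ZXDiagram n m O) (D' : ZXDiagram m k O)

theorem compEnds_eq_left (h) (v : D.V) : D.compEnds D' h = Sum.inl (Sum.inl v) ↔
    ∃ h₀, D.ends h₀ = Sum.inl v ∧ (Sum.inl h₀.1, h₀.2) = h := by
  rcases h with ⟨e | e, x⟩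
  · rcases hh : D.ends (e, x) with u | u | u <;> simp [compEnds, hh]
  · rcases hh : D'.ends (e, x) with u | u | u <;> simp [compEnds, hh]

theorem compEnds_eq_right (h) (v : D'.V) : D.compEnds D' h = Sum.inl (Sum.inr (Sum.inl v)) ↔
    ∃ h₀, D'.ends h₀ = Sum.inl v ∧ (Sum.inr h₀.1, h₀.2) = h := by
  rcases h with ⟨e | e, x⟩
  · rcases hh : D.ends (e, x) with u | u | u <;> simp [compEnds, hh]
  · rcases hh : D'.ends (e, x) with u | u | u <;> simp [compEnds, hh]

theorem compEnds_eq_joint (h) (j : Fin m) : D.compEnds D' h = Sum.inl (Sum.inr (Sum.inr j)) ↔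
    h = (Sum.inl (D.port (Sum.inr j)).1, (D.port (Sum.inr j)).2) ∨
    h = (Sum.inr (D'.port (Sum.inl j)).1, (D'.port (Sum.inl j)).2) := by
  rcases h with ⟨e | e, x⟩
  · have := D.ends_eq_inr_iff (h := (e, x)) (p := Sum.inr j)
    rcases hh : D.ends (e, x) with u | u | u <;>
      simpa [compEnds, hh, Prod.ext_iff] using this
  · have := D'.ends_eq_inr_iff (h := (e, x)) (p := Sum.inl j)
    rcases hh : D'.ends (e, x) with u | u | u <;>
      simpa [compEnds, hh, Prod.ext_iff] using this

/-- The ends that the inputs and outputs of a sequential composition carry. -/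
noncomputable def compPort : Fin n ⊕ Fin k → (D.E ⊕ D'.E) × Bool :=
  Sum.elim (fun i => (Sum.inl (D.port (Sum.inl i)).1, (D.port (Sum.inl i)).2))
    fun i => (Sum.inr (D'.port (Sum.inr i)).1, (D'.port (Sum.inr i)).2)

theorem compEnds_eq_inr (h) (p : Fin n ⊕ Fin k) :
    D.compEnds D' h = Sum.inr p ↔ h = D.compPort D' p := by
  rcases h with ⟨e | e, x⟩ <;> rcases p with p | p
  · have := D.ends_eq_inr_iff (h := (e, x)) (p := Sum.inl p)
    rcases hh : D.ends (e, x) with u | u | u <;>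
      simpa [compEnds, compPort, hh, Prod.ext_iff] using this
  · rcases hh : D.ends (e, x) with u | u | u <;> simp [compEnds, compPort, hh]
  · rcases hh : D'.ends (e, x) with u | u | u <;> simp [compEnds, compPort, hh]
  · have := D'.ends_eq_inr_iff (h := (e, x)) (p := Sum.inr p)
    rcases hh : D'.ends (e, x) with u | u | u <;>
      simpa [compEnds, compPort, hh, Prod.ext_iff] using this

theorem lift_left_injective {A B : Type} :
    Function.Injective fun h : A × Bool => ((Sum.inl h.1, h.2) : (A ⊕ B) × Bool) := by
  rintro ⟨e, x⟩ ⟨e', x'⟩ h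
  simpa using h

theorem lift_right_injective {A B : Type} :
    Function.Injective fun h : B × Bool => ((Sum.inr h.1, h.2) : (A ⊕ B) × Bool) := by
  rintro ⟨e, x⟩ ⟨e', x'⟩ h
  simpa using h

/-- Keeps the condition that Hadamard boxes have two legs when a diagram becomes part of a larger
one. -/
theorem card_filter_ends {V V' E E' P P' : Type} [Fintype E] [Fintype E'] [DecidableEq V]
    [DecidableEq V'] [DecidableEq P] [DecidableEq P'] {ends : E × Bool → V ⊕ P}
    {ends' : E' × Bool → V' ⊕ P'} {f : E × Bool → E' × Bool}
    (hf : Function.Injective f) {v : V} {v' : V'}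
    (h : ∀ x, ends' x = Sum.inl v' ↔ ∃ y, ends y = Sum.inl v ∧ f y = x) :
    (Finset.univ.filter fun x => ends' x = Sum.inl v').card =
      (Finset.univ.filter fun x => ends x = Sum.inl v).card := by
  rw [← Finset.card_map ⟨f, hf⟩]
  congr 1; ext x; simp [h]

/-- Sequential composition: each output of `D` is joined to an input of `D'` by a phase-free
Z-spider. -/
def comp : ZXDiagram n k O where
  V := D.V ⊕ (D'.V ⊕ Fin m)
  E := D.E ⊕ D'.E
  kind := Sum.elim D.kind (Sum.elim D'.kind fun _ => Node.z 0 0)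
  ends := D.compEnds D'
  noisy := Sum.elim D.noisy D'.noisy
  boundary := fun p => ⟨D.compPort D' p, (D.compEnds_eq_inr D' _ p).2 rfl,
    fun h hh => (D.compEnds_eq_inr D' h p).1 hh⟩
  hadamard := by
    rintro (v | v | v) hv
    · exact (card_filter_ends lift_left_injective fun h => D.compEnds_eq_left D' h v).trans
        (D.hadamard v hv)
    · exact (card_filter_ends lift_right_injective fun h => D.compEnds_eq_right D' h v).trans
        (D'.hadamard v hv)
    · simp at hv

/-- A joining spider is a Kronecker delta between an output end of `D` and an input end of `D'`; the
common value is the summation index of the matrix product. -/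
theorem eval_comp (F : D.E → Pauli) (F' : D'.E → Pauli) (s : O → ZMod 2) :
    (D.comp D').eval (Sum.elim F F') s = D'.eval F' s * D.eval F s := by
  ext o i
  rw [Matrix.mul_apply]
  refine ((D.comp D').eval_eq_netEval (port := D.compPort D')
    (fun p => (D.compEnds_eq_inr D' _ p).2 rfl) _ _ _ _).trans ?_
  change netEval (Sum.elim D.kind (Sum.elim D'.kind fun _ => Node.z 0 0)) (D.compEnds D')
    (D.compPort D') (Sum.elim F F') s (Sum.elim i o) = _
  simp only [D.eval_eq_netEval D.ends_port, D'.eval_eq_netEval D'.ends_port, netEval]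
  rw [sum_sum_prod_bool]
  simp only [Finset.sum_mul_sum]
  rw [Finset.sum_comm]
  rw [Finset.sum_comm (s := Finset.univ (α := Fin m → ZMod 2))]
  refine Finset.sum_congr rfl fun b₂ _ => ?_
  rw [Finset.sum_comm]
  refine Finset.sum_congr rfl fun b₁ _ => ?_
  simp only [Fintype.prod_sum_type, Sum.elim_inl, Sum.elim_inr]
  set b : (D.E ⊕ D'.E) × Bool → ZMod 2 :=
    fun h => Sum.elim (fun e => b₁ (e, h.2)) (fun e => b₂ (e, h.2)) h.1 with hb
  have hleft : ∀ v, (D.kind v).tensor s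
      (Finset.univ.filter fun h => D.compEnds D' h = Sum.inl (Sum.inl v)) b =
      (D.kind v).tensor s (Finset.univ.filter fun h => D.ends h = Sum.inl v) b₁ := fun v =>
    Node.tensor_of_image _ s lift_left_injective (fun h => by
      simpa using D.compEnds_eq_left D' h v) b
  have hright : ∀ v, (D'.kind v).tensor s
      (Finset.univ.filter fun h => D.compEnds D' h = Sum.inl (Sum.inr (Sum.inl v))) b =
      (D'.kind v).tensor s (Finset.univ.filter fun h => D'.ends h = Sum.inl v) b₂ := fun v =>
    Node.tensor_of_image _ s lift_right_injective (fun h => by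
      simpa using D.compEnds_eq_right D' h v) b
  have hjoint : ∀ j : Fin m, (Node.z 0 0).tensor s
      (Finset.univ.filter fun h => D.compEnds D' h = Sum.inl (Sum.inr (Sum.inr j))) b =
      if b₁ (D.port (Sum.inr j)) = b₂ (D'.port (Sum.inl j)) then 1 else 0 := fun j => by
    have : (Finset.univ.filter fun h => D.compEnds D' h = Sum.inl (Sum.inr (Sum.inr j))) =
        {(Sum.inl (D.port (Sum.inr j)).1, (D.port (Sum.inr j)).2),
          (Sum.inr (D'.port (Sum.inl j)).1, (D'.port (Sum.inl j)).2)} := by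
      ext h
      simpa using D.compEnds_eq_joint D' h j
    rw [this]
    exact Node.tensor_z_zero_pair s _ _ b
  simp only [hleft, hright, hjoint, prod_ite_zero', Finset.prod_const_one]
  -- For fixed values at all ends, the only intermediate basis state that contributes is the one
  -- read off at the outputs of `D`.
  rw [Finset.sum_eq_single fun j => b₁ (D.port (Sum.inr j))]
  · have hc : (∀ p, b (D.compPort D' p) = Sum.elim i o p) ↔
        (∀ p, b₁ (D.port (Sum.inl p)) = i p) ∧ ∀ p, b₂ (D'.port (Sum.inr p)) = o p := by
      simp only [compPort, Sum.forall, hb, Sum.elim_inl, Sum.elim_inr, Prod.mk.eta]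
    rw [if_congr hc rfl rfl]
    simp only [Sum.forall, Sum.elim_inl, Sum.elim_inr]
    by_cases h1 : ∀ p, b₁ (D.port (Sum.inl p)) = i p
    · by_cases h2 : ∀ p, b₂ (D'.port (Sum.inr p)) = o p
      · by_cases h3 : ∀ j, b₁ (D.port (Sum.inr j)) = b₂ (D'.port (Sum.inl j))
        · have h3' : ∀ j, b₂ (D'.port (Sum.inl j)) = b₁ (D.port (Sum.inr j)) :=
            fun j => (h3 j).symm
          simp only [h1, h2, h3', implies_true, and_self, if_true]
          ring
        · have h3' : ¬ ∀ j, b₂ (D'.port (Sum.inl j)) = b₁ (D.port (Sum.inr j)) :=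
            fun h => h3 fun j => (h j).symm
          simp only [h3, h3', false_and, if_false]
          simp
      · simp only [h2, and_false, if_false, zero_mul]
    · simp only [h1, false_and, if_false, mul_zero]
  · intro c _ hc
    rw [if_neg (c := ∀ p, b₁ (D.port p) = Sum.elim i c p), mul_zero]
    intro h
    exact hc (funext fun j => (h (Sum.inr j)).symm)
  · simp

end comp

end ZXDiagram

theorem pauliEntry_zero (a b : ZMod 2) : pauliEntry 0 a b = if a = b then 1 else 0 := by
  simp [pauliEntry, sgn_zero]

theorem sum_sigma_prod_bool {ι : Type} [Fintype ι] [DecidableEq ι] {E : ι → Type}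
    [∀ g, Fintype (E g)] [∀ g, DecidableEq (E g)] (f : ∀ g, (E g × Bool → ZMod 2) → ℂ) :
    ∑ b : (Σ g, E g) × Bool → ZMod 2, ∏ g, f g (fun h => b (⟨g, h.1⟩, h.2)) =
      ∏ g, ∑ b, f g b := by
  rw [Finset.prod_univ_sum, Fintype.piFinset_univ]
  exact Fintype.sum_equiv
    { toFun := fun b g h => b (⟨g, h.1⟩, h.2)
      invFun := fun c h => c h.1.1 (h.1.2, h.2)
      left_inv := fun b => rfl
      right_inv := fun c => rfl } _ _ fun b => rfl

namespace ZXDiagram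

variable {n m k : ℕ} {O : Type}

/-! ### Parallel composition -/

section tens

variable {ι : Type} {p q : ι → ℕ}
  (D : ∀ g, ZXDiagram (p g) (q g) O) (wi : (Σ g, Fin (p g)) ≃ Fin n)
  (wo : (Σ g, Fin (q g)) ≃ Fin m)

/-- The ends of the edges in a parallel composition. -/
def tensEnds : (Σ g, (D g).E) × Bool → (Σ g, (D g).V) ⊕ (Fin n ⊕ Fin m) := fun h =>
  Sum.map (Sigma.mk h.1.1) (Sum.map (fun j => wi ⟨h.1.1, j⟩) fun j => wo ⟨h.1.1, j⟩)
    ((D h.1.1).ends (h.1.2, h.2))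

/-- The ends that the inputs and outputs of a parallel composition carry. -/
noncomputable def tensPort : Fin n ⊕ Fin m → (Σ g, (D g).E) × Bool :=
  Sum.elim
    (fun i => (⟨_, ((D (wi.symm i).1).port (Sum.inl (wi.symm i).2)).1⟩,
      ((D (wi.symm i).1).port (Sum.inl (wi.symm i).2)).2))
    fun i => (⟨_, ((D (wo.symm i).1).port (Sum.inr (wo.symm i).2)).1⟩,
      ((D (wo.symm i).1).port (Sum.inr (wo.symm i).2)).2)

theorem tensPort_inl (g : ι) (j : Fin (p g)) : tensPort D wi wo (Sum.inl (wi ⟨g, j⟩)) =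
    (⟨g, ((D g).port (Sum.inl j)).1⟩, ((D g).port (Sum.inl j)).2) := by
  simp only [tensPort, Sum.elim_inl]
  rw [wi.symm_apply_apply]

theorem tensPort_inr (g : ι) (j : Fin (q g)) : tensPort D wi wo (Sum.inr (wo ⟨g, j⟩)) =
    (⟨g, ((D g).port (Sum.inr j)).1⟩, ((D g).port (Sum.inr j)).2) := by
  simp only [tensPort, Sum.elim_inr]
  rw [wo.symm_apply_apply]

theorem lift_sigma_injective {E : ι → Type} (g : ι) :
    Function.Injective fun h : E g × Bool => ((⟨g, h.1⟩, h.2) : (Σ g, E g) × Bool) := by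
  rintro ⟨e, x⟩ ⟨e', x'⟩ h
  simpa using h

theorem tensEnds_eq_inl (h) (g : ι) (v : (D g).V) : tensEnds D wi wo h = Sum.inl ⟨g, v⟩ ↔
    ∃ h₀, (D g).ends h₀ = Sum.inl v ∧ (⟨g, h₀.1⟩, h₀.2) = h := by
  obtain ⟨⟨g', e⟩, x⟩ := h
  constructor
  · intro hh
    rcases hv : (D g').ends (e, x) with u | u
    · simp only [tensEnds, hv, Sum.map_inl, Sum.inl.injEq] at hh
      cases hh
      exact ⟨(e, x), hv, rfl⟩
    · simp [tensEnds, hv] at hh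
  · rintro ⟨⟨e', x'⟩, h1, h2⟩
    cases h2
    simp [tensEnds, h1]

theorem tensEnds_tensPort (a : Fin n ⊕ Fin m) :
    tensEnds D wi wo (tensPort D wi wo a) = Sum.inr a := by
  rcases a with a | a
  · obtain ⟨⟨g, j⟩, rfl⟩ := wi.surjective a
    rw [tensPort_inl]
    simp [tensEnds, ends_port]
  · obtain ⟨⟨g, j⟩, rfl⟩ := wo.surjective a
    rw [tensPort_inr]
    simp [tensEnds, ends_port]

theorem eq_tensPort {h} {a : Fin n ⊕ Fin m} (hh : tensEnds D wi wo h = Sum.inr a) :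
    h = tensPort D wi wo a := by
  obtain ⟨⟨g, e⟩, x⟩ := h
  rcases hv : (D g).ends (e, x) with u | u | u
  · simp [tensEnds, hv] at hh
  · simp only [tensEnds, hv, Sum.map_inr, Sum.map_inl, Sum.inr.injEq] at hh
    rw [← hh, tensPort_inl, ← (D g).ends_eq_inr_iff.1 hv]
  · simp only [tensEnds, hv, Sum.map_inr, Sum.inr.injEq] at hh
    rw [← hh, tensPort_inr, ← (D g).ends_eq_inr_iff.1 hv]

variable [Fintype ι] [DecidableEq ι]

/-- Parallel composition. -/
def tens : ZXDiagram n m O where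
  V := Σ g, (D g).V
  E := Σ g, (D g).E
  kind := fun v => (D v.1).kind v.2
  ends := tensEnds D wi wo
  noisy := fun e => (D e.1).noisy e.2
  boundary := fun a => ⟨_, tensEnds_tensPort D wi wo a, fun _ => eq_tensPort D wi wo⟩
  hadamard := by
    rintro ⟨g, v⟩ hv
    exact (card_filter_ends (lift_sigma_injective g) fun h => tensEnds_eq_inl D wi wo h g v).trans
      ((D g).hadamard v hv)

/-- The network is a disjoint union, so assignments are independent choices for the parts and the
sum of products is a product of sums. -/
theorem eval_tens (F : ∀ g, (D g).E → Pauli) (s : O → ZMod 2) (o : Fin m → ZMod 2)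
    (i : Fin n → ZMod 2) : (tens D wi wo).eval (fun e => F e.1 e.2) s o i =
      ∏ g, (D g).eval (F g) s (fun j => o (wo ⟨g, j⟩)) (fun j => i (wi ⟨g, j⟩)) := by
  refine ((tens D wi wo).eval_eq_netEval (tensEnds_tensPort D wi wo) _ _ _ _).trans ?_
  change netEval (fun v : Σ g, (D g).V => (D v.1).kind v.2) (tensEnds D wi wo)
    (tensPort D wi wo) (fun e => F e.1 e.2) s (Sum.elim i o) = _
  simp only [fun g => (D g).eval_eq_netEval (D g).ends_port, netEval]
  rw [← sum_sigma_prod_bool]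
  refine Finset.sum_congr rfl fun b _ => ?_
  have hc : (∀ a, b (tensPort D wi wo a) = Sum.elim i o a) ↔
      ∀ g a, b (⟨g, ((D g).port a).1⟩, ((D g).port a).2) =
        Sum.elim (fun j => i (wi ⟨g, j⟩)) (fun j => o (wo ⟨g, j⟩)) a := by
    simp only [Sum.forall, ← wi.forall_congr_right, ← wo.forall_congr_right, Sigma.forall,
      tensPort_inl, tensPort_inr, Sum.elim_inl, Sum.elim_inr]
    exact forall_and.symm
  have ht : ∀ g v, ((D g).kind v).tensor s
      (Finset.univ.filter fun h => tensEnds D wi wo h = Sum.inl ⟨g, v⟩) b =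
      ((D g).kind v).tensor s (Finset.univ.filter fun h => (D g).ends h = Sum.inl v)
        fun h => b (⟨g, h.1⟩, h.2) := fun g v =>
    Node.tensor_of_image _ s (lift_sigma_injective g) (fun h => by
      simpa using tensEnds_eq_inl D wi wo h g v) b
  rw [if_congr hc rfl rfl, prod_ite_zero']
  simp only [Fintype.prod_sigma, ht, Finset.prod_mul_distrib]

end tens

/-! ### Wires and one-legged nodes -/

/-- The identity diagram, whose edges are the wires. -/
def wires (n : ℕ) (O : Type) : ZXDiagram n n O where
  V := Empty
  E := Fin n
  kind := Empty.elim
  ends := fun h => Sum.inr (if h.2 then Sum.inr h.1 else Sum.inl h.1)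
  noisy := fun _ => False
  boundary := by
    rintro (p | p)
    · refine ⟨(p, false), rfl, ?_⟩
      rintro ⟨e, _ | _⟩ <;> simp
    · refine ⟨(p, true), rfl, ?_⟩
      rintro ⟨e, _ | _⟩ <;> simp
  hadamard := by rintro ⟨⟩

theorem eval_wires (F : Fin n → Pauli) (s : O → ZMod 2) :
    (wires n O).eval F s = pauliMat F := by
  ext o i
  refine ((wires n O).eval_eq_netEval
    (port := Sum.elim (fun j => (j, false)) fun j => (j, true)) ?_ _ _ _ _).trans ?_
  · rintro (p | p) <;> rfl
  change netEval Empty.elim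
    (fun h : Fin n × Bool => Sum.inr (if h.2 then Sum.inr h.1 else Sum.inl h.1))
    (Sum.elim (fun j => (j, false)) fun j => (j, true)) F s (Sum.elim i o) = _
  -- Both ends of every wire are ports, so the boundary values leave a single assignment.
  rw [netEval, Finset.sum_eq_single fun h => if h.2 then o h.1 else i h.1]
  · rw [if_pos]
    · simp [pauliMat]
    · rintro (p | p) <;> rfl
  · intro b _ hb
    rw [if_neg]
    intro h
    refine hb (funext fun ⟨j, x⟩ => ?_)
    cases x
    · exact h (Sum.inl j)
    · exact h (Sum.inr j)
  · simp

/-- The diagram that puts a one-legged node on each input and each output. -/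
def caps (κ : Fin n ⊕ Fin m → Node O) (hκ : ∀ p, κ p ≠ Node.had) : ZXDiagram n m O where
  V := Fin n ⊕ Fin m
  E := Fin n ⊕ Fin m
  kind := κ
  ends := fun h => if h.2 then Sum.inl h.1 else Sum.inr h.1
  noisy := fun _ => False
  boundary := fun p => by
    refine ⟨(p, false), rfl, ?_⟩
    rintro ⟨e, _ | _⟩ <;> simp
  hadamard := fun p hp => absurd hp (hκ p)

theorem eval_caps (κ : Fin n ⊕ Fin m → Node O) (hκ : ∀ p, κ p ≠ Node.had) (s : O → ZMod 2)
    (o : Fin m → ZMod 2) (i : Fin n → ZMod 2) : (caps κ hκ).eval 0 s o i =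
      ∏ p, (κ p).tensor s {()} fun _ => Sum.elim i o p := by
  refine ((caps κ hκ).eval_eq_netEval (port := fun p => (p, false)) (fun p => rfl) _ _ _ _).trans ?_
  change netEval κ (fun h : (Fin n ⊕ Fin m) × Bool => if h.2 then Sum.inl h.1 else Sum.inr h.1)
    (fun p => (p, false)) 0 s (Sum.elim i o) = _
  have hl : ∀ p, (Finset.univ.filter fun h : (Fin n ⊕ Fin m) × Bool =>
      (if h.2 then Sum.inl h.1 else Sum.inr h.1 : (Fin n ⊕ Fin m) ⊕ (Fin n ⊕ Fin m)) =
        Sum.inl p) = {(p, true)} := by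
    intro p; ext ⟨e, _ | _⟩ <;> simp
  simp only [netEval, hl, Pi.zero_apply, pauliEntry_zero, prod_ite_zero', Finset.prod_const_one]
  -- The identity on each edge forces the end at the node to agree with the end at the boundary.
  rw [Finset.sum_eq_single fun h => Sum.elim i o h.1]
  · rw [if_pos fun p => rfl, if_pos fun p => rfl, mul_one]
    refine Finset.prod_congr rfl fun p _ => ?_
    exact Node.tensor_of_image (κ p) s (f := fun _ : Unit => (p, true))
      (fun _ _ _ => rfl) (fun x => by simp [eq_comm]) _
  · intro b _ hb
    split_ifs with h1 h2
    · refine absurd (funext fun ⟨p, x⟩ => ?_) hb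
      cases x
      · exact h1 p
      · exact (h2 p).trans (h1 p)
    · simp
    · rfl
  · simp

end ZXDiagram

/-! ## Pauli boxes -/

theorem I_pow_val_add (a b : ZMod 4) :
    Complex.I ^ (a + b).val = Complex.I ^ a.val * Complex.I ^ b.val := by
  rw [ZMod.val_add, ← pow_add, Complex.I_pow_eq_pow_mod (a.val + b.val)]

theorem exists_prod_I_pow {ι : Type*} (s : Finset ι) (j : ι → ZMod 4) :
    ∏ i ∈ s, Complex.I ^ (j i).val = Complex.I ^ (∑ i ∈ s, j i).val := by
  classical
  induction s using Finset.induction_on with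
  | empty => simp
  | insert a s ha ih => rw [Finset.sum_insert ha, Finset.prod_insert ha, I_pow_val_add, ih]

theorem inv_sqrt_two_mul_self :
    ((1 / Real.sqrt 2 : ℝ) : ℂ) * ((1 / Real.sqrt 2 : ℝ) : ℂ) = 1 / 2 := by
  rw [← Complex.ofReal_mul]
  have : (1 / Real.sqrt 2) * (1 / Real.sqrt 2) = (1 / 2 : ℝ) := by
    rw [div_mul_div_comm, Real.mul_self_sqrt (by norm_num), one_mul]
  rw [this]; norm_num

namespace Node

variable {O H : Type}

/-- The matrix of a two-legged node. -/
noncomputable def pairTensor (v : Node O) (s : O → ZMod 2) (a c : ZMod 2) : ℂ :=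
  v.tensor s Finset.univ fun t : Bool => if t then c else a

theorem tensor_pair (v : Node O) (s : O → ZMod 2) [DecidableEq H] {x y : H} (hxy : x ≠ y)
    (b : H → ZMod 2) : v.tensor s {x, y} b = v.pairTensor s (b x) (b y) := by
  refine (v.tensor_of_image s (f := fun t : Bool => if t then y else x) (S := Finset.univ)
    ?_ ?_ b).trans ?_
  · rintro (_ | _) (_ | _) h <;> simp_all [eq_comm]
  · intro z; simp [eq_comm, or_comm]
  · congr 1; funext t; cases t <;> rfl

theorem pairTensor_z (s : O → ZMod 2) (a c : ZMod 2) :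
    (z 0 0 : Node O).pairTensor s a c = if a = c then 1 else 0 := by
  rcases zmod_two_cases a with rfl | rfl <;> rcases zmod_two_cases c with rfl | rfl <;>
    simp [pairTensor, tensor, phaseFactor, sgn_zero]

theorem pairTensor_had (s : O → ZMod 2) (a c : ZMod 2) :
    (had : Node O).pairTensor s a c = ((1 / Real.sqrt 2 : ℝ) : ℂ) * sgn (a * c) := by
  rcases zmod_two_cases a with rfl | rfl <;> rcases zmod_two_cases c with rfl | rfl <;>
    simp [pairTensor, tensor, sgn_zero, sgn_one]

theorem pairTensor_x (s : O → ZMod 2) (p : ZMod 4) (a c : ZMod 2) :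
    (x p 0 : Node O).pairTensor s a c = 1 / 2 * (1 + Complex.I ^ p.val * sgn (a + c)) := by
  have := inv_sqrt_two_mul_self
  simp only [pairTensor, tensor, phaseFactor, Pi.zero_apply, sgn_zero, mul_one,
    Fintype.univ_bool, Finset.mem_singleton, Bool.true_eq_false, not_false_eq_true,
    Finset.prod_insert, Finset.prod_singleton, if_true, Bool.false_eq_true, if_false, sgn_add]
  linear_combination (1 + Complex.I ^ p.val * sgn a * sgn c) * this

/-- The matrix of a Pauli box whose leg carries the state `|0⟩ + (-1) ^ z |1⟩`. -/
noncomputable def boxTensor (s : O → ZMod 2) (p : Pauli) (z a c : ZMod 2) : ℂ :=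
  ∑ l, (boxBefore p : Node O).pairTensor s a l * (boxAfter p : Node O).pairTensor s l c *
    sgn (z * l)

theorem I_pow_three_val : Complex.I ^ (3 : ZMod 4).val = -Complex.I := Complex.I_pow_three

theorem I_pow_one_val : Complex.I ^ (1 : ZMod 4).val = Complex.I := pow_one _

theorem I_pow_two_val : Complex.I ^ (2 : ZMod 4).val = -1 := Complex.I_sq

theorem zmod_four_neg_one : (-1 : ZMod 4) = 3 := rfl

/-- The core with its leg acts as Z^z, and conjugation by Hadamards turns it into X^z; concretely,
half the sum of (-1)^(l(a+c+z)) over l is a delta. -/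
theorem boxTensor_X (s : O → ZMod 2) (z a c : ZMod 2) :
    boxTensor s Pauli.X z a c = if c = a + z then 1 else 0 := by
  have h := inv_sqrt_two_mul_self
  have hb : boxTensor s Pauli.X z a c = ((1 / Real.sqrt 2 : ℝ) : ℂ) * ((1 / Real.sqrt 2 : ℝ) : ℂ) *
      ∑ l, sgn (a * l) * sgn (l * c) * sgn (z * l) := by
    simp only [boxTensor, boxBefore, boxAfter, if_true, pairTensor_had, Finset.mul_sum]
    refine Finset.sum_congr rfl fun l _ => ?_
    ring
  rw [hb, h, sum_zmod_two]
  rcases zmod_two_cases a with rfl | rfl <;> rcases zmod_two_cases c with rfl | rfl <;>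
    rcases zmod_two_cases z with rfl | rfl <;>
    simp [sgn_zero, sgn_one, CharTwo.add_self_eq_zero] <;> norm_num

theorem boxTensor_Z (s : O → ZMod 2) (p : Pauli) (hX : p ≠ Pauli.X) (hY : p ≠ Pauli.Y)
    (z a c : ZMod 2) : boxTensor s p z a c = if c = a then sgn (z * a) else 0 := by
  simp only [boxTensor, boxBefore, boxAfter, if_neg hX, if_neg hY, pairTensor_z, ite_mul, mul_ite,
    one_mul, zero_mul, mul_zero, Finset.sum_ite_eq', Finset.mem_univ, if_true]
  by_cases h : a = c
  · rw [if_pos h, if_pos h.symm, h]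
  · rw [if_neg h, if_neg (Ne.symm h)]

/-- Red spiders of phase ± π/2 rotate Z into Y. The result is the Hermitian Y = i X Z, which
accounts for the factor i. -/
theorem boxTensor_Y (s : O → ZMod 2) (z a c : ZMod 2) : boxTensor s Pauli.Y z a c =
    if c = a + z then (if z = 0 then 1 else Complex.I * sgn a) else 0 := by
  have hI := Complex.I_mul_I
  have hb : boxTensor s Pauli.Y z a c = ∑ l, 1 / 4 * ((1 + Complex.I * sgn (a + l)) *
      (1 - Complex.I * sgn (l + c))) * sgn (z * l) := by
    have hYX : Pauli.Y ≠ Pauli.X := by decide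
    simp only [boxTensor, boxBefore, boxAfter, if_true, if_neg hYX, pairTensor_x,
      zmod_four_neg_one, I_pow_three_val, I_pow_one_val]
    refine Finset.sum_congr rfl fun l _ => ?_
    ring
  rw [hb, sum_zmod_two]
  rcases zmod_two_cases a with rfl | rfl <;> rcases zmod_two_cases c with rfl | rfl <;>
    rcases zmod_two_cases z with rfl | rfl <;>
    simp [sgn_zero, sgn_one, CharTwo.add_self_eq_zero] <;>
    first
    | ring1
    | linear_combination hI
    | linear_combination (1 / 2 : ℂ) * hI
    | linear_combination (-1 / 2 : ℂ) * hI

theorem pauli_cases (p : Pauli) : p = 0 ∨ p = Pauli.X ∨ p = Pauli.Y ∨ p = Pauli.Z := by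
  revert p; decide

/-- For every type of box the neighbours of the core are inverse to each other, so a box with a
trivial leg is a wire. -/
theorem boxTensor_zero (s : O → ZMod 2) (p : Pauli) (a c : ZMod 2) :
    boxTensor s p 0 a c = if c = a then 1 else 0 := by
  by_cases hX : p = Pauli.X
  · rw [hX, boxTensor_X, add_zero]
  by_cases hY : p = Pauli.Y
  · rw [hY, boxTensor_Y, add_zero, if_pos rfl]
  · rw [boxTensor_Z s p hX hY, zero_mul, sgn_zero]

/-- The exponent is nonzero only for Y, where the box is i X Z and `pauliEntry` is X Z. It is chosen
before the outcomes and the matrix entry, so that it can be taken out of the contraction as a global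
phase. -/
theorem exists_boxTensor_one (p : Pauli) (hp : p ≠ 0) : ∃ j : ZMod 4, ∀ (s : O → ZMod 2) a c,
    boxTensor s p 1 a c = Complex.I ^ j.val * pauliEntry p c a := by
  rcases pauli_cases p with rfl | rfl | rfl | rfl
  · exact absurd rfl hp
  · exact ⟨0, fun s a c => by simp [boxTensor_X, pauliEntry, sgn_zero]⟩
  · exact ⟨1, fun s a c => by simp [boxTensor_Y, pauliEntry, I_pow_one_val]⟩
  · exact ⟨0, fun s a c => by
      rw [boxTensor_Z s _ (by decide) (by decide)]; simp [pauliEntry]⟩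

theorem sum_pauliEntry_mul (f p : Pauli) (a x : ZMod 2) :
    ∑ y, pauliEntry f a y * pauliEntry p y x = sgn (f.2 * p.1) * pauliEntry (f + p) a x := by
  have h1 : ∀ y, pauliEntry f a y * pauliEntry p y x =
      if y = x + p.1 then pauliEntry f a y * sgn (p.2 * x) else 0 := by
    intro y; simp only [pauliEntry, mul_ite, mul_zero]
  rw [Finset.sum_congr rfl fun y _ => h1 y, Finset.sum_ite_eq' Finset.univ,
    if_pos (Finset.mem_univ _)]
  simp only [pauliEntry, Prod.fst_add, Prod.snd_add, ite_mul, zero_mul, mul_ite, mul_zero]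
  refine if_congr (by rw [add_assoc, add_comm p.1]) ?_ rfl
  rw [← sgn_add, ← sgn_add]; congr 1; ring

/-- A Pauli box followed by a Pauli is a Pauli, up to a fourth root of unity. -/
theorem exists_sum_pauliEntry_mul_boxTensor (f p : Pauli) (hp : p ≠ 0) : ∃ j : ZMod 4,
    ∀ (s : O → ZMod 2) a x, ∑ y, pauliEntry f a y * boxTensor s p 1 x y =
      Complex.I ^ j.val * pauliEntry (f + p) a x := by
  obtain ⟨j, hj⟩ := exists_boxTensor_one (O := O) p hp
  have hs : ∃ j' : ZMod 4, sgn (f.2 * p.1) = Complex.I ^ j'.val := by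
    rcases zmod_two_cases (f.2 * p.1) with h | h
    · exact ⟨0, by rw [h]; simp [sgn_zero]⟩
    · exact ⟨2, by rw [h, I_pow_two_val, sgn_one]⟩
  obtain ⟨j', hj'⟩ := hs
  refine ⟨j + j', fun s a x => ?_⟩
  rw [I_pow_val_add, ← hj', mul_assoc, ← sum_pauliEntry_mul, Finset.mul_sum]
  refine Finset.sum_congr rfl fun y _ => ?_
  rw [hj]; ring

theorem sum_pauliEntry_mul_boxTensor_zero (f p : Pauli) (s : O → ZMod 2) (a x : ZMod 2) :
    ∑ y, pauliEntry f a y * boxTensor s p 0 x y = pauliEntry f a x := by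
  simp [boxTensor_zero]

end Node

/-! ## Evaluating fault gadgets -/

namespace GadgetNode

theorem prod_eq {S M : Type} [Fintype S] [DecidableEq S] [CommMonoid M] (f : GadgetNode S → M) :
    ∏ v, f v = (∏ e, f (pre e)) * (∏ e, f (core e)) * (∏ e, f (post e)) * f hub * f tip := by
  let φ : GadgetNode S ≃ ((S ⊕ S) ⊕ S) ⊕ Bool :=
    { toFun := fun v => match v with
        | pre e => Sum.inl (Sum.inl (Sum.inl e))
        | core e => Sum.inl (Sum.inl (Sum.inr e))
        | post e => Sum.inl (Sum.inr e)
        | hub => Sum.inr false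
        | tip => Sum.inr true
      invFun := fun v => match v with
        | Sum.inl (Sum.inl (Sum.inl e)) => pre e
        | Sum.inl (Sum.inl (Sum.inr e)) => core e
        | Sum.inl (Sum.inr e) => post e
        | Sum.inr false => hub
        | Sum.inr true => tip
      left_inv := by rintro (_ | _ | _ | _ | _) <;> rfl
      right_inv := by rintro (((_ | _) | _) | _ | _) <;> rfl }
  rw [← φ.symm.prod_comp]
  simp only [Fintype.prod_sum_type, Fintype.prod_bool]
  rw [mul_comm (f (φ.symm (Sum.inr true))), ← mul_assoc]
  rfl

end GadgetNode

namespace GadgetEdge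

theorem prod_eq {S M : Type} [Fintype S] [DecidableEq S] [CommMonoid M] (f : GadgetEdge S → M) :
    ∏ v, f v = (∏ e, f (enter e)) * (∏ e, f (left e)) * (∏ e, f (right e)) * (∏ e, f (link e)) *
      f flip := by
  let φ : GadgetEdge S ≃ (((S ⊕ S) ⊕ S) ⊕ S) ⊕ Unit :=
    { toFun := fun v => match v with
        | enter e => Sum.inl (Sum.inl (Sum.inl (Sum.inl e)))
        | left e => Sum.inl (Sum.inl (Sum.inl (Sum.inr e)))
        | right e => Sum.inl (Sum.inl (Sum.inr e))
        | link e => Sum.inl (Sum.inr e)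
        | flip => Sum.inr ()
      invFun := fun v => match v with
        | Sum.inl (Sum.inl (Sum.inl (Sum.inl e))) => enter e
        | Sum.inl (Sum.inl (Sum.inl (Sum.inr e))) => left e
        | Sum.inl (Sum.inl (Sum.inr e)) => right e
        | Sum.inl (Sum.inr e) => link e
        | Sum.inr () => flip
      left_inv := by rintro (_ | _ | _ | _ | _) <;> rfl
      right_inv := by rintro ((((_ | _) | _) | _) | ⟨⟩) <;> rfl }
  rw [← φ.symm.prod_comp]
  simp only [Fintype.prod_sum_type, Fintype.prod_unique]
  rfl

end GadgetEdge

/-- The values at the new ends of edges that belong to a Pauli box. -/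
structure BoxEnds : Type where
  out : ZMod 2
  enter : ZMod 2
  left : ZMod 2 × ZMod 2
  right : ZMod 2 × ZMod 2
  link : ZMod 2 × ZMod 2

namespace BoxEnds

/-- Box ends as tuples. -/
def equivProd : BoxEnds ≃
    ZMod 2 × ZMod 2 × (ZMod 2 × ZMod 2) × (ZMod 2 × ZMod 2) × (ZMod 2 × ZMod 2) where
  toFun x := (x.out, x.enter, x.left, x.right, x.link)
  invFun x := ⟨x.1, x.2.1, x.2.2.1, x.2.2.2.1, x.2.2.2.2⟩
  left_inv _ := rfl
  right_inv _ := rfl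

instance : Fintype BoxEnds := Fintype.ofEquiv _ equivProd.symm

theorem sum_eq (f : BoxEnds → ℂ) : ∑ x, f x = ∑ y, ∑ t, ∑ l, ∑ l', ∑ r, ∑ r', ∑ k, ∑ k',
    f ⟨y, t, (l, l'), (r, r'), (k, k')⟩ := by
  rw [← equivProd.symm.sum_comp]
  simp only [Fintype.sum_prod_type]
  rfl

end BoxEnds

/-- The contribution of one Pauli box, in which the wire enters with value `x`. -/
noncomputable def boxTerm {O : Type} (s : O → ZMod 2) (p : Pauli) (x : ZMod 2) (m : BoxEnds) : ℂ :=
  (boxBefore p : Node O).pairTensor s m.enter m.left.1 *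
    (if m.left.2 = m.right.1 ∧ m.right.1 = m.link.1 then 1 else 0) *
    (boxAfter p : Node O).pairTensor s m.right.2 m.out *
    ((if m.enter = x then 1 else 0) * (if m.left.2 = m.left.1 then 1 else 0) *
      (if m.right.2 = m.right.1 then 1 else 0) * (if m.link.2 = m.link.1 then 1 else 0))

/-- The inner edges of a box are fault-free and contribute deltas. What remains is one value shared
by wire and leg at the core, together with the outgoing value; the sign is the character of the hub
evaluated on the link. -/
theorem sum_boxTerm {O : Type} (s : O → ZMod 2) (p : Pauli) (x z : ZMod 2) (f : ZMod 2 → ℂ) :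
    ∑ m : BoxEnds, boxTerm s p x m * f m.out * sgn (z * m.link.2) =
      ∑ y, f y * Node.boxTensor s p z x y := by
  rw [BoxEnds.sum_eq]
  refine Finset.sum_congr rfl fun y _ => ?_
  -- The nesting of the conditions follows the order of summation, so that the innermost sum always
  -- meets its own delta first.
  have h : ∀ t l l' r r' k k' : ZMod 2,
      boxTerm s p x ⟨y, t, (l, l'), (r, r'), (k, k')⟩ * f y * sgn (z * k') =
        if k' = k then if k = r then if r' = r then if r = l' then if l' = l then if t = x then
          f y * ((boxBefore p : Node O).pairTensor s x l *
            (boxAfter p : Node O).pairTensor s l y * sgn (z * l))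
          else 0 else 0 else 0 else 0 else 0 else 0 := by
    intro t l l' r r' k k'
    simp only [boxTerm]
    split_ifs <;> simp_all
    ring
  rw [Finset.sum_eq_single x]
  · simp only [h, Finset.sum_ite_eq', Finset.mem_univ, if_true, Node.boxTensor, Finset.mul_sum]
  · intro t _ ht
    simp only [h, if_neg ht, ite_self, Finset.sum_const_zero]
  · simp

namespace ZXDiagram

variable {n m : ℕ} {O : Type} (D : ZXDiagram n m O) (P : D.E → Pauli)

/-- The values at the ends of the edges of `D.insertGadget P`, in terms of the values `b` at the
ends of the edges of `D`, the values `c` at the ends of the edge `flip`, and those of the boxes. -/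
def gadgetAssign (b : D.E × Bool → ZMod 2) (c : ZMod 2 × ZMod 2) (μ : FaultSupport P → BoxEnds) :
    (D.E ⊕ GadgetEdge (FaultSupport P)) × Bool → ZMod 2
  | (Sum.inl e, true) => b (e, true)
  | (Sum.inl e, false) => if he : P e ≠ 0 then (μ ⟨e, he⟩).out else b (e, false)
  | (Sum.inr (GadgetEdge.enter e), false) => b (e.1, false)
  | (Sum.inr (GadgetEdge.enter e), true) => (μ e).enter
  | (Sum.inr (GadgetEdge.left e), false) => (μ e).left.1
  | (Sum.inr (GadgetEdge.left e), true) => (μ e).left.2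
  | (Sum.inr (GadgetEdge.right e), false) => (μ e).right.1
  | (Sum.inr (GadgetEdge.right e), true) => (μ e).right.2
  | (Sum.inr (GadgetEdge.link e), false) => (μ e).link.1
  | (Sum.inr (GadgetEdge.link e), true) => (μ e).link.2
  | (Sum.inr GadgetEdge.flip, false) => c.1
  | (Sum.inr GadgetEdge.flip, true) => c.2

theorem gadgetAssign_gadgetEnd (b c μ) (h : D.E × Bool) :
    D.gadgetAssign P b c μ (D.gadgetEnd P h) = b h := by
  rcases h with ⟨e, _ | _⟩
  · by_cases he : P e = 0 <;> simp [gadgetEnd, gadgetAssign, he]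
  · rfl

theorem gadgetAssign_out (b c μ) (e : FaultSupport P) :
    D.gadgetAssign P b c μ (Sum.inl e.1, false) = (μ e).out := by
  simp [gadgetAssign, e.2]

theorem gadgetAssign_of_eq_zero (b c μ) {e : D.E} (he : P e = 0) :
    D.gadgetAssign P b c μ (Sum.inl e, false) = b (e, false) := by
  simp [gadgetAssign, he]

/-- On an edge that is cut by a box, the old end `(e, false)` has become the outer end of `enter e`.
The value at the new end of the remaining part is therefore the free value `out`, and the two
assignments are in bijection. -/
theorem sum_gadgetAssign (f : ((D.E ⊕ GadgetEdge (FaultSupport P)) × Bool → ZMod 2) → ℂ) :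
    ∑ b', f b' = ∑ b, ∑ c, ∑ μ, f (D.gadgetAssign P b c μ) := by
  have hprod : ∑ b, ∑ c, ∑ μ, f (D.gadgetAssign P b c μ) =
      ∑ x : ((D.E × Bool → ZMod 2) × (ZMod 2 × ZMod 2)) × (FaultSupport P → BoxEnds),
        f (D.gadgetAssign P x.1.1 x.1.2 x.2) := by
    rw [Fintype.sum_prod_type, Fintype.sum_prod_type]
  rw [hprod]
  symm
  refine Fintype.sum_equiv
    { toFun := fun x => D.gadgetAssign P x.1.1 x.1.2 x.2
      invFun := fun b' => ((fun h => b' (D.gadgetEnd P h),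
          (b' (Sum.inr GadgetEdge.flip, false), b' (Sum.inr GadgetEdge.flip, true))),
        fun e => ⟨b' (Sum.inl e.1, false), b' (Sum.inr (GadgetEdge.enter e), true),
          (b' (Sum.inr (GadgetEdge.left e), false), b' (Sum.inr (GadgetEdge.left e), true)),
          (b' (Sum.inr (GadgetEdge.right e), false), b' (Sum.inr (GadgetEdge.right e), true)),
          (b' (Sum.inr (GadgetEdge.link e), false), b' (Sum.inr (GadgetEdge.link e), true))⟩)
      left_inv := ?_
      right_inv := ?_ } _ _ fun x => rfl
  · rintro ⟨⟨b, c⟩, μ⟩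
    refine Prod.ext (Prod.ext (funext fun h => D.gadgetAssign_gadgetEnd P b c μ h) rfl)
      (funext fun e => ?_)
    simp only [gadgetAssign_out]
    rfl
  · intro b'
    funext ⟨e, x⟩
    rcases e with e | e
    · cases x
      · by_cases he : P e = 0
        · refine (D.gadgetAssign_of_eq_zero P _ _ _ he).trans ?_
          simp [gadgetEnd, he]
        · exact D.gadgetAssign_out P _ _ _ ⟨e, he⟩
      · rfl
    · rcases e with e | e | e | e | _ <;> cases x <;> try rfl
      simp [gadgetAssign, gadgetEnd, e.2]

/-! ### The legs of the nodes of a gadget -/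

theorem gadgetLift_ne (h : D.E × Bool) (v : GadgetNode (FaultSupport P)) :
    D.gadgetLift P h ≠ Sum.inl (Sum.inr v) := by
  unfold gadgetLift
  rcases D.ends h with x | x <;> simp

theorem gadgetEnds_eq_pre (e : FaultSupport P) :
    (Finset.univ.filter fun h => D.gadgetEnds P h = Sum.inl (Sum.inr (GadgetNode.pre e))) =
      {(Sum.inr (GadgetEdge.enter e), true), (Sum.inr (GadgetEdge.left e), false)} := by
  ext ⟨f | f, x⟩
  · rcases x with _ | _
    · by_cases he : P f = 0 <;> simp [gadgetEnds, he, gadgetLift_ne]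
    · simp [gadgetEnds, gadgetLift_ne]
  · rcases f with f | f | f | f | _ <;> rcases x with _ | _ <;> simp [gadgetEnds, gadgetLift_ne]

theorem gadgetEnds_eq_core (e : FaultSupport P) :
    (Finset.univ.filter fun h => D.gadgetEnds P h = Sum.inl (Sum.inr (GadgetNode.core e))) =
      {(Sum.inr (GadgetEdge.left e), true), (Sum.inr (GadgetEdge.right e), false),
        (Sum.inr (GadgetEdge.link e), false)} := by
  ext ⟨f | f, x⟩
  · rcases x with _ | _
    · by_cases he : P f = 0 <;> simp [gadgetEnds, he, gadgetLift_ne]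
    · simp [gadgetEnds, gadgetLift_ne]
  · rcases f with f | f | f | f | _ <;> rcases x with _ | _ <;> simp [gadgetEnds, gadgetLift_ne]

theorem gadgetEnds_eq_post (e : FaultSupport P) :
    (Finset.univ.filter fun h => D.gadgetEnds P h = Sum.inl (Sum.inr (GadgetNode.post e))) =
      {(Sum.inr (GadgetEdge.right e), true), (Sum.inl e.1, false)} := by
  ext ⟨f | f, x⟩
  · rcases x with _ | _
    · by_cases he : P f = 0
      · have : f ≠ e.1 := fun h => e.2 (h ▸ he)
        simp [gadgetEnds, he, gadgetLift_ne, this]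
      · simp [gadgetEnds, he, Subtype.ext_iff]
    · simp [gadgetEnds, gadgetLift_ne]
  · rcases f with f | f | f | f | _ <;> rcases x with _ | _ <;> simp [gadgetEnds, gadgetLift_ne]

theorem gadgetEnds_eq_tip :
    (Finset.univ.filter fun h => D.gadgetEnds P h = Sum.inl (Sum.inr GadgetNode.tip)) =
      {(Sum.inr GadgetEdge.flip, true)} := by
  ext ⟨f | f, x⟩
  · rcases x with _ | _
    · by_cases he : P f = 0 <;> simp [gadgetEnds, he, gadgetLift_ne]
    · simp [gadgetEnds, gadgetLift_ne]
  · rcases f with f | f | f | f | _ <;> rcases x with _ | _ <;> simp [gadgetEnds, gadgetLift_ne]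

/-- The ends of edges at the hub of a gadget. -/
def hubEnd : Option (FaultSupport P) → (D.E ⊕ GadgetEdge (FaultSupport P)) × Bool
  | none => (Sum.inr GadgetEdge.flip, false)
  | some e => (Sum.inr (GadgetEdge.link e), true)

theorem hubEnd_injective : Function.Injective (D.hubEnd P) := by
  rintro (_ | e) (_ | e') h <;> simp_all [hubEnd]

theorem gadgetEnds_eq_hub (h) : D.gadgetEnds P h = Sum.inl (Sum.inr GadgetNode.hub) ↔
    ∃ y, y ∈ Finset.univ ∧ D.hubEnd P y = h := by
  obtain ⟨f | f, x⟩ := h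
  · rcases x with _ | _
    · by_cases he : P f = 0 <;> simp [gadgetEnds, he, gadgetLift_ne, hubEnd, Option.exists]
    · simp [gadgetEnds, gadgetLift_ne, hubEnd, Option.exists]
  · rcases f with f | f | f | f | _ <;> rcases x with _ | _ <;>
      simp [gadgetEnds, gadgetLift_ne, hubEnd, Option.exists]

end ZXDiagram

/-! ### Contraction of a gadget with an arbitrary tip. -/

namespace ZXDiagram

variable {n m : ℕ} {O : Type} (D : ZXDiagram n m O) (P : D.E → Pauli)

/-- The kinds of nodes after inserting a fault gadget whose tip is a node `κ`. -/
def tipKind (κ : Node O) : D.V ⊕ GadgetNode (FaultSupport P) → Node O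
  | Sum.inl v => D.kind v
  | Sum.inr (GadgetNode.pre e) => boxBefore (P e.1)
  | Sum.inr (GadgetNode.core _) => Node.z 0 0
  | Sum.inr (GadgetNode.post e) => boxAfter (P e.1)
  | Sum.inr GadgetNode.hub => Node.x 0 0
  | Sum.inr GadgetNode.tip => κ

theorem gadgetKind_eq_tipKind : D.gadgetKind P = D.tipKind P (Node.z 0 0) := by
  funext v
  rcases v with v | _ | _ | _ | _ | _ <;> rfl

/-- The vector of a one-legged node at the tip of a gadget, after a fault `g`. -/
noncomputable def tipEntry (κ : Node O) (s : O → ZMod 2) (g : Pauli) (c : ZMod 2 × ZMod 2) : ℂ :=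
  pauliEntry g c.2 c.1 * κ.tensor s {()} fun _ => c.2

/-- The amplitude with which the Pauli of a gadget is not applied (`z = 0`) or is applied
(`z = 1`). -/
noncomputable def tipCoeff (κ : Node O) (s : O → ZMod 2) (g : Pauli) (z : ZMod 2) : ℂ :=
  ∑ c, sgn (z * c.1) * tipEntry κ s g c

/-- The normalisation of a gadget. -/
noncomputable def gadgetScale : ℝ :=
  (1 / Real.sqrt 2) ^ (Fintype.card (FaultSupport P) + 1)

theorem gadgetScale_pos : 0 < D.gadgetScale P := by
  unfold gadgetScale; positivity

theorem tensor_core (s : O → ZMod 2) (b c μ) (e : FaultSupport P) :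
    (Node.z 0 0 : Node O).tensor s
      (Finset.univ.filter fun h => D.gadgetEnds P h = Sum.inl (Sum.inr (GadgetNode.core e)))
      (D.gadgetAssign P b c μ) =
    if (μ e).left.2 = (μ e).right.1 ∧ (μ e).right.1 = (μ e).link.1 then 1 else 0 := by
  rw [gadgetEnds_eq_core]
  simp only [Node.tensor, Finset.mem_insert, Finset.mem_singleton,
    forall_eq_or_imp, forall_eq, gadgetAssign]
  generalize (μ e).left.2 = l
  generalize (μ e).right.1 = r
  generalize (μ e).link.1 = k
  rcases zmod_two_cases l with rfl | rfl <;> rcases zmod_two_cases r with rfl | rfl <;>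
    rcases zmod_two_cases k with rfl | rfl <;> simp [phaseFactor, sgn_zero]

/-- The two summands, a constant and a parity sign, are the source of the two branches in which the
Pauli of the gadget is absent or applied. The scale has one factor 1/√2 for each link and one for
the edge to the tip. -/
theorem tensor_hub (s : O → ZMod 2) (b c μ) :
    (Node.x 0 0 : Node O).tensor s
      (Finset.univ.filter fun h => D.gadgetEnds P h = Sum.inl (Sum.inr GadgetNode.hub))
      (D.gadgetAssign P b c μ) =
    (D.gadgetScale P : ℂ) * (1 + sgn c.1 * ∏ e, sgn (μ e).link.2) := by
  rw [Node.tensor_of_image _ s (D.hubEnd_injective P) (S := Finset.univ) (fun h => by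
    simpa using D.gadgetEnds_eq_hub P h)]
  have hscale : (D.gadgetScale P : ℂ) = ((1 / Real.sqrt 2 : ℝ) : ℂ) *
      ∏ _e : FaultSupport P, ((1 / Real.sqrt 2 : ℝ) : ℂ) := by
    rw [gadgetScale, Finset.prod_const, Finset.card_univ, pow_succ', Complex.ofReal_mul,
      Complex.ofReal_pow]
  have hphase : phaseFactor 0 ((0 : (O → ZMod 2) → ZMod 2) s) = 1 := by
    simp [phaseFactor, sgn_zero]
  simp only [Node.tensor, Finset.prod_mul_distrib, Fintype.prod_option, hphase, hscale]
  simp only [hubEnd, gadgetAssign]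
  ring

theorem prod_gadget_nodes (κ : Node O) (s : O → ZMod 2) (b c μ) :
    (∏ v, (D.tipKind P κ v).tensor s
      (Finset.univ.filter fun h => D.gadgetEnds P h = Sum.inl v) (D.gadgetAssign P b c μ)) =
    (∏ v, (D.kind v).tensor s (Finset.univ.filter fun h => D.ends h = Sum.inl v) b) *
      ((∏ e, (boxBefore (P e.1) : Node O).pairTensor s (μ e).enter (μ e).left.1) *
        (∏ e, if (μ e).left.2 = (μ e).right.1 ∧ (μ e).right.1 = (μ e).link.1 then 1 else 0) *
        (∏ e, (boxAfter (P e.1) : Node O).pairTensor s (μ e).right.2 (μ e).out) *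
        ((D.gadgetScale P : ℂ) * (1 + sgn c.1 * ∏ e, sgn (μ e).link.2)) *
        κ.tensor s {()} fun _ => c.2) := by
  have hold : ∀ v, (D.kind v).tensor s
      (Finset.univ.filter fun h => D.gadgetEnds P h = Sum.inl (Sum.inl v))
      (D.gadgetAssign P b c μ) =
      (D.kind v).tensor s (Finset.univ.filter fun h => D.ends h = Sum.inl v) b := fun v => by
    rw [(D.kind v).tensor_of_image s (D.gadgetEnd_injective P)
      (S := Finset.univ.filter fun h => D.ends h = Sum.inl v) (fun h => by
        simpa [and_comm] using D.gadgetEnds_eq_lift P h (Sum.inl v))]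
    simp only [gadgetAssign_gadgetEnd]
  have hpre : ∀ e : FaultSupport P, (boxBefore (P e.1) : Node O).tensor s
      (Finset.univ.filter fun h => D.gadgetEnds P h = Sum.inl (Sum.inr (GadgetNode.pre e)))
      (D.gadgetAssign P b c μ) =
      (boxBefore (P e.1) : Node O).pairTensor s (μ e).enter (μ e).left.1 := fun e => by
    rw [gadgetEnds_eq_pre, Node.tensor_pair _ _ (by simp)]
    rfl
  have hpost : ∀ e : FaultSupport P, (boxAfter (P e.1) : Node O).tensor s
      (Finset.univ.filter fun h => D.gadgetEnds P h = Sum.inl (Sum.inr (GadgetNode.post e)))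
      (D.gadgetAssign P b c μ) =
      (boxAfter (P e.1) : Node O).pairTensor s (μ e).right.2 (μ e).out := fun e => by
    rw [gadgetEnds_eq_post, Node.tensor_pair _ _ (by simp), gadgetAssign_out]
    rfl
  have htip : κ.tensor s
      (Finset.univ.filter fun h => D.gadgetEnds P h = Sum.inl (Sum.inr GadgetNode.tip))
      (D.gadgetAssign P b c μ) = κ.tensor s {()} fun _ => c.2 := by
    rw [gadgetEnds_eq_tip]
    exact Node.tensor_of_image κ s (f := fun _ : Unit => (Sum.inr GadgetEdge.flip, true))
      (fun _ _ _ => rfl) (fun x => by simp [eq_comm]) _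
  rw [Fintype.prod_sum_type, GadgetNode.prod_eq]
  simp only [tipKind]
  rw [Finset.prod_congr rfl fun v _ => hold v, Finset.prod_congr rfl fun e _ => hpre e,
    Finset.prod_congr rfl fun e _ => D.tensor_core P s b c μ e,
    Finset.prod_congr rfl fun e _ => hpost e, tensor_hub, htip]

/-- On the support of `P` the remaining part of the edge starts at its box, so its Pauli acts on
`out`; off the support nothing changes. Of the gadget's own edges only `flip` carries a fault. -/
theorem prod_gadget_edges (F : D.E → Pauli) (g : Pauli) (b c μ) :
    (∏ e, pauliEntry ((Sum.elim F (Pi.single GadgetEdge.flip g) :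
        D.E ⊕ GadgetEdge (FaultSupport P) → Pauli) e)
      (D.gadgetAssign P b c μ (e, true)) (D.gadgetAssign P b c μ (e, false))) =
    ((∏ e : FaultSupport P, pauliEntry (F e) (b (e, true)) (μ e).out) *
      ∏ e : {e // ¬ P e ≠ 0}, pauliEntry (F e) (b (e, true)) (b (e, false))) *
      ((∏ e : FaultSupport P, if (μ e).enter = b (e, false) then 1 else 0) *
        (∏ e, if (μ e).left.2 = (μ e).left.1 then 1 else 0) *
        (∏ e, if (μ e).right.2 = (μ e).right.1 then 1 else 0) *
        (∏ e, if (μ e).link.2 = (μ e).link.1 then 1 else 0) * pauliEntry g c.2 c.1) := by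
  rw [Fintype.prod_sum_type, GadgetEdge.prod_eq]
  congr 1
  · rw [← Fintype.prod_subtype_mul_prod_subtype fun e => P e ≠ 0]
    congr 1
    · refine Finset.prod_congr rfl fun e _ => ?_
      rw [gadgetAssign_out]; rfl
    · refine Finset.prod_congr rfl fun e _ => ?_
      rw [gadgetAssign_of_eq_zero _ _ _ _ _ (not_not.1 e.2)]; rfl
  · simp only [Sum.elim_inr, Pi.single_eq_same]
    congr 1
    congr 1
    · congr 1
      · congr 1
        all_goals
          refine Finset.prod_congr rfl fun e _ => ?_
          rw [Pi.single_eq_of_ne (by simp), pauliEntry_zero]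
          rfl
      · refine Finset.prod_congr rfl fun e _ => ?_
        rw [Pi.single_eq_of_ne (by simp), pauliEntry_zero]
        rfl
    · refine Finset.prod_congr rfl fun e _ => ?_
      rw [Pi.single_eq_of_ne (by simp), pauliEntry_zero]
      rfl

/-- Evaluation of a diagram with a gadget: a superposition of not applying and applying `P`. -/
theorem exists_netEval_gadget (F : D.E → Pauli) : ∃ j : ZMod 4, ∀ (κ : Node O) (g : Pauli)
    (s : O → ZMod 2) (x : Fin n ⊕ Fin m → ZMod 2),
    netEval (D.tipKind P κ) (D.gadgetEnds P) (fun p => D.gadgetEnd P (D.port p))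
      (Sum.elim F (Pi.single GadgetEdge.flip g)) s x =
    (D.gadgetScale P : ℂ) * (tipCoeff κ s g 0 * netEval D.kind D.ends D.port F s x +
      tipCoeff κ s g 1 * Complex.I ^ j.val * netEval D.kind D.ends D.port (F + P) s x) := by
  -- Each box contributes its own power of i; together they give one global phase, independent of
  -- tip, outcomes and boundary values.
  choose j hj using fun e : FaultSupport P =>
    Node.exists_sum_pauliEntry_mul_boxTensor (O := O) (F e.1) (P e.1) e.2
  refine ⟨∑ e, j e, fun κ g s x => ?_⟩
  simp only [netEval]
  rw [sum_gadgetAssign, Finset.mul_sum, Finset.mul_sum, ← Finset.sum_add_distrib, Finset.mul_sum]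
  refine Finset.sum_congr rfl fun b _ => ?_
  simp only [prod_gadget_nodes, prod_gadget_edges, gadgetAssign_gadgetEnd]
  split_ifs with hb
  swap
  · simp
  -- Each character of the hub is a product over the links, so the sum over all box values
  -- factorises over the boxes. The cases z = 0 and z = 1 are the two characters.
  have hμ : ∀ z : ZMod 2, ∑ μ : FaultSupport P → BoxEnds, ∏ e : FaultSupport P,
      (boxTerm s (P e.1) (b (e.1, false)) (μ e) * pauliEntry (F e.1) (b (e.1, true)) (μ e).out *
        sgn (z * (μ e).link.2)) = ∏ e : FaultSupport P, ∑ y,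
          pauliEntry (F e.1) (b (e.1, true)) y * Node.boxTensor s (P e.1) z (b (e.1, false)) y := by
    intro z
    simp only [← sum_boxTerm]
    rw [Finset.prod_univ_sum, Fintype.piFinset_univ]
  have h0 := hμ 0
  have h1 := hμ 1
  simp only [Node.sum_pauliEntry_mul_boxTensor_zero] at h0
  simp only [hj, Finset.prod_mul_distrib, exists_prod_I_pow] at h1
  have hF : ∏ e, pauliEntry (F e) (b (e, true)) (b (e, false)) =
      (∏ e : FaultSupport P, pauliEntry (F e) (b (e, true)) (b (e, false))) *
      ∏ e : {e // ¬ P e ≠ 0}, pauliEntry (F e) (b (e, true)) (b (e, false)) :=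
    (Fintype.prod_subtype_mul_prod_subtype (fun e => P e ≠ 0) _).symm
  have hFP : ∏ e, pauliEntry ((F + P) e) (b (e, true)) (b (e, false)) =
      (∏ e : FaultSupport P, pauliEntry (F e + P e) (b (e, true)) (b (e, false))) *
      ∏ e : {e // ¬ P e ≠ 0}, pauliEntry (F e) (b (e, true)) (b (e, false)) := by
    rw [← Fintype.prod_subtype_mul_prod_subtype (fun e => P e ≠ 0)]
    congr 1
    refine Finset.prod_congr rfl fun e _ => ?_
    rw [Pi.add_apply, not_not.1 e.2, add_zero]
  rw [hF, hFP, ← h0]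
  have h1' : ∀ A B : ℂ, tipCoeff κ s g 1 * Complex.I ^ (∑ e, j e).val *
      (A * ((∏ e : FaultSupport P, pauliEntry (F e + P e) (b (e, true)) (b (e, false))) * B)) =
      tipCoeff κ s g 1 * (A * ((Complex.I ^ (∑ e, j e).val *
        ∏ e : FaultSupport P, pauliEntry (F e + P e) (b (e, true)) (b (e, false))) * B)) := by
    intro A B; ring
  rw [h1', ← h1]
  -- With all closed forms unfolded again, both sides are sums over the box values and the two ends
  -- of `flip`, and they agree term by term.
  simp only [tipCoeff, Finset.sum_mul, Finset.mul_sum]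
  rw [Finset.sum_comm, ← Finset.sum_add_distrib, Finset.mul_sum]
  refine Finset.sum_congr rfl fun μ _ => ?_
  rw [← Finset.sum_add_distrib, Finset.mul_sum]
  refine Finset.sum_congr rfl fun c _ => ?_
  simp only [tipEntry, boxTerm, Finset.prod_mul_distrib, zero_mul, one_mul, sgn_zero,
    Finset.prod_const_one]
  ring

end ZXDiagram

/-! ### Tips of gadgets and the superpositions they select. -/

namespace ZXDiagram

variable {n m k : ℕ} {O : Type}

theorem sum_tip_no_fault (κ : Node O) (s : O → ZMod 2) (z : ZMod 2) :
    tipCoeff κ s 0 z = ∑ c, sgn (z * c) * κ.tensor s {()} fun _ => c := by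
  simp only [tipCoeff, tipEntry, Fintype.sum_prod_type, pauliEntry_zero, ite_mul, one_mul,
    zero_mul, mul_ite, mul_zero, Finset.sum_ite_eq', Finset.mem_univ, if_true]

/-- The tip is the state |0⟩ + |1⟩, which is fixed by X and which Z turns into |0⟩ - |1⟩. Each of
these is orthogonal to one of the two characters. -/
theorem tipCoeff_z_zero (s : O → ZMod 2) (g : Pauli) (z : ZMod 2) :
    tipCoeff (Node.z 0 0 : Node O) s g z = if g.2 = z then 2 else 0 := by
  have h : ∀ c : ZMod 2, (Node.z 0 0 : Node O).tensor s {()} (fun _ => c) = 1 := fun c => by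
    rw [Node.tensor_z_single]; simp [phaseFactor, sgn_zero]
  obtain ⟨g₁, g₂⟩ := g
  simp only [tipCoeff, tipEntry, Fintype.sum_prod_type, h, mul_one, pauliEntry]
  simp only [mul_ite, mul_zero, Finset.sum_ite_eq', Finset.mem_univ, if_true]
  rw [sum_zmod_two]
  rcases zmod_two_cases g₂ with rfl | rfl <;> rcases zmod_two_cases z with rfl | rfl <;>
    norm_num [sgn_zero, sgn_one]

/-- A phase qπ on a green tip acts like Z^q, so the outcome selects one branch. -/
theorem tipCoeff_z (s : O → ZMod 2) (q : (O → ZMod 2) → ZMod 2) (z : ZMod 2) :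
    tipCoeff (Node.z 0 q : Node O) s 0 z = if q s = z then 2 else 0 := by
  simp only [sum_tip_no_fault, sum_zmod_two, Node.tensor_z_single]
  rcases zmod_two_cases (q s) with h | h <;> rcases zmod_two_cases z with rfl | rfl <;>
    norm_num [sgn_zero, sgn_one, phaseFactor, h]

/-- A red tip meets both characters with equal modulus, and its phase becomes their relative phase.
-/
theorem tipCoeff_x (s : O → ZMod 2) (a : ZMod 4) (q : (O → ZMod 2) → ZMod 2) (z : ZMod 2) :
    tipCoeff (Node.x a q : Node O) s 0 z =
      2 * ((1 / Real.sqrt 2 : ℝ) : ℂ) * if z = 0 then 1 else phaseFactor a (q s) := by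
  simp only [sum_tip_no_fault, sum_zmod_two, Node.tensor_x_single]
  rcases zmod_two_cases z with rfl | rfl
  · simp only [zero_mul, sgn_zero, mul_zero, sgn_one, if_true]; ring
  · simp only [one_mul, sgn_zero, sgn_one, one_ne_zero, if_false]; ring

section

variable (D : ZXDiagram n m O) (P : D.E → Pauli)

theorem gadgetEnds_gadgetEnd_port (p : Fin n ⊕ Fin m) :
    D.gadgetEnds P (D.gadgetEnd P (D.port p)) = Sum.inr p :=
  (D.gadgetEnds_eq_lift P _ (Sum.inr p)).2 ⟨_, rfl, D.ends_port p⟩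

/-- Inserting a fault gadget whose tip is a node `κ`. -/
def tipGadget (κ : Node O) (hκ : κ ≠ Node.had) : ZXDiagram n m O where
  V := D.V ⊕ GadgetNode (FaultSupport P)
  E := D.E ⊕ GadgetEdge (FaultSupport P)
  kind := D.tipKind P κ
  ends := D.gadgetEnds P
  noisy := fun _ => False
  boundary := D.gadget_boundary P
  hadamard := by
    rintro (v | e | e | e | _ | _) hv
    · exact D.gadget_hadamard P (Sum.inl v) hv
    · exact D.gadget_hadamard P (Sum.inr (GadgetNode.pre e)) hv
    · exact D.gadget_hadamard P (Sum.inr (GadgetNode.core e)) hv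
    · exact D.gadget_hadamard P (Sum.inr (GadgetNode.post e)) hv
    · exact D.gadget_hadamard P (Sum.inr GadgetNode.hub) hv
    · exact absurd hv hκ

theorem exists_eval_tipGadget : ∃ j : ZMod 4, ∀ (κ : Node O) (hκ : κ ≠ Node.had)
    (s : O → ZMod 2), (D.tipGadget P κ hκ).eval 0 s =
      (D.gadgetScale P : ℂ) • (tipCoeff κ s 0 0 • D.eval 0 s +
        (tipCoeff κ s 0 1 * Complex.I ^ j.val) • D.eval P s) := by
  obtain ⟨j, hj⟩ := D.exists_netEval_gadget P 0
  refine ⟨j, fun κ hκ s => ?_⟩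
  ext o i
  have h := hj κ 0 s (Sum.elim i o)
  have h0 : (Sum.elim 0 (Pi.single GadgetEdge.flip 0) :
      D.E ⊕ GadgetEdge (FaultSupport P) → Pauli) = 0 := by
    rw [Pi.single_zero]; funext e; rcases e with e | e <;> rfl
  rw [zero_add, h0, ← D.eval_eq_netEval D.ends_port, ← D.eval_eq_netEval D.ends_port] at h
  exact ((D.tipGadget P κ hκ).eval_eq_netEval (D.gadgetEnds_gadgetEnd_port P) _ _ _ _).trans h

/-- Only one of the two branches survives, according to the Z-component of `g`. Both come with the
same normalisation; the power of i in the second is a global phase. -/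
theorem insertGadget_eval (F : D.E → Pauli) (g : Pauli) :
    SameMap ((D.insertGadget P).eval (Sum.elim F (Pi.single GadgetEdge.flip g)))
      (D.eval (F + g.2 • P)) := by
  obtain ⟨j, hj⟩ := D.exists_netEval_gadget P F
  have h : ∀ s o i, (D.insertGadget P).eval (Sum.elim F (Pi.single GadgetEdge.flip g)) s o i =
      (D.gadgetScale P : ℂ) * (tipCoeff (Node.z 0 0) s g 0 * D.eval F s o i +
        tipCoeff (Node.z 0 0) s g 1 * Complex.I ^ j.val * D.eval (F + P) s o i) := by
    intro s o i
    have h := hj (Node.z 0 0) g s (Sum.elim i o)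
    rw [← D.eval_eq_netEval D.ends_port, ← D.eval_eq_netEval D.ends_port] at h
    refine ((D.insertGadget P).eval_eq_netEval (D.gadgetEnds_gadgetEnd_port P) _ _ _ _).trans ?_
    rw [← h, ← gadgetKind_eq_tipKind]
    rfl
  have hpos := D.gadgetScale_pos P
  rcases zmod_two_cases g.2 with hg | hg
  · rw [hg, zero_smul, add_zero]
    refine ⟨D.gadgetScale P * 2, fun _ => D.gadgetScale P * 2, by positivity, fun s => ?_,
      fun s => ?_⟩
    · simp [abs_of_pos hpos]
    · ext o i
      rw [h, Matrix.smul_apply, tipCoeff_z_zero, tipCoeff_z_zero, if_pos hg, if_neg (by simp [hg]),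
        smul_eq_mul]
      ring
  · rw [hg, one_smul]
    refine ⟨D.gadgetScale P * 2, fun _ => D.gadgetScale P * 2 * Complex.I ^ j.val, by positivity,
      fun s => ?_, fun s => ?_⟩
    · simp [abs_of_pos hpos]
    · ext o i
      rw [h, Matrix.smul_apply, tipCoeff_z_zero, tipCoeff_z_zero, if_pos hg, if_neg (by simp [hg]),
        smul_eq_mul]
      ring

end

end ZXDiagram

/-! ## Maps that have a diagram -/

/-- A family of maps is diagrammatic if some ZX diagram evaluates to it. -/
def IsDiagrammatic {n m : ℕ} {O : Type} (A : OutcomeMap n m O) : Prop :=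
  ∃ D : ZXDiagram n m O, SameMap A (D.eval 0)

namespace IsDiagrammatic

open ZXDiagram

variable {n m k : ℕ} {O : Type}

theorem of_sameMap {A B : OutcomeMap n m O} (hB : IsDiagrammatic B) (h : SameMap A B) :
    IsDiagrammatic A := by
  obtain ⟨D, hD⟩ := hB
  exact ⟨D, h.trans hD⟩

theorem eval_comp_zero (D : ZXDiagram n m O) (D' : ZXDiagram m k O) (s : O → ZMod 2) :
    (D.comp D').eval 0 s = D'.eval 0 s * D.eval 0 s := by
  rw [← eval_comp]
  congr 1
  funext e; rcases e with e | e <;> rfl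

theorem mul {A : OutcomeMap m k O} {B : OutcomeMap n m O} (hA : IsDiagrammatic A)
    (hB : IsDiagrammatic B) : IsDiagrammatic fun s => A s * B s := by
  obtain ⟨D, hD⟩ := hA
  obtain ⟨D', hD'⟩ := hB
  exact ⟨D'.comp D, (hD.mul hD').trans
    (SameMap.of_eq (funext fun s => (eval_comp_zero _ _ s).symm))⟩

theorem eval_wires_zero (n : ℕ) (s : O → ZMod 2) : (wires n O).eval 0 s = 1 := by
  rw [← pauliMat_zero]; exact eval_wires 0 s

theorem one :
    IsDiagrammatic fun _ : O → ZMod 2 => (1 : Matrix (Fin n → ZMod 2) (Fin n → ZMod 2) ℂ) :=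
  ⟨wires n O, SameMap.of_eq (funext fun s => (eval_wires_zero n s).symm)⟩

theorem caps (κ : Fin n ⊕ Fin m → Node O) (hκ : ∀ p, κ p ≠ Node.had) :
    IsDiagrammatic fun s => Matrix.of fun (o : Fin m → ZMod 2) (i : Fin n → ZMod 2) =>
      ∏ p, (κ p).tensor s {()} fun _ => Sum.elim i o p :=
  ⟨ZXDiagram.caps κ hκ, SameMap.of_eq (funext fun s => by
    ext o i; rw [eval_caps, Matrix.of_apply])⟩

/-- A diagram with additional edges on its inputs and its outputs. -/
theorem exists_diagram_with_boundary_faults (D : ZXDiagram n m O) (P : Fin n → Pauli)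
    (Q : Fin m → Pauli) : ∃ (D' : ZXDiagram n m O) (F : D'.E → Pauli),
      (∀ s, D'.eval 0 s = D.eval 0 s) ∧
      ∀ s, D'.eval F s = pauliMat Q * (D.eval 0 s * pauliMat P) := by
  refine ⟨((wires n O).comp D).comp (wires m O), Sum.elim (Sum.elim P 0) Q, fun s => ?_,
    fun s => ?_⟩
  · rw [eval_comp_zero, eval_comp_zero]
    rw [eval_wires_zero, eval_wires_zero, Matrix.one_mul, Matrix.mul_one]
  · refine (eval_comp ((wires n O).comp D) (wires m O) (Sum.elim P 0) Q s).trans ?_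
    rw [eval_wires]
    congr 1
    refine (eval_comp (wires n O) D P 0 s).trans ?_
    rw [eval_wires]

/-- Realised by a gadget with a red tip, whose Pauli acts by `P` on the input wires and `Q` on the
output wires of a diagram for `A`. -/
theorem add_phase_smul {A : OutcomeMap n m O} (hA : IsDiagrammatic A) (P : Fin n → Pauli)
    (Q : Fin m → Pauli) (a : ZMod 4) (q : (O → ZMod 2) → ZMod 2) :
    IsDiagrammatic fun s => A s + phaseFactor a (q s) • (pauliMat Q * (A s * pauliMat P)) := by
  obtain ⟨D, r, c, hr, hc, hD⟩ := hA
  obtain ⟨D', F, h0, hF⟩ := exists_diagram_with_boundary_faults D P Q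
  obtain ⟨j, hj⟩ := D'.exists_eval_tipGadget F
  -- The Pauli boxes bring in the phase i^j; subtracting `j` in the tip leaves the desired relative
  -- phase.
  refine of_sameMap (B := (D'.tipGadget F (Node.x (a - j) q) (by simp)).eval 0)
    ⟨_, SameMap.refl _⟩ ?_
  set K : ℝ := D'.gadgetScale F * (2 * (1 / Real.sqrt 2)) with hK
  have hpos : 0 < K := mul_pos (D'.gadgetScale_pos F) (by positivity)
  have hval : ∀ s, (D'.tipGadget F (Node.x (a - j) q) (by simp)).eval 0 s =
      (K : ℂ) • (D.eval 0 s + phaseFactor a (q s) • (pauliMat Q * (D.eval 0 s * pauliMat P))) := by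
    intro s
    have hphase : phaseFactor (a - j) (q s) * Complex.I ^ j.val = phaseFactor a (q s) := by
      have := I_pow_val_add (a - j) j
      rw [sub_add_cancel] at this
      rw [phaseFactor, phaseFactor, this]; ring
    rw [hj, h0, hF, tipCoeff_x, tipCoeff_x, if_pos rfl, if_neg one_ne_zero, ← hphase, hK]
    simp only [smul_add, smul_smul]
    push_cast
    congr 2 <;> ring
  refine SameMap.trans (B := fun s =>
    D.eval 0 s + phaseFactor a (q s) • (pauliMat Q * (D.eval 0 s * pauliMat P)))
    ⟨r, c, hr, hc, fun s => ?_⟩ (SameMap.symm ?_)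
  · simp only [hD, smul_add, Matrix.smul_mul, Matrix.mul_smul, smul_comm (c s)]
  · rw [show (D'.tipGadget F (Node.x (a - j) q) (by simp)).eval 0 = _ from funext hval]
    exact SameMap.smul (K : ℂ) (by exact_mod_cast hpos.ne') _

/-- The green tip of phase qπ picks one branch of the gadget on bare wires. The power of i occurs
only in the branch q = 1, hence the phase depends on the outcome but its modulus does not. -/
theorem controlledPauli (P : Fin n → Pauli) (q : (O → ZMod 2) → ZMod 2) :
    IsDiagrammatic fun s => Gate.controlledPauli P (q s) := by
  obtain ⟨j, hj⟩ := (wires n O).exists_eval_tipGadget P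
  refine ⟨(wires n O).tipGadget P (Node.z 0 q) (by simp), SameMap.symm ?_⟩
  have hpos := (wires n O).gadgetScale_pos P
  refine ⟨(wires n O).gadgetScale P * 2, fun s => (wires n O).gadgetScale P * 2 *
    if q s = 0 then 1 else Complex.I ^ j.val, by positivity, fun s => ?_, fun s => ?_⟩
  · dsimp only
    split_ifs <;> simp [abs_of_pos hpos]
  · rw [hj, tipCoeff_z, tipCoeff_z, eval_wires_zero, eval_wires]
    simp only [Gate.controlledPauli]
    rcases zmod_two_cases (q s) with h | h <;> simp [h, smul_smul, mul_assoc]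

end IsDiagrammatic

/-! ## Clifford gates have diagrams -/

theorem single_pauli_fst {k : ℕ} (j : Fin k) (p : Pauli) :
    (fun q => ((Pi.single j p : Fin k → Pauli) q).1) = Pi.single j p.1 := by
  funext q
  by_cases h : q = j
  · subst h; simp
  · simp [h]

theorem sum_single_pauli_snd_mul {k : ℕ} (j : Fin k) (p : Pauli) (f : Fin k → ZMod 2) :
    ∑ q, ((Pi.single j p : Fin k → Pauli) q).2 * f q = p.2 * f j := by
  rw [Finset.sum_eq_single j]
  · simp
  · intro q _ h; simp [h]
  · simp

theorem conj_single_Z_apply {k : ℕ} (j : Fin k) (M : Matrix (Fin k → ZMod 2) (Fin k → ZMod 2) ℂ)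
    (a b : Fin k → ZMod 2) :
    (pauliMat (Pi.single j Pauli.Z) * (M * pauliMat (Pi.single j Pauli.Z))) a b =
      sgn (a j + b j) * M a b := by
  rw [pauliMat_mul_apply, mul_pauliMat_apply, single_pauli_fst, sum_single_pauli_snd_mul,
    sum_single_pauli_snd_mul, sgn_add]
  simp only [Pi.single_zero, add_zero, one_mul, Pi.single_eq_same]
  ring

theorem conj_single_X_apply {k : ℕ} (j : Fin k) (M : Matrix (Fin k → ZMod 2) (Fin k → ZMod 2) ℂ)
    (a b : Fin k → ZMod 2) :
    (pauliMat (Pi.single j Pauli.X) * (M * pauliMat (Pi.single j Pauli.X))) a b =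
      M (a + Pi.single j 1) (b + Pi.single j 1) := by
  rw [pauliMat_mul_apply, mul_pauliMat_apply, single_pauli_fst, sum_single_pauli_snd_mul,
    sum_single_pauli_snd_mul]
  simp [sgn_zero]

theorem exists_eq_I_pow_of_sq {c : ℂ} {b : ZMod 2} (h : c ^ 2 = sgn b) :
    ∃ a : ZMod 4, c = Complex.I ^ a.val := by
  rcases zmod_two_cases b with rfl | rfl
  · rw [sgn_zero, ← one_pow 2, sq_eq_sq_iff_eq_or_eq_neg] at h
    rcases h with h | h
    · exact ⟨0, by rw [h]; simp⟩
    · exact ⟨2, h.trans Node.I_pow_two_val.symm⟩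
  · rw [sgn_one, ← Complex.I_sq, sq_eq_sq_iff_eq_or_eq_neg] at h
    rcases h with h | h
    · exact ⟨1, h.trans Node.I_pow_one_val.symm⟩
    · exact ⟨3, h.trans Node.I_pow_three_val.symm⟩

/-- The conjugate c Q of the involution P is again an involution, while Q squares to ± 1. So c² = ±
1 and c is a fourth root of unity, which is a phase that a spider can carry. -/
theorem IsClifford.exists_conj {k : ℕ} {U : Matrix (Fin k → ZMod 2) (Fin k → ZMod 2) ℂ}
    (hU : IsClifford U) {P : Fin k → Pauli} (hP : pauliMat P * pauliMat P = 1) :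
    ∃ (Q : Fin k → Pauli) (a : ZMod 4), U * pauliMat P = Complex.I ^ a.val • (pauliMat Q * U) := by
  obtain ⟨hu, hc⟩ := hU
  obtain ⟨Q, c, h⟩ := hc P
  have h1 : U * U.conjTranspose = 1 := Matrix.mem_unitaryGroup_iff.1 hu
  have h2 : U.conjTranspose * U = 1 := Matrix.mem_unitaryGroup_iff'.1 hu
  have h3 : U * pauliMat P = c • (pauliMat Q * U) := by
    rw [← Matrix.smul_mul, ← h, Matrix.mul_assoc, h2, Matrix.mul_one]
  have h4 : (c • pauliMat Q) * (c • pauliMat Q) = 1 := by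
    calc (c • pauliMat Q) * (c • pauliMat Q)
        = U * (pauliMat P * ((U.conjTranspose * U) * pauliMat P)) * U.conjTranspose := by
          rw [← h]; simp only [Matrix.mul_assoc]
      _ = 1 := by rw [h2, Matrix.one_mul, hP, Matrix.mul_one, h1]
  rw [Matrix.smul_mul, Matrix.mul_smul, pauliMat_mul_self, smul_smul, smul_smul] at h4
  have h5 := congrFun (congrFun h4 0) 0
  rw [Matrix.smul_apply, Matrix.one_apply_eq, smul_eq_mul, mul_one] at h5
  have h6 : c ^ 2 = sgn (∑ q, (Q q).2 * (Q q).1) := by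
    have := sgn_mul_self (∑ q, (Q q).2 * (Q q).1)
    linear_combination sgn (∑ q, (Q q).2 * (Q q).1) * h5 - c ^ 2 * this
  obtain ⟨a, rfl⟩ := exists_eq_I_pow_of_sq h6
  exact ⟨Q, a, h3⟩

namespace IsDiagrammatic

variable {n m k : ℕ} {O : Type}

theorem smul {A : OutcomeMap n m O} (hA : IsDiagrammatic A) {c : ℂ} (hc : c ≠ 0) :
    IsDiagrammatic fun s => c • A s :=
  hA.of_sameMap (SameMap.smul c hc A)

/-- Pushing the left `P` through `U` turns U P N P into i^a Q (U N) P, which has the shape required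
by `add_phase_smul` for the map U N. -/
theorem clifford_twirl {U : Matrix (Fin k → ZMod 2) (Fin k → ZMod 2) ℂ} (hU : IsClifford U)
    {P : Fin k → Pauli} (hP : pauliMat P * pauliMat P = 1)
    {N : Matrix (Fin k → ZMod 2) (Fin k → ZMod 2) ℂ}
    (hN : IsDiagrammatic fun _ : O → ZMod 2 => U * N) :
    IsDiagrammatic fun _ : O → ZMod 2 => U * (N + pauliMat P * (N * pauliMat P)) := by
  obtain ⟨Q, a, h⟩ := hU.exists_conj hP
  refine (hN.add_phase_smul P Q a 0).of_sameMap (SameMap.of_eq (funext fun s => ?_))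
  have hphase : phaseFactor a ((0 : (O → ZMod 2) → ZMod 2) s) = Complex.I ^ a.val := by
    simp [phaseFactor, sgn_zero]
  rw [hphase, Matrix.mul_add, ← Matrix.mul_assoc U (pauliMat P), h, Matrix.smul_mul]
  simp only [Matrix.mul_assoc]

/-- Diagrams of matrix units, which may depend on the outcomes. -/
theorem ketbra (u : Fin n → (O → ZMod 2) → ZMod 2) (v : Fin m → (O → ZMod 2) → ZMod 2) :
    IsDiagrammatic fun s => Matrix.of fun (o : Fin m → ZMod 2) (i : Fin n → ZMod 2) =>
      if (∀ j, i j = u j s) ∧ ∀ j, o j = v j s then (1 : ℂ) else 0 := by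
  set κ : Fin n ⊕ Fin m → Node O := fun p => Node.x 0 (Sum.elim u v p) with hκ
  set r : ℂ := ((1 / Real.sqrt 2 : ℝ) : ℂ) * 2 with hr
  have hr0 : r ≠ 0 := by
    rw [hr]; exact mul_ne_zero (by
      rw [Complex.ofReal_ne_zero]; positivity) two_ne_zero
  have h : ∀ p s c, (κ p).tensor s {()} (fun _ => c) =
      if c = Sum.elim u v p s then r else 0 := by
    intro p s c
    rw [hκ, Node.tensor_x_single]
    rcases zmod_two_cases c with rfl | rfl <;>
      rcases zmod_two_cases (Sum.elim u v p s) with h' | h' <;>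
      norm_num [h', phaseFactor, sgn_zero, sgn_one, hr]
  refine ((caps κ (by simp [hκ])).smul (inv_ne_zero (pow_ne_zero (n + m) hr0))).of_sameMap
    (SameMap.of_eq (funext fun s => ?_))
  ext o i
  simp only [Matrix.of_apply, Matrix.smul_apply, h, prod_ite_zero', Finset.prod_const,
    Finset.card_univ, Fintype.card_sum, Fintype.card_fin, Sum.forall, Sum.elim_inl, Sum.elim_inr,
    smul_eq_mul, mul_ite, mul_zero, inv_mul_cancel₀ (pow_ne_zero (n + m) hr0)]

/-- Twirling an operator over all Paulis gives a multiple of the identity. Carrying this out one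
generator at a time behind `U` leads from a matrix unit to `U`. -/
theorem clifford {U : Matrix (Fin k → ZMod 2) (Fin k → ZMod 2) ℂ} (hU : IsClifford U) :
    IsDiagrammatic fun _ : O → ZMod 2 => U := by
  have h1 : U * U.conjTranspose = 1 := Matrix.mem_unitaryGroup_iff.1 hU.1
  obtain ⟨o₀, i₀, h0⟩ : ∃ o i, U o i ≠ 0 := by
    by_contra! h
    have : U = 0 := by ext o i; exact h o i
    rw [this, Matrix.zero_mul] at h1
    exact zero_ne_one h1
  -- Chosen so that U N is the matrix unit |o₀⟩⟨i₀|, which has a diagram.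
  set N : Matrix (Fin k → ZMod 2) (Fin k → ZMod 2) ℂ := U.conjTranspose *
    Matrix.of fun o i => if (∀ j, i j = i₀ j) ∧ ∀ j, o j = o₀ j then (1 : ℂ) else 0 with hNdef
  have hN : ∀ a b, N a b = if ∀ j, b j = i₀ j then star (U o₀ a) else 0 := by
    intro a b
    rw [hNdef, Matrix.mul_apply, Finset.sum_eq_single o₀]
    · simp [Matrix.conjTranspose_apply]
    · intro c _ hc
      rw [Matrix.of_apply, if_neg, mul_zero]
      exact fun h => hc (funext h.2)
    · simp
  -- Twirling by Z on qubit j doubles the entries with a j = b j and kills the others; after all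
  -- qubits N is diagonal.
  have hZ : ∀ A : Finset (Fin k), IsDiagrammatic fun _ : O → ZMod 2 => U *
      Matrix.of fun a b => (2 : ℂ) ^ A.card * if ∀ j ∈ A, a j = b j then N a b else 0 := by
    intro A
    induction A using Finset.induction_on with
    | empty =>
      have : (Matrix.of fun a b => (2 : ℂ) ^ (∅ : Finset (Fin k)).card *
          if ∀ j ∈ (∅ : Finset (Fin k)), a j = b j then N a b else 0) = N := by
        ext a b; simp
      rw [this, hNdef]
      simp only [← Matrix.mul_assoc, h1, Matrix.one_mul]
      exact ketbra (fun j _ => i₀ j) fun j _ => o₀ j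
    | insert j A hj ih =>
      have hP : pauliMat (Pi.single j Pauli.Z : Fin k → Pauli) * pauliMat (Pi.single j Pauli.Z) =
          1 := by
        rw [pauliMat_mul_self, sum_single_pauli_snd_mul]; simp [sgn_zero]
      refine (clifford_twirl hU hP ih).of_sameMap
        (SameMap.of_eq (funext fun s => congrArg (U * ·) ?_))
      ext a b
      rw [Matrix.add_apply, conj_single_Z_apply]
      simp only [Matrix.of_apply, Finset.card_insert_of_notMem hj, Finset.forall_mem_insert]
      by_cases h : a j = b j
      · simp only [h, CharTwo.add_self_eq_zero, sgn_zero, true_and]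
        ring
      · have : a j + b j = 1 := by
          revert h; generalize a j = x; generalize b j = y; revert x y; decide
        simp only [h, this, sgn_one, false_and, if_false]
        ring
  -- Twirling by X on qubit j adds the translate by the j-th basis vector and so lifts the
  -- constraint a j = i₀ j. The start is the normalised projector on |i₀⟩, the end the identity.
  have hX : ∀ A : Finset (Fin k), IsDiagrammatic fun _ : O → ZMod 2 => U *
      Matrix.of fun a b => if a = b ∧ ∀ j, j ∉ A → a j = i₀ j then (1 : ℂ) else 0 := by
    intro A
    induction A using Finset.induction_on with
    | empty =>
      -- Since `N` lives in column i₀, the Z-twirl leaves this number times |i₀⟩⟨i₀|. It is nonzero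
      -- because (o₀, i₀) was chosen as a nonzero entry of `U`.
      have hμ : (2 : ℂ) ^ k * star (U o₀ i₀) ≠ 0 := mul_ne_zero (by simp) (star_ne_zero.2 h0)
      refine ((hZ Finset.univ).smul (inv_ne_zero hμ)).of_sameMap
        (SameMap.of_eq (funext fun s => ?_))
      rw [← Matrix.mul_smul]
      congr 1
      ext a b
      have e1 : (∀ j ∈ Finset.univ, a j = b j) ↔ a = b := by simp [funext_iff]
      have e2 : (∀ j, b j = i₀ j) ↔ b = i₀ := funext_iff.symm
      have e3 : (∀ j, j ∉ (∅ : Finset (Fin k)) → a j = i₀ j) ↔ a = i₀ := by simp [funext_iff]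
      simp only [Matrix.of_apply, Matrix.smul_apply, hN, Finset.card_univ, Fintype.card_fin,
        e1, e2, e3]
      by_cases hab : a = b
      · subst hab
        by_cases ha : a = i₀
        · subst ha
          simp only [and_self, if_true, smul_eq_mul]
          exact (inv_mul_cancel₀ hμ).symm
        · simp [ha]
      · simp [hab]
    | insert j A hj ih =>
      have hP : pauliMat (Pi.single j Pauli.X : Fin k → Pauli) * pauliMat (Pi.single j Pauli.X) =
          1 := by
        rw [pauliMat_mul_self, sum_single_pauli_snd_mul]; simp [sgn_zero]
      refine (clifford_twirl hU hP ih).of_sameMap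
        (SameMap.of_eq (funext fun s => congrArg (U * ·) ?_))
      ext a b
      rw [Matrix.add_apply, conj_single_X_apply]
      simp only [Matrix.of_apply, add_left_inj]
      by_cases hab : a = b
      · subst hab
        simp only [true_and]
        have e1 : (∀ i, i ∉ insert j A → a i = i₀ i) ↔ ∀ i, i ≠ j → i ∉ A → a i = i₀ i := by
          simp [Finset.mem_insert, not_or]
        have e2 : (∀ i, i ∉ A → a i = i₀ i) ↔ (∀ i, i ≠ j → i ∉ A → a i = i₀ i) ∧ a j = i₀ j := by
          constructor
          · exact fun h => ⟨fun i _ hi => h i hi, h j hj⟩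
          · rintro ⟨h, h'⟩ i hi
            by_cases hij : i = j
            · rw [hij, h']
            · exact h i hij hi
        have e3 : (∀ i, i ∉ A → (a + Pi.single j 1 : Fin k → ZMod 2) i = i₀ i) ↔
            (∀ i, i ≠ j → i ∉ A → a i = i₀ i) ∧ a j + 1 = i₀ j := by
          constructor
          · refine fun h => ⟨fun i hij hi => ?_, ?_⟩
            · simpa [hij] using h i hi
            · simpa using h j hj
          · rintro ⟨h, h'⟩ i hi
            by_cases hij : i = j
            · rw [hij]; simpa using h'
            · simpa [hij] using h i hij hi
        rw [if_congr e1 rfl rfl, if_congr e2 rfl rfl, if_congr e3 rfl rfl]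
        by_cases h : ∀ i, i ≠ j → i ∉ A → a i = i₀ i
        -- Exactly one of a and its translate satisfies the constraint at j, so the two indicators
        -- add up to the weaker one.
        · have h2 : ∀ x y : ZMod 2, (x = y ∧ ¬ x + 1 = y) ∨ (¬ x = y ∧ x + 1 = y) := by decide
          rcases h2 (a j) (i₀ j) with ⟨h3, h4⟩ | ⟨h3, h4⟩
          · rw [if_pos h, if_pos ⟨h, h3⟩, if_neg (fun x => h4 x.2), add_zero]
          · rw [if_pos h, if_neg (fun x => h3 x.2), if_pos ⟨h, h4⟩, zero_add]
        · rw [if_neg h, if_neg (fun x => h x.1), if_neg (fun x => h x.1), add_zero]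
      · simp [hab]
  have hone : (Matrix.of fun a b : Fin k → ZMod 2 =>
      if a = b ∧ ∀ j, j ∉ (Finset.univ : Finset (Fin k)) → a j = i₀ j then (1 : ℂ) else 0) = 1 := by
    ext a b; simp [Matrix.one_apply]
  have := hX Finset.univ
  rwa [hone, Matrix.mul_one] at this

end IsDiagrammatic

/-! ## Circuits have diagrams -/

namespace IsDiagrammatic

variable {n m k : ℕ} {O O' : Type}

/-- The projection is half of 1 + i^y (-1)^t P with y the number of Y's: the factor i^y makes `P`
Hermitian, and the outcome enters as a phase π. -/
theorem measure (P : Fin k → Pauli) (q : (O → ZMod 2) → ZMod 2) :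
    IsDiagrammatic fun s => Gate.projection P (q s) := by
  obtain ⟨a, ha⟩ : ∃ a : ZMod 4, (∏ j, if P j = Pauli.Y then Complex.I else 1) =
      Complex.I ^ a.val := by
    refine ⟨∑ j, if P j = Pauli.Y then 1 else 0, ?_⟩
    rw [← exists_prod_I_pow]
    refine Finset.prod_congr rfl fun j _ => ?_
    split_ifs
    · exact Node.I_pow_one_val.symm
    · simp
  refine ((one.add_phase_smul 0 P a q).smul (c := 1 / 2) (by norm_num)).of_sameMap
    (SameMap.of_eq (funext fun s => ?_))
  rw [Gate.projection, pauliHerm, ha, pauliMat_zero, Matrix.mul_one, Matrix.mul_one, smul_smul,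
    phaseFactor, mul_comm (sgn _)]

theorem destroyX (q : (O → ZMod 2) → ZMod 2) : IsDiagrammatic fun s =>
    (Matrix.of fun _ i => ((1 / Real.sqrt 2 : ℝ) : ℂ) * sgn (q s * i (0 : Fin 1)) :
      Matrix (Fin 0 → ZMod 2) (Fin 1 → ZMod 2) ℂ) := by
  refine ((caps (n := 1) (m := 0) (fun _ => Node.z 0 q) (by simp)).smul
    (c := ((1 / Real.sqrt 2 : ℝ) : ℂ)) ?_).of_sameMap (SameMap.of_eq (funext fun s => ?_))
  · rw [Complex.ofReal_ne_zero]; positivity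
  · ext o i
    rw [Matrix.smul_apply, Matrix.of_apply, Matrix.of_apply, Fintype.prod_sum_type, smul_eq_mul]
    simp only [Node.tensor_z_single, Finset.univ_unique, Finset.prod_singleton,
      Finset.univ_eq_empty, Finset.prod_empty, mul_one, Sum.elim_inl]
    congr 1
    change _ = if i (0 : Fin 1) = 0 then (1 : ℂ) else _
    rcases zmod_two_cases (i (0 : Fin 1)) with h | h <;>
      simp [h, sgn_zero, phaseFactor]

theorem prep {U : Matrix (Fin k → ZMod 2) (Fin k → ZMod 2) ℂ} (hU : IsClifford U) :
    IsDiagrammatic fun _ : O → ZMod 2 =>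
      (Matrix.of fun o _ => U o 0 : Matrix (Fin k → ZMod 2) (Fin 0 → ZMod 2) ℂ) := by
  refine ((clifford hU).mul (ketbra (n := 0) (m := k) (fun _ _ => 0) fun _ _ => 0)).of_sameMap
    (SameMap.of_eq (funext fun s => ?_))
  ext o i
  rw [Matrix.mul_apply, Finset.sum_eq_single 0]
  · simp
  · intro c _ hc
    rw [Matrix.of_apply, if_neg, mul_zero]
    exact fun h => hc (funext h.2)
  · simp

theorem destroyZ (q : (O → ZMod 2) → ZMod 2) : IsDiagrammatic fun s =>
    (Matrix.of fun _ i => if i (0 : Fin 1) = q s then 1 else 0 :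
      Matrix (Fin 0 → ZMod 2) (Fin 1 → ZMod 2) ℂ) := by
  refine (ketbra (n := 1) (m := 0) (fun _ s => q s) fun _ _ => 0).of_sameMap
    (SameMap.of_eq (funext fun s => ?_))
  ext o i
  rw [Matrix.of_apply, Matrix.of_apply]
  refine if_congr ?_ rfl rfl
  constructor
  · exact fun h => ⟨fun j => by rw [Subsingleton.elim j 0]; exact h, fun j => j.elim0⟩
  · exact fun h => h.1 0

/-- The maps `σ` and `τ` extract the earlier and the own outcomes of the gate from those of a whole
circuit, so that all diagrams share one set of outcomes. -/
theorem gate (g : Gate O) (σ : (O' → ZMod 2) → O → ZMod 2)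
    (τ : (O' → ZMod 2) → Fin g.arity → ZMod 2) :
    IsDiagrammatic fun s => g.mat (σ s) (τ s) := by
  cases g with
  | prep k U hU => exact prep hU
  | clifford k U hU => exact clifford hU
  | correction k P q => exact controlledPauli P fun s => q (σ s)
  | measure k P => exact measure P fun s => τ s (0 : Fin 1)
  | destroyZ => exact destroyZ fun s => τ s (0 : Fin 1)
  | destroyX => exact destroyX fun s => τ s (0 : Fin 1)

theorem layer (L : Layer O n m) (σ : (O' → ZMod 2) → O → ZMod 2)
    (τ : (O' → ZMod 2) → L.Outcome → ZMod 2) :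
    IsDiagrammatic fun s => L.mat (σ s) (τ s) := by
  choose D r c hr hc hD using fun g => gate (L.gate g) σ fun s j => τ s ⟨g, j⟩
  refine ⟨ZXDiagram.tens D L.wireIn L.wireOut, ∏ g, r g, fun s => ∏ g, c g s,
    Finset.prod_pos fun g _ => hr g, fun s => ?_, fun s => ?_⟩
  · rw [norm_prod]; exact Finset.prod_congr rfl fun g _ => hc g s
  · ext o i
    have h := ZXDiagram.eval_tens D L.wireIn L.wireOut (fun g => 0) s o i
    have hg : ∀ g o i, (L.gate g).mat (σ s) (fun j => τ s ⟨g, j⟩) o i =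
        c g s * (D g).eval 0 s o i := fun g o i => congrFun (congrFun (hD g s) o) i
    have hL : L.mat (σ s) (τ s) o i = ∏ g, (L.gate g).mat (σ s) (fun j => τ s ⟨g, j⟩)
        (fun j => o (L.wireOut ⟨g, j⟩)) fun j => i (L.wireIn ⟨g, j⟩) := rfl
    refine hL.trans ?_
    simp only [hg]
    rw [Finset.prod_mul_distrib, ← h]
    rfl

end IsDiagrammatic

/-! ### Assembling the diagram of a circuit. -/

theorem ZXDiagram.eval_comp_wires {n m : ℕ} {O : Type} (D : ZXDiagram n m O) (F : D.E → Pauli)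
    (Q : Fin m → Pauli) (s : O → ZMod 2) :
    (D.comp (wires m O)).eval (Sum.elim F Q) s = pauliMat Q * D.eval F s :=
  (eval_comp D (wires m O) F Q s).trans (congrArg (· * D.eval F s) (eval_wires Q s))

theorem Circuit.finite_loc {n m : ℕ} {O : Type} (C : Circuit n m O) : Finite C.Loc := by
  induction C with
  | nil => exact inferInstanceAs (Finite (Fin n))
  | @snoc m k O C L ih => exact @Finite.instSum _ _ ih (inferInstanceAs (Finite (Fin k)))

/-- Every circuit has a diagram that contains its fault locations among its edges. -/
theorem Circuit.exists_diagram {n m : ℕ} {O : Type} (C : Circuit n m O) :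
    ∃ (D : ZXDiagram n m O) (loc : C.Loc ↪ D.E),
      ∀ f : C.Loc → Pauli, SameMap (C.eval f) (D.eval (Function.extend loc f 0)) := by
  induction C with
  | nil =>
    refine ⟨ZXDiagram.wires n Empty, Function.Embedding.refl (Fin n), fun f => ?_⟩
    refine SameMap.of_eq (funext fun s => ?_)
    refine (ZXDiagram.eval_wires (O := Empty) f s).symm.trans ?_
    congr 1
    funext e
    exact (Function.injective_id.extend_apply f 0 e).symm
  | @snoc m k O C L ih =>
    obtain ⟨D, loc, hD⟩ := ih
    obtain ⟨DL, hL⟩ := IsDiagrammatic.layer L (O' := O ⊕ L.Outcome) (fun s o => s (Sum.inl o))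
      fun s o => s (Sum.inr o)
    -- Earlier locations stay inside the earlier diagram; the new ones are the edges of the wires
    -- appended after the time step.
    let φ : C.Loc ⊕ Fin k → (D.E ⊕ DL.E) ⊕ Fin k := Sum.map (fun l => Sum.inl (loc l)) id
    have hφ : Function.Injective φ :=
      Sum.map_injective.2 ⟨Sum.inl_injective.comp loc.injective, Function.injective_id⟩
    -- Layers are composed after pulling the earlier diagram back to the enlarged set of outcomes.
    -- The final identity wires exist only to carry the Paulis placed after the layer.
    refine ⟨((D.comap fun (s : O ⊕ L.Outcome → ZMod 2) o => s (Sum.inl o)).comp DL).comp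
      (ZXDiagram.wires k _), ⟨φ, hφ⟩, fun f => ?_⟩
    have hf : Function.extend φ f 0 = Sum.elim
        (Sum.elim (Function.extend loc (fun l => f (Sum.inl l)) 0) 0) fun q => f (Sum.inr q) := by
      funext e
      rcases e with (e | e) | e
      · by_cases h : ∃ l, loc l = e
        · obtain ⟨l, rfl⟩ := h
          exact (hφ.extend_apply f 0 (Sum.inl l)).trans
            (loc.injective.extend_apply (fun l => f (Sum.inl l)) 0 l).symm
        · refine (Function.extend_apply' _ _ _ ?_).trans
            (Function.extend_apply' (fun l => f (Sum.inl l))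
            (0 : D.E → Pauli) e h).symm
          rintro ⟨l | l, hl⟩
          · exact h ⟨l, by simpa [φ] using hl⟩
          · simp [φ] at hl
      · refine Function.extend_apply' _ _ _ ?_
        rintro ⟨l | l, hl⟩ <;> simp [φ] at hl
      · exact hφ.extend_apply f 0 (Sum.inr e)
    have heval : ∀ s, (((D.comap fun (s : O ⊕ L.Outcome → ZMod 2) o => s (Sum.inl o)).comp
        DL).comp (ZXDiagram.wires k _)).eval (Function.extend φ f 0) s =
        pauliMat (fun q => f (Sum.inr q)) * (DL.eval 0 s *
          D.eval (Function.extend loc (fun l => f (Sum.inl l)) 0) fun o => s (Sum.inl o)) := by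
      intro s
      refine (congrArg (fun F => ZXDiagram.eval _ F s) hf).trans ?_
      refine (ZXDiagram.eval_comp_wires _ _ (fun q => f (Sum.inr q)) s).trans ?_
      refine congrArg (pauliMat (fun q => f (Sum.inr q)) * ·) ?_
      refine (ZXDiagram.eval_comp (D.comap _) DL _ 0 s).trans ?_
      congr 1
      exact D.eval_comap _ _ s
    refine SameMap.trans ?_ (SameMap.of_eq (funext heval).symm)
    exact (SameMap.refl fun _ => pauliMat fun q => f (Sum.inr q)).mul
      (hL.mul ((hD fun l => f (Sum.inl l)).comap fun s o => s (Sum.inl o)))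

/-! ## A criterion for fault equivalence -/

theorem exists_list_of_mem_closure {L : Type} {N : Set (L → Pauli)} {F : L → Pauli}
    (hF : F ∈ AddSubgroup.closure N) :
    ∃ l : List (L → Pauli), (∀ f ∈ l, f ∈ N) ∧ l.sum = F := by
  induction hF using AddSubgroup.closure_induction with
  | mem x hx => exact ⟨[x], by simpa using hx, by simp⟩
  | zero => exact ⟨[], by simp, rfl⟩
  | add x y _ _ hx hy =>
    obtain ⟨l, hl, rfl⟩ := hx
    obtain ⟨l', hl', rfl⟩ := hy
    refine ⟨l ++ l', fun f hf => ?_, List.sum_append⟩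
    rcases List.mem_append.1 hf with h | h
    exacts [hl f h, hl' f h]
  -- Paulis modulo phase are their own inverses, so the same list serves.
  | neg x _ hx =>
    obtain ⟨l, hl, rfl⟩ := hx
    exact ⟨l, hl, (neg_eq_of_add_eq_zero_left (pauli_add_self _)).symm⟩

/-- For faults in the generated group the infimum is over a nonempty set of naturals, hence
attained. -/
theorem exists_list_length_eq_faultWeight {L : Type} {N : Set (L → Pauli)} {F : L → Pauli}
    (hF : F ∈ AddSubgroup.closure N) :
    ∃ l : List (L → Pauli), (∀ f ∈ l, f ∈ N) ∧ l.sum = F ∧ l.length = faultWeight N F := by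
  obtain ⟨l, hl, hs⟩ := exists_list_of_mem_closure hF
  exact Nat.sInf_mem (s := {w | ∃ l : List (L → Pauli), (∀ f ∈ l, f ∈ N) ∧ l.sum = F ∧
    l.length = w}) ⟨_, l, hl, hs, rfl⟩

theorem faultWeight_sum_le {L : Type} {N : Set (L → Pauli)} {l : List (L → Pauli)}
    (hl : ∀ f ∈ l, f ∈ N) : faultWeight N l.sum ≤ l.length :=
  Nat.sInf_le ⟨l, hl, rfl, rfl⟩

theorem list_sum_mem_closure {L : Type} {N : Set (L → Pauli)} {l : List (L → Pauli)}
    (hl : ∀ f ∈ l, f ∈ N) : l.sum ∈ AddSubgroup.closure N :=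
  list_sum_mem fun f hf => AddSubgroup.subset_closure (hl f hf)

/-- Atomic faults are replaced one at a time and trivial ones dropped; the total effect is kept
because effects are additive. -/
theorem exists_list_of_generators {L L' G : Type} [AddCommGroup G] {N : Set (L → Pauli)}
    {N' : Set (L' → Pauli)} (φ : (L → Pauli) →+ G) (ψ : (L' → Pauli) →+ G)
    (h : ∀ f ∈ N, φ f = 0 ∨ ∃ f' ∈ N', ψ f' = φ f) (l : List (L → Pauli)) (hl : ∀ f ∈ l, f ∈ N) :
    ∃ l' : List (L' → Pauli), (∀ f ∈ l', f ∈ N') ∧ l'.length ≤ l.length ∧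
      ψ l'.sum = φ l.sum := by
  induction l with
  | nil => exact ⟨[], by simp, le_rfl, by simp⟩
  | cons f l ih =>
    obtain ⟨l', hl', hlen, hs⟩ := ih fun f hf => hl f (List.mem_cons_of_mem _ hf)
    rcases h f (hl f List.mem_cons_self) with h0 | ⟨f', hf', hψ⟩
    · refine ⟨l', hl', hlen.trans (by simp), ?_⟩
      rw [List.sum_cons, map_add, h0, zero_add, hs]
    · refine ⟨f' :: l', ?_, by simpa using hlen, ?_⟩
      · rintro g hg
        rcases List.mem_cons.1 hg with rfl | hg
        exacts [hf', hl' g hg]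
      · rw [List.sum_cons, List.sum_cons, map_add, map_add, hψ, hs]

/-- If the effects of faults are described by homomorphisms to a common group, and each atomic
fault of `A` is trivial or has the effect of an atomic fault of `B`, then the faults of `A` are
bounded by those of `B`. -/
theorem faultBounded_of_generators {n m : ℕ} {O G : Type} [AddCommGroup G] {A B : NoisyMap n m O}
    (φ : (A.Loc → Pauli) →+ G) (ψ : (B.Loc → Pauli) →+ G)
    (heval : ∀ F ∈ AddSubgroup.closure A.noise, ∀ F' ∈ AddSubgroup.closure B.noise, φ F = ψ F' →
      SameMap (A.eval F) (B.eval F'))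
    (h : ∀ f ∈ A.noise, φ f = 0 ∨ ∃ f' ∈ B.noise, ψ f' = φ f) (w : ℕ) : FaultBounded w A B := by
  intro F hF _
  obtain ⟨l, hl, rfl, hlen⟩ := exists_list_length_eq_faultWeight hF
  obtain ⟨l', hl', hlen', hψ⟩ := exists_list_of_generators φ ψ h l hl
  -- The second alternative always holds: no fault has to be excused as detectable.
  refine Or.inr ⟨l'.sum, list_sum_mem_closure hl', ?_,
    heval _ hF _ (list_sum_mem_closure hl') hψ.symm⟩
  exact (faultWeight_sum_le hl').trans (hlen'.trans hlen.le)

theorem faultEquiv_of_generators {n m : ℕ} {O G : Type} [AddCommGroup G] {A B : NoisyMap n m O}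
    (φ : (A.Loc → Pauli) →+ G) (ψ : (B.Loc → Pauli) →+ G)
    (heval : ∀ F ∈ AddSubgroup.closure A.noise, ∀ F' ∈ AddSubgroup.closure B.noise, φ F = ψ F' →
      SameMap (A.eval F) (B.eval F'))
    (h : ∀ f ∈ A.noise, φ f = 0 ∨ ∃ f' ∈ B.noise, ψ f' = φ f)
    (h' : ∀ f ∈ B.noise, ψ f = 0 ∨ ∃ f' ∈ A.noise, φ f' = ψ f) : FaultEquiv A B := fun w =>
  ⟨faultBounded_of_generators φ ψ heval h w,
    faultBounded_of_generators ψ φ (fun F hF F' hF' e => (heval F' hF' F hF e.symm).symm) h' w⟩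

/-! ## Inserting several gadgets -/

namespace ZXDiagram

variable {n m : ℕ} {O : Type}

theorem sameMap_insertGadget_eval (D : ZXDiagram n m O) (P : D.E → Pauli)
    (G : D.E ⊕ GadgetEdge (FaultSupport P) → Pauli)
    (hG : ∀ e, e ≠ GadgetEdge.flip → G (Sum.inr e) = 0) :
    SameMap ((D.insertGadget P).eval G)
      (D.eval ((fun e => G (Sum.inl e)) + (G (Sum.inr GadgetEdge.flip)).2 • P)) := by
  have h := D.insertGadget_eval P (fun e => G (Sum.inl e)) (G (Sum.inr GadgetEdge.flip))
  have hG' : (Sum.elim (fun e => G (Sum.inl e))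
      (Pi.single GadgetEdge.flip (G (Sum.inr GadgetEdge.flip))) :
        D.E ⊕ GadgetEdge (FaultSupport P) → Pauli) = G := by
    funext e
    rcases e with e | e
    · rfl
    · by_cases he : e = GadgetEdge.flip
      · subst he; simp
      · simp [he, hG e he]
  exact hG' ▸ h

/-- The edges of `D.insertGadgets k P`, as far as they are relevant to noise: those of `D` and one
edge for each gadget; and the effect of faults. -/
theorem exists_insertGadgets (k : ℕ) (D : ZXDiagram n m O) (P : Fin k → D.E → Pauli) :
    ∃ (old : D.E → (D.insertGadgets k P).E) (flip : Fin k → (D.insertGadgets k P).E),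
      Function.Injective (Sum.elim old flip) ∧
      (∀ e, (D.insertGadgets k P).noisy e ↔
        (∃ e', D.noisy e' ∧ old e' = e) ∨ ∃ i, flip i = e) ∧
      ∀ G : (D.insertGadgets k P).E → Pauli, (∀ e, G e ≠ 0 → (D.insertGadgets k P).noisy e) →
        SameMap ((D.insertGadgets k P).eval G)
          (D.eval ((fun e => G (old e)) + ∑ i, (G (flip i)).2 • P i)) := by
  induction k generalizing D with
  | zero =>
    refine ⟨id, Fin.elim0, ?_, fun e => ?_, fun G _ => ?_⟩
    · rintro (e | i) (e' | i') h
      · exact congrArg Sum.inl h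
      · exact i'.elim0
      · exact i.elim0
      · exact i.elim0
    · constructor
      · exact fun h => Or.inl ⟨e, h, rfl⟩
      · rintro (⟨e', h, rfl⟩ | ⟨i, _⟩)
        exacts [h, i.elim0]
    · refine SameMap.of_eq (congrArg D.eval ?_)
      rw [Finset.univ_eq_empty, Finset.sum_empty, add_zero]
      rfl
  | succ k ih =>
    -- The induction runs over diagrams: once the first gadget is in place its edges count as old
    -- ones, on which the remaining Paulis are extended by zero.
    obtain ⟨old, flip, hinj, hnoisy, heval⟩ :=
      ih (D.insertGadget (P 0)) fun i => Sum.elim (P i.succ) 0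
    have hold : Function.Injective old := fun e e' h =>
      Sum.inl_injective (hinj (a₁ := Sum.inl e) (a₂ := Sum.inl e') h)
    have hflip : Function.Injective flip := fun e e' h =>
      Sum.inr_injective (hinj (a₁ := Sum.inr e) (a₂ := Sum.inr e') h)
    have hne : ∀ e i, old e ≠ flip i := fun e i h =>
      Sum.inl_ne_inr (hinj (a₁ := Sum.inl e) (a₂ := Sum.inr i) h)
    refine ⟨fun e => old (Sum.inl e),
      Fin.cons (old (Sum.inr GadgetEdge.flip)) flip, ?_, fun e => ?_, fun G hG => ?_⟩
    · rintro (e | i) (e' | i') h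
      · exact congrArg Sum.inl (Sum.inl_injective (hold h))
      · cases i' using Fin.cases with
        | zero => exact absurd (hold h) Sum.inl_ne_inr
        | succ i' => exact absurd h (hne _ _)
      · cases i using Fin.cases with
        | zero => exact absurd (hold h) Sum.inr_ne_inl
        | succ i => exact absurd h.symm (hne _ _)
      · cases i using Fin.cases with
        | zero =>
          cases i' using Fin.cases with
          | zero => rfl
          | succ i' => exact absurd h (hne _ _)
        | succ i =>
          cases i' using Fin.cases with
          | zero => exact absurd h.symm (hne _ _)
          | succ i' => exact congrArg (fun i => Sum.inr (Fin.succ i)) (hflip h)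
    · refine (hnoisy e).trans ?_
      constructor
      · rintro (⟨e' | e', h, rfl⟩ | ⟨i, rfl⟩)
        · exact Or.inl ⟨e', h, rfl⟩
        · obtain rfl : e' = GadgetEdge.flip := h
          exact Or.inr ⟨0, rfl⟩
        · exact Or.inr ⟨i.succ, rfl⟩
      · rintro (⟨e', h, rfl⟩ | ⟨i, rfl⟩)
        · exact Or.inl ⟨Sum.inl e', h, rfl⟩
        · cases i using Fin.cases with
          | zero => exact Or.inl ⟨Sum.inr GadgetEdge.flip, rfl, rfl⟩
          | succ i => exact Or.inr ⟨i, rfl⟩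
    -- Apart from its tip edge the first gadget is fault-free, so `G` vanishes there.
    · have hzero : ∀ e, e ≠ GadgetEdge.flip → G (old (Sum.inr e)) = 0 := by
        intro e he
        by_contra h0
        rcases (hnoisy _).1 (hG _ h0) with ⟨e', h, h'⟩ | ⟨i, h⟩
        · rw [hold h'] at h
          exact he h
        · exact hne _ _ h.symm
      have hsum : ∀ e : D.E ⊕ GadgetEdge (FaultSupport (P 0)),
          (∑ i : Fin k, (G (flip i)).2 • (Sum.elim (P i.succ) 0 :
            D.E ⊕ GadgetEdge (FaultSupport (P 0)) → Pauli)) e =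
          Sum.elim (∑ i : Fin k, (G (flip i)).2 • P i.succ) 0 e := by
        rintro (e | e) <;> simp [Finset.sum_apply]
      refine (heval G hG).trans ?_
      refine (D.sameMap_insertGadget_eval (P 0) _ fun e he => ?_).trans (SameMap.of_eq ?_)
      · refine (congrArg₂ (· + ·) (hzero e he) (hsum (Sum.inr e))).trans ?_
        simp
      -- The later Paulis vanish on the tip edge of the first gadget, so moving their effects onto
      -- old edges does not alter the fault there.
      · have hfl : ((fun e : D.E ⊕ GadgetEdge (FaultSupport (P 0)) => G (old e)) +
            ∑ i : Fin k, (G (flip i)).2 •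
            (Sum.elim (P i.succ) 0 : D.E ⊕ GadgetEdge (FaultSupport (P 0)) → Pauli))
            (Sum.inr GadgetEdge.flip) = G (old (Sum.inr GadgetEdge.flip)) := by
          refine (congrArg₂ (· + ·) rfl (hsum (Sum.inr GadgetEdge.flip))).trans ?_
          simp
        refine congrArg D.eval (funext fun e => ?_)
        refine (congrArg₂ (· + ·) (congrArg₂ (· + ·) rfl (hsum (Sum.inl e)))
          (congrArg (fun x : Pauli => (x.2 • P 0) e) hfl)).trans ?_
        simp only [Sum.elim_inl, Pi.add_apply, Fin.sum_univ_succ]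
        rw [add_assoc, add_comm ((∑ i : Fin k, (G (flip i)).2 • P i.succ) e)]
        rfl

theorem eq_zero_of_mem_closure_edgeFlip (D : ZXDiagram n m O) {G : D.E → Pauli}
    (hG : G ∈ AddSubgroup.closure D.edgeFlip) (e : D.E) (he : G e ≠ 0) : D.noisy e := by
  by_contra hn
  refine he ?_
  clear he
  induction hG using AddSubgroup.closure_induction with
  | mem x hx => exact not_not.1 fun h => hn (hx.2 e h)
  | zero => rfl
  | add x y _ _ hx hy => rw [Pi.add_apply, hx, hy, add_zero]
  | neg x _ hx => rw [Pi.neg_apply, hx, neg_zero]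

theorem single_mem_edgeFlip (D : ZXDiagram n m O) {e : D.E} (he : D.noisy e) {p : Pauli}
    (hp : p ≠ 0) : Pi.single e p ∈ D.edgeFlip := by
  refine ⟨⟨e, by simpa using hp, fun e' h => by simp [h]⟩, fun e' h => ?_⟩
  by_cases h' : e' = e
  · rwa [h']
  · simp [h'] at h

theorem exists_eq_single_of_mem_edgeFlip (D : ZXDiagram n m O) {f : D.E → Pauli}
    (hf : f ∈ D.edgeFlip) : ∃ e p, D.noisy e ∧ p ≠ 0 ∧ f = Pi.single e p := by
  obtain ⟨⟨e, he, h⟩, hn⟩ := hf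
  refine ⟨e, f e, hn e he, he, funext fun e' => ?_⟩
  by_cases h' : e' = e
  · subst h'; simp
  · rw [h e' h', Pi.single_eq_of_ne h']

end ZXDiagram

/-! ## Circuits under noise as diagrams with fault gadgets -/

/-- The effect of faults on the tips of gadgets, as a homomorphism. -/
def tipEffect {L E : Type} {k : ℕ} (flip : Fin k → E) (a : Fin k → L → Pauli) :
    (E → Pauli) →+ (L → Pauli) where
  toFun G := ∑ i, (G (flip i)).2 • a i
  map_zero' := by simp
  map_add' G G' := by simp [add_smul, Finset.sum_add_distrib]

theorem tipEffect_single_self {L E : Type} [DecidableEq E] {k : ℕ} {flip : Fin k → E}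
    (hflip : Function.Injective flip) (a : Fin k → L → Pauli) (i : Fin k) (p : Pauli) :
    tipEffect flip a (Pi.single (flip i) p) = p.2 • a i := by
  change ∑ i', ((Pi.single (flip i) p : _ → Pauli) (flip i')).2 • a i' = _
  rw [Finset.sum_eq_single i]
  · rw [Pi.single_eq_same]
  · intro i' _ h
    rw [Pi.single_eq_of_ne (hflip.ne h)]
    exact zero_smul _ _
  · simp

theorem tipEffect_single_of_ne {L E : Type} [DecidableEq E] {k : ℕ} {flip : Fin k → E}
    {e : E} (he : ∀ i, e ≠ flip i) (a : Fin k → L → Pauli) (p : Pauli) :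
    tipEffect flip a (Pi.single e p) = 0 := by
  change ∑ i', ((Pi.single e p : _ → Pauli) (flip i')).2 • a i' = _
  refine Finset.sum_eq_zero fun i _ => ?_
  rw [Pi.single_eq_of_ne (he i).symm]
  exact zero_smul _ _

theorem extend_sum_smul {L E : Type} {k : ℕ} {loc : L → E} (hloc : Function.Injective loc)
    (z : Fin k → ZMod 2) (a : Fin k → L → Pauli) :
    ∑ i, z i • Function.extend loc (a i) 0 = Function.extend loc (∑ i, z i • a i) 0 := by
  funext e
  rw [Finset.sum_apply]
  by_cases h : ∃ l, loc l = e
  · obtain ⟨l, rfl⟩ := h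
    rw [hloc.extend_apply, Finset.sum_apply]
    simp only [Pi.smul_apply, hloc.extend_apply]
  · rw [Function.extend_apply' _ _ _ h]
    simp only [Pi.smul_apply, Function.extend_apply' _ _ _ h]
    simp

/-- Effects are compared in the group of faults on `C`: a circuit fault is its own effect, and a
diagram fault contributes `a i` for each tip edge on which it has a Z-component. -/
theorem Circuit.faultEquiv_insertGadgets {n m : ℕ} {O : Type} (C : Circuit n m O)
    (D : ZXDiagram n m O) (loc : C.Loc ↪ D.E) (hD : ∀ e, ¬ D.noisy e)
    (heval : ∀ f : C.Loc → Pauli, SameMap (C.eval f) (D.eval (Function.extend loc f 0)))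
    {k : ℕ} (a : Fin k → C.Loc → Pauli) :
    FaultEquiv (C.under (Set.range a))
      (D.insertGadgets k fun i => Function.extend loc (a i) 0).underEdgeFlip := by
  obtain ⟨old, flip, hinj, hnoisy, hG⟩ :=
    D.exists_insertGadgets k fun i => Function.extend loc (a i) 0
  have hflip : Function.Injective flip := fun e e' h =>
    Sum.inr_injective (hinj (a₁ := Sum.inr e) (a₂ := Sum.inr e') h)
  have hne : ∀ e i, old e ≠ flip i := fun e i h =>
    Sum.inl_ne_inr (hinj (a₁ := Sum.inl e) (a₂ := Sum.inr i) h)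
  have hiff : ∀ e, (D.insertGadgets k fun i => Function.extend loc (a i) 0).noisy e ↔
      ∃ i, flip i = e := fun e => (hnoisy e).trans
    ⟨fun h => h.resolve_left fun ⟨e', h', _⟩ => hD e' h', Or.inr⟩
  have hsingle : ∀ i (p : Pauli), tipEffect flip a (Pi.single (flip i) p) = p.2 • a i :=
    fun i p => tipEffect_single_self hflip a i p
  refine faultEquiv_of_generators (AddMonoidHom.id _) (tipEffect flip a) ?_ ?_ ?_
  · intro F _ F' hF' e
    have hv := ZXDiagram.eq_zero_of_mem_closure_edgeFlip _ hF'
    refine (heval F).trans (SameMap.symm ((hG F' hv).trans (SameMap.of_eq ?_)))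
    congr 1
    -- All old edges are idealised, so faults live on tip edges alone.
    have h0 : (fun e => F' (old e)) = 0 := by
      funext e
      by_contra h
      obtain ⟨i, hi⟩ := (hiff _).1 (hv _ h)
      exact hne _ _ hi.symm
    have e' : F = ∑ i, (F' (flip i)).2 • a i := e
    rw [e', ← extend_sum_smul loc.injective]
    exact (congrArg (· + _) h0).trans (zero_add _)
  · rintro _ ⟨i, rfl⟩
    have hmem := ZXDiagram.single_mem_edgeFlip _ ((hiff _).2 ⟨i, rfl⟩) (p := Pauli.Z) (by decide)
    exact Or.inr ⟨_, hmem, (hsingle i Pauli.Z).trans (one_smul _ _)⟩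
  · intro f hf
    obtain ⟨e, p, he, hp, rfl⟩ := ZXDiagram.exists_eq_single_of_mem_edgeFlip _ hf
    obtain ⟨i, rfl⟩ := (hiff e).1 he
    -- An X on a tip edge is trivial; Z and Y both trigger the atomic fault.
    rcases zmod_two_cases p.2 with h | h
    · exact Or.inl ((hsingle i p).trans ((congrArg (· • a i) h).trans (zero_smul _ _)))
    · exact Or.inr ⟨a i, ⟨i, rfl⟩, ((hsingle i p).trans
        ((congrArg (· • a i) h).trans (one_smul _ _))).symm⟩

/-- The diagram with all edges idealised. -/
def ZXDiagram.idealise {n m : ℕ} {O : Type} (D : ZXDiagram n m O) : ZXDiagram n m O :=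
  { D with noisy := fun _ => False }

theorem ZXDiagram.eval_idealise {n m : ℕ} {O : Type} (D : ZXDiagram n m O) (F : D.E → Pauli) :
    D.idealise.eval F = D.eval F := by
  funext s
  ext o i
  exact (D.idealise.eval_eq_netEval D.ends_port F s o i).trans
    (D.eval_eq_netEval D.ends_port F s o i).symm

theorem Circuit.exists_idealised_diagram {n m : ℕ} {O : Type} (C : Circuit n m O) :
    ∃ (D : ZXDiagram n m O) (loc : C.Loc ↪ D.E),
      (∀ e, ¬ D.noisy e) ∧
      (∀ f : C.Loc → Pauli, SameMap (C.eval f) (D.eval (Function.extend loc f 0))) ∧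
      ∀ N : Set (C.Loc → Pauli), ∃ (k : ℕ) (a : Fin k → C.Loc → Pauli),
        Function.Injective a ∧ Set.range a = N ∧
        FaultEquiv (C.under N)
          (D.insertGadgets k fun i => Function.extend loc (a i) 0).underEdgeFlip := by
  obtain ⟨D, loc, heval⟩ := C.exists_diagram
  have hfin : Finite (C.Loc → Pauli) := by
    have := C.finite_loc
    infer_instance
  have heval' : ∀ f : C.Loc → Pauli,
      SameMap (C.eval f) (D.idealise.eval (Function.extend loc f 0)) := fun f =>
    (heval f).trans (SameMap.of_eq (D.eval_idealise _).symm)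
  refine ⟨D.idealise, loc, fun _ => id, heval', fun N => ?_⟩
  -- Finitely many locations allow only finitely many faults, so every noise model can be enumerated
  -- without repetition: one gadget for each atomic fault.
  obtain ⟨k, ⟨φ⟩⟩ := Finite.exists_equiv_fin N
  have hrange : Set.range (fun i => (φ.symm i : C.Loc → Pauli)) = N := by
    ext f
    exact ⟨fun ⟨i, hi⟩ => hi ▸ (φ.symm i).2, fun hf => ⟨φ ⟨f, hf⟩, by simp⟩⟩
  refine ⟨k, fun i => φ.symm i, Subtype.val_injective.comp φ.symm.injective, hrange, ?_⟩
  have := C.faultEquiv_insertGadgets D.idealise loc (fun _ => id) heval'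
    fun i => (φ.symm i : C.Loc → Pauli)
  rwa [hrange] at this

/-! ## The CNOT -/

/-- The Pauli that a CNOT turns `P` into. -/
def cnotPush (P : Fin 2 → Pauli) : Fin 2 → Pauli :=
  ![((P 0).1, (P 0).2 + (P 1).2), ((P 0).1 + (P 1).1, (P 1).2)]

theorem cnotPush_zero : cnotPush 0 = 0 := by decide

theorem cnotPush_add (P R : Fin 2 → Pauli) : cnotPush (P + R) = cnotPush P + cnotPush R := by
  funext q
  fin_cases q
  · exact Prod.ext rfl (add_add_add_comm _ _ _ _)
  · exact Prod.ext (add_add_add_comm _ _ _ _) rfl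

theorem cnotMat_mul_pauliMat (P : Fin 2 → Pauli) :
    cnotMat * pauliMat P = pauliMat (cnotPush P) * cnotMat := by
  ext o i
  rw [cnotMat_mul, mul_cnotMat, pauliMat_apply, pauliMat_apply]
  have h1 : ∀ o0 o1 i0 i1 x0 x1 : ZMod 2, (o0 = i0 + x0 ∧ o0 + o1 = i1 + x1) ↔
      (o0 = i0 + x0 ∧ o1 = i0 + i1 + (x0 + x1)) := by decide
  have h2 : ∀ i0 i1 z0 z1 : ZMod 2,
      z0 * i0 + z1 * i1 = (z0 + z1) * i0 + z1 * (i0 + i1) := by decide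
  refine if_congr ?_ ?_ rfl
  · simp only [funext_iff, Fin.forall_fin_two, Pi.add_apply]
    exact h1 _ _ _ _ _ _
  · rw [Fin.sum_univ_two, Fin.sum_univ_two]
    exact congrArg sgn (h2 _ _ _ _)

/-- The effect of faults before and after a CNOT on its outputs. -/
def cnotCircuitEffect : (Fin 2 ⊕ Fin 2 → Pauli) →+ (Fin 2 → Pauli) where
  toFun F := (fun q => F (Sum.inr q)) + cnotPush fun q => F (Sum.inl q)
  map_zero' := (zero_add _).trans cnotPush_zero
  map_add' F G := (congrArg (_ + ·) (cnotPush_add (fun q => F (Sum.inl q)) fun q =>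
    G (Sum.inl q))).trans (add_add_add_comm (fun q => F (Sum.inr q)) (fun q => G (Sum.inr q)) _ _)

theorem eval_cnotCircuit (F : Fin 2 ⊕ Fin 2 → Pauli) (s : Empty ⊕ (Σ _ : Fin 1, Fin 0) → ZMod 2) :
    cnotCircuit.eval F s = pauliMat (fun q => F (Sum.inr q)) *
      (cnotMat * pauliMat fun q => F (Sum.inl q)) := by
  have hL : ∀ M : Matrix (Fin 2 → ZMod 2) (Fin 2 → ZMod 2) ℂ,
      (∀ o i, M o i = ∏ _g : Fin 1, cnotMat o i) → M = cnotMat :=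
    fun M hM => Matrix.ext fun o i => (hM o i).trans (Fin.prod_univ_one _)
  exact congrArg (fun M => pauliMat (fun q => F (Sum.inr q)) *
    (M * pauliMat fun q => F (Sum.inl q))) (hL _ fun _ _ => rfl)

theorem sgn_ne_zero (a : ZMod 2) : sgn a ≠ 0 :=
  norm_ne_zero_iff.1 (by rw [norm_sgn]; exact one_ne_zero)

/-- Faults before the gate are pushed through to the outputs; merging the Paulis costs only a sign.
-/
theorem sameMap_cnotCircuit (F : Fin 2 ⊕ Fin 2 → Pauli) :
    SameMap (cnotCircuit.eval F) fun _ => pauliMat (cnotCircuitEffect F) * cnotMat := by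
  have h : cnotCircuit.eval F = fun _ => sgn (∑ q, (F (Sum.inr q)).2 *
      (cnotPush (fun q => F (Sum.inl q)) q).1) • (pauliMat (cnotCircuitEffect F) * cnotMat) := by
    funext s
    rw [eval_cnotCircuit, cnotMat_mul_pauliMat, ← Matrix.mul_assoc, pauliMat_mul, Matrix.smul_mul]
    rfl
  exact (SameMap.of_eq h).trans (SameMap.smul _ (sgn_ne_zero _) _)

/-- The effect of a fault of the CNOT diagram on its outputs. -/
def cnotDiagramEffect : (CnotEdge → Pauli) →+ (Fin 2 → Pauli) where
  toFun F := ![F CnotEdge.controlOut, F CnotEdge.targetOut] +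
    (![(0, (F CnotEdge.middle).2), ((F CnotEdge.middle).1, 0)] +
      cnotPush ![F CnotEdge.controlIn, F CnotEdge.targetIn])
  map_zero' := by decide
  map_add' F G := by
    funext q
    fin_cases q <;> refine Prod.ext ?_ ?_ <;> simp [cnotPush] <;> ring

/-- The values at the ends of the edges of the CNOT diagram, if the fault `F` occurs. -/
def cnotAssign (F : CnotEdge → Pauli) (i o : Fin 2 → ZMod 2) (y : ZMod 2) :
    CnotEdge × Bool → ZMod 2
  | (CnotEdge.controlIn, false) => i 0
  | (CnotEdge.controlIn, true) => i 0 + (F CnotEdge.controlIn).1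
  | (CnotEdge.targetIn, false) => i 1
  | (CnotEdge.targetIn, true) => i 1 + (F CnotEdge.targetIn).1
  | (CnotEdge.middle, false) => y
  | (CnotEdge.middle, true) => y + (F CnotEdge.middle).1
  | (CnotEdge.controlOut, false) => o 0 + (F CnotEdge.controlOut).1
  | (CnotEdge.controlOut, true) => o 0
  | (CnotEdge.targetOut, false) => o 1 + (F CnotEdge.targetOut).1
  | (CnotEdge.targetOut, true) => o 1

/-- The ends that the inputs and outputs of the CNOT diagram carry. -/
def cnotPort : Fin 2 ⊕ Fin 2 → CnotEdge × Bool :=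
  Sum.elim ![(CnotEdge.controlIn, false), (CnotEdge.targetIn, false)]
    ![(CnotEdge.controlOut, true), (CnotEdge.targetOut, true)]

theorem pauliEntry_ne_zero {p : Pauli} {a b : ZMod 2} (h : pauliEntry p a b ≠ 0) : a = b + p.1 := by
  by_contra hn
  exact h (if_neg hn)

theorem pauliEntry_add (p : Pauli) (b : ZMod 2) : pauliEntry p (b + p.1) b = sgn (p.2 * b) :=
  if_pos rfl

theorem zmod_two_eq_add {a b x : ZMod 2} (h : a = b + x) : b = a + x := by
  rw [h, add_assoc, CharTwo.add_self_eq_zero, add_zero]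

theorem tensor_z_triple {O H : Type} [DecidableEq H] (s : O → ZMod 2) (x y z : H)
    (b : H → ZMod 2) : (Node.z 0 0 : Node O).tensor s {x, y, z} b =
      if b x = b y ∧ b y = b z then 1 else 0 := by
  simp only [Node.tensor, Finset.mem_insert, Finset.mem_singleton, forall_eq_or_imp, forall_eq]
  generalize b x = l
  generalize b y = r
  generalize b z = k
  rcases zmod_two_cases l with rfl | rfl <;> rcases zmod_two_cases r with rfl | rfl <;>
    rcases zmod_two_cases k with rfl | rfl <;> simp [phaseFactor, sgn_zero]

theorem tensor_x_triple {O H : Type} [DecidableEq H] (s : O → ZMod 2) {x y z : H} (hxy : x ≠ y)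
    (hxz : x ≠ z) (hyz : y ≠ z) (b : H → ZMod 2) : (Node.x 0 0 : Node O).tensor s {x, y, z} b =
      ((1 / Real.sqrt 2 : ℝ) : ℂ) * if b x = b y + b z then 1 else 0 := by
  have h := inv_sqrt_two_mul_self
  have hphase : phaseFactor 0 ((0 : (O → ZMod 2) → ZMod 2) s) = 1 := by
    simp [phaseFactor, sgn_zero]
  have hb : (Node.x 0 0 : Node O).tensor s {x, y, z} b = ((1 / Real.sqrt 2 : ℝ) : ℂ) *
      (1 / 2 * (1 + sgn (b x) * (sgn (b y) * sgn (b z)))) := by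
    rw [← h]
    simp only [Node.tensor, hphase]
    rw [Finset.prod_insert (by simp [hxy, hxz]), Finset.prod_insert (by simp [hyz]),
      Finset.prod_insert (by simp [hxy, hxz]), Finset.prod_insert (by simp [hyz]),
      Finset.prod_singleton, Finset.prod_singleton]
    ring
  rw [hb]
  generalize b x = l
  generalize b y = r
  generalize b z = k
  rcases zmod_two_cases l with rfl | rfl <;> rcases zmod_two_cases r with rfl | rfl <;>
    rcases zmod_two_cases k with rfl | rfl <;>
    simp [sgn_zero, sgn_one, CharTwo.add_self_eq_zero] <;> norm_num

theorem prod_cnotEdge (f : CnotEdge → ℂ) : ∏ e, f e = f CnotEdge.controlIn *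
    (f CnotEdge.targetIn * (f CnotEdge.middle * (f CnotEdge.controlOut *
      f CnotEdge.targetOut))) := by
  have h : (Finset.univ : Finset CnotEdge) = {CnotEdge.controlIn, CnotEdge.targetIn,
    CnotEdge.middle, CnotEdge.controlOut, CnotEdge.targetOut} := rfl
  rw [h, Finset.prod_insert (by decide), Finset.prod_insert (by decide),
    Finset.prod_insert (by decide), Finset.prod_insert (by decide), Finset.prod_singleton]

theorem prod_cnotNode (f : CnotNode → ℂ) : ∏ v, f v = f CnotNode.green * f CnotNode.red := by
  have h : (Finset.univ : Finset CnotNode) = {CnotNode.green, CnotNode.red} := rfl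
  rw [h, Finset.prod_insert (by decide), Finset.prod_singleton]

theorem sum_cnot_constraint (p q u v x : ZMod 2) (c : ℂ) (g : ZMod 2 → ℂ) :
    ∑ y, (if p = y ∧ y = u then 1 else 0) * (c * if q = y + x + v then 1 else 0) * g y =
      c * ((if p = u ∧ q = u + x + v then 1 else 0) * g u) := by
  rw [Finset.sum_eq_single u
    (fun y _ hy => by rw [if_neg fun h => hy h.2, zero_mul, zero_mul]) (by simp)]
  by_cases hp : p = u <;> by_cases hq : q = u + x + v <;> simp [hp, hq]

/-- The green spider copies a value and the red one imposes a parity. A Z on the middle edge passes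
through the green spider to the control, an X through the red one to the target. The prefactor is 2
(1/√2)³ from the three-legged red spider. -/
theorem eval_cnotDiagram (O : Type) (F : CnotEdge → Pauli) (s : O → ZMod 2) :
    (cnotDiagram O).eval F s = ((1 / Real.sqrt 2 : ℝ) : ℂ) •
      (pauliMat ![F CnotEdge.controlOut, F CnotEdge.targetOut] *
        (pauliMat ![(0, (F CnotEdge.middle).2), ((F CnotEdge.middle).1, 0)] *
          (cnotMat * pauliMat ![F CnotEdge.controlIn, F CnotEdge.targetIn]))) := by
  ext o i
  have hport : ∀ p, cnotEnds (cnotPort p) = Sum.inr p := by decide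
  refine ((cnotDiagram O).eval_eq_netEval (port := cnotPort) hport F s o i).trans ?_
  change netEval (fun v => match v with
    | CnotNode.green => Node.z 0 0
    | CnotNode.red => Node.x 0 0) cnotEnds cnotPort F s (Sum.elim i o) = _
  have hgreen : (Finset.univ.filter fun h => cnotEnds h = Sum.inl CnotNode.green) =
      {(CnotEdge.controlIn, true), (CnotEdge.middle, false), (CnotEdge.controlOut, false)} := by
    decide
  have hred : (Finset.univ.filter fun h => cnotEnds h = Sum.inl CnotNode.red) =
      {(CnotEdge.targetIn, true), (CnotEdge.middle, true), (CnotEdge.targetOut, false)} := by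
    decide
  simp only [netEval, prod_cnotEdge, prod_cnotNode, hgreen, hred, tensor_z_triple]
  -- Boundary values and edge Paulis determine all ends except one end of the middle edge; every
  -- other assignment contributes zero.
  rw [← Fintype.sum_of_injective (cnotAssign F i o)
    (fun y y' h => congrFun h (CnotEdge.middle, false)) _ _ ?_ fun y => rfl]
  swap
  · intro b hb
    by_contra h0
    refine hb ⟨b (CnotEdge.middle, false), ?_⟩
    have hp : ∀ p, b (cnotPort p) = Sum.elim i o p := by
      by_contra hn
      exact h0 (if_neg hn)
    rw [if_pos hp] at h0
    obtain ⟨h1, h2, h3, h4, h5⟩ : _ ∧ _ ∧ _ ∧ _ ∧ _ := by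
      have := right_ne_zero_of_mul h0
      simpa only [mul_ne_zero_iff] using this
    have hi0 : b (CnotEdge.controlIn, false) = i 0 := hp (Sum.inl 0)
    have hi1 : b (CnotEdge.targetIn, false) = i 1 := hp (Sum.inl 1)
    have ho0 : b (CnotEdge.controlOut, true) = o 0 := hp (Sum.inr 0)
    have ho1 : b (CnotEdge.targetOut, true) = o 1 := hp (Sum.inr 1)
    have h1 := pauliEntry_ne_zero h1
    have h2 := pauliEntry_ne_zero h2
    have h3 := pauliEntry_ne_zero h3
    have h4 := zmod_two_eq_add (pauliEntry_ne_zero h4)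
    have h5 := zmod_two_eq_add (pauliEntry_ne_zero h5)
    rw [hi0] at h1
    rw [hi1] at h2
    rw [ho0] at h4
    rw [ho1] at h5
    funext ⟨e, x⟩
    rcases e with _ | _ | _ | _ | _ <;> cases x <;>
      simp only [cnotAssign, h1, h2, h3, h4, h5, hi0, hi1, ho0, ho1]
  have hassign : ∀ y p, cnotAssign F i o y (cnotPort p) = Sum.elim i o p := by
    rintro y (p | p) <;> fin_cases p <;> rfl
  have hout : ∀ (p : Pauli) (a : ZMod 2), pauliEntry p a (a + p.1) = sgn (p.2 * (a + p.1)) := by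
    intro p a
    have := pauliEntry_add p (a + p.1)
    rwa [add_assoc, CharTwo.add_self_eq_zero, add_zero] at this
  simp only [hassign, implies_true, if_true]
  rw [Matrix.smul_apply, pauliMat_mul_apply, pauliMat_mul_apply, cnotMat_mul, pauliMat_apply]
  rw [Finset.sum_congr rfl fun y _ => by
    rw [tensor_x_triple s (by decide) (by decide) (by decide)]]
  simp only [cnotAssign, pauliEntry_add, hout, Fin.sum_univ_two]
  have hcond : (cnotFun ((o + fun q => (![F CnotEdge.controlOut, F CnotEdge.targetOut] q).1) +
      fun q => (![(0, (F CnotEdge.middle).2), ((F CnotEdge.middle).1, 0)] q).1) =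
        i + fun q => (![F CnotEdge.controlIn, F CnotEdge.targetIn] q).1) ↔
      i 0 + (F CnotEdge.controlIn).1 = o 0 + (F CnotEdge.controlOut).1 ∧
        i 1 + (F CnotEdge.targetIn).1 = o 0 + (F CnotEdge.controlOut).1 + (F CnotEdge.middle).1 +
          (o 1 + (F CnotEdge.targetOut).1) := by
    have h : ∀ p q u v x : ZMod 2, (u + 0 = p ∧ u + 0 + (v + x) = q) ↔ (p = u ∧ q = u + x + v) := by
      decide
    rw [funext_iff, Fin.forall_fin_two]
    exact h _ _ _ _ _
  refine (sum_cnot_constraint _ _ _ _ _ _ fun y => _).trans ?_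
  simp only [hcond, Pi.add_apply, Matrix.cons_val_zero, Matrix.cons_val_one, add_zero, zero_mul,
    smul_eq_mul, sgn_add]
  refine congrArg _ ?_
  by_cases h : i 0 + (F CnotEdge.controlIn).1 = o 0 + (F CnotEdge.controlOut).1 ∧
      i 1 + (F CnotEdge.targetIn).1 = o 0 + (F CnotEdge.controlOut).1 + (F CnotEdge.middle).1 +
        (o 1 + (F CnotEdge.targetOut).1)
  · rw [if_pos h, if_pos h]
    ring
  · rw [if_neg h, if_neg h]
    ring

theorem sameMap_cnotDiagram (O : Type) (F : CnotEdge → Pauli) :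
    SameMap ((cnotDiagram O).eval F) fun _ => pauliMat (cnotDiagramEffect F) * cnotMat := by
  have h : (cnotDiagram O).eval F = fun _ => _ := funext fun s => eval_cnotDiagram O F s
  refine (SameMap.of_eq h).trans ((SameMap.smul _ ?_ _).trans ?_)
  · exact_mod_cast (one_div_pos.2 (Real.sqrt_pos.2 two_pos)).ne'
  · have h' : ∀ P R S : Fin 2 → Pauli, pauliMat P * (pauliMat R * (cnotMat * pauliMat S)) =
        sgn (∑ q, (R q).2 * (cnotPush S q).1) • sgn (∑ q, (P q).2 * ((R + cnotPush S) q).1) •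
          (pauliMat (P + (R + cnotPush S)) * cnotMat) := by
      intro P R S
      rw [cnotMat_mul_pauliMat, ← Matrix.mul_assoc (pauliMat R), pauliMat_mul, Matrix.smul_mul,
        Matrix.mul_smul, ← Matrix.mul_assoc, pauliMat_mul, Matrix.smul_mul]
    rw [h']
    exact (SameMap.smul _ (sgn_ne_zero _) _).trans (SameMap.smul _ (sgn_ne_zero _) _)

/-! ### Output faults of the CNOT as single edge flips. -/

theorem sameMap_pauliMat_mul_cnotMat_iff {O : Type} {Q R : Fin 2 → Pauli} :
    SameMap (O := O) (fun _ => pauliMat Q * cnotMat) (fun _ => pauliMat R * cnotMat) ↔ Q = R := by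
  refine ⟨fun ⟨_, c, _, _, h⟩ => ?_, fun h => SameMap.of_eq (by rw [h])⟩
  -- Unitarity allows the CNOT to be cancelled, which leaves two Paulis equal up to a scalar; any
  -- one outcome suffices.
  have hu : cnotMat * star cnotMat = 1 := Matrix.mem_unitaryGroup_iff.1 isClifford_cnotMat.1
  refine eq_of_pauliMat_eq_smul (c := c 0) ?_
  have := congrArg (· * star cnotMat) (h 0)
  simpa only [Matrix.smul_mul, Matrix.mul_assoc, hu, Matrix.mul_one] using this

/-- The output faults of a CNOT that are no gadget fault are those of single edge flips. -/
theorem exists_cnotDiagramEffect_single_iff {Q : Fin 2 → Pauli} (hQ : Q ≠ 0) :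
    (∃ e p, p ≠ 0 ∧ cnotDiagramEffect (Pi.single e p) = Q) ↔ Q ∉ Set.range cnotGadgetFaults := by
  -- The flips of the output edges give P ⊗ 1 and 1 ⊗ P, six in all. The input edges add X ⊗ X, Y ⊗
  -- X, Z ⊗ Z and Z ⊗ Y, and a Y on the middle edge adds Z ⊗ X; the other flips repeat these. All
  -- this is a finite check.
  have h : ∀ a b : Pauli, (![a, b] : Fin 2 → Pauli) ≠ 0 →
      ((∃ (e : CnotEdge) (p : Pauli), p ≠ 0 ∧ cnotDiagramEffect (Pi.single e p) = ![a, b]) ↔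
        ¬ ∃ i, cnotGadgetFaults i = ![a, b]) := by
    decide
  have hQ' : Q = ![Q 0, Q 1] := by
    funext q
    fin_cases q <;> rfl
  rw [hQ'] at hQ ⊢
  exact h _ _ hQ

theorem cnotOutputFault_mem_circuitLevelNoise (Q : Fin 2 → Pauli) :
    cnotOutputFault Q ∈ cnotCircuit.circuitLevelNoise := by
  have hinj : Function.Injective fun j : Fin 2 =>
      Equiv.uniqueSigma (fun _ : Fin 1 => Fin 2) ⟨0, j⟩ := fun j j' h => h
  refine Or.inr ⟨(0 : Fin 1), (0, Q), rfl, ?_⟩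
  refine congrArg₂ (Sum.elim (γ := Pauli) (α := Fin 2) (β := Fin 2)) ?_ ?_
  · exact (Function.extend_zero _).symm
  · funext q
    exact (hinj.extend_apply Q (0 : Fin 2 → Pauli) q).symm

theorem cnotCircuitEffect_cnotOutputFault (Q : Fin 2 → Pauli) :
    cnotCircuitEffect (cnotOutputFault Q) = Q :=
  (congrArg (Q + ·) cnotPush_zero).trans (add_zero Q)

theorem cnotDiagramEffect_cnotEdgeFault (Q : Fin 2 → Pauli) :
    cnotDiagramEffect (cnotEdgeFault Q) = Q := by
  have h : cnotDiagramEffect (cnotEdgeFault Q) = ![Q 0, Q 1] + 0 :=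
    congrArg (![Q 0, Q 1] + ·) (show ![(0, 0), (0, 0)] + cnotPush ![0, 0] = 0 by decide)
  rw [h, add_zero]
  funext q
  fin_cases q <;> rfl

theorem single_comp_of_injective {E E' : Type} [DecidableEq E] [DecidableEq E'] {old : E → E'}
    (hold : Function.Injective old) (e : E) (p : Pauli) :
    (fun e' => (Pi.single (old e) p : E' → Pauli) (old e')) = Pi.single e p := by
  funext e'
  by_cases h : e' = e
  · rw [h, Pi.single_eq_same, Pi.single_eq_same]
  · rw [Pi.single_eq_of_ne h, Pi.single_eq_of_ne (hold.ne h)]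

/-- A CNOT under circuit-level noise is its diagram with four gadgets under edge-flip noise. -/
theorem cnot_faultEquiv : FaultEquiv (cnotCircuit.under cnotCircuit.circuitLevelNoise)
    ((cnotDiagram _).insertGadgets 4
      fun i => cnotEdgeFault (cnotGadgetFaults i)).underEdgeFlip := by
  obtain ⟨old, flip, hinj, hnoisy, hG⟩ :=
    (cnotDiagram (Empty ⊕ Σ _ : Fin 1, Fin 0)).exists_insertGadgets 4
      fun i => cnotEdgeFault (cnotGadgetFaults i)
  have hold : Function.Injective old := fun e e' h =>
    Sum.inl_injective (hinj (a₁ := Sum.inl e) (a₂ := Sum.inl e') h)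
  have hflip : Function.Injective flip := fun e e' h =>
    Sum.inr_injective (hinj (a₁ := Sum.inr e) (a₂ := Sum.inr e') h)
  have hne : ∀ e i, old e ≠ flip i := fun e i h =>
    Sum.inl_ne_inr (hinj (a₁ := Sum.inl e) (a₂ := Sum.inr i) h)
  -- A fault is first moved from the tips to the edges of the plain diagram, then pushed to the
  -- outputs.
  let ψ : (((cnotDiagram (Empty ⊕ Σ _ : Fin 1, Fin 0)).insertGadgets 4
      fun i => cnotEdgeFault (cnotGadgetFaults i)).E → Pauli) →+ (Fin 2 → Pauli) :=
    cnotDiagramEffect.comp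
      ({ toFun := fun G e => G (old e), map_zero' := rfl, map_add' := fun _ _ => rfl } +
        tipEffect flip fun i => cnotEdgeFault (cnotGadgetFaults i))
  have hψ : ∀ i, ψ (Pi.single (flip i) Pauli.Z) = cnotGadgetFaults i := by
    intro i
    refine (congrArg cnotDiagramEffect ?_).trans (cnotDiagramEffect_cnotEdgeFault _)
    refine (congrArg₂ (· + ·) (funext fun e => ?_) (tipEffect_single_self hflip _ i Pauli.Z)).trans
      ((zero_add _).trans (one_smul _ _))
    exact Pi.single_eq_of_ne (hne e i) _
  have hψ' : ∀ e p, ψ (Pi.single (old e) p) = cnotDiagramEffect (Pi.single e p) := by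
    intro e p
    exact congrArg cnotDiagramEffect ((congrArg₂ (· + ·) (single_comp_of_injective hold e p)
      (tipEffect_single_of_ne (hne e) _ p)).trans (add_zero _))
  refine faultEquiv_of_generators cnotCircuitEffect ψ ?_ ?_ ?_
  · intro F _ F' hF' e
    have e' : cnotCircuitEffect F = ψ F' := e
    refine (sameMap_cnotCircuit F).trans (SameMap.symm ((hG F'
      (ZXDiagram.eq_zero_of_mem_closure_edgeFlip _ hF')).trans
        ((sameMap_cnotDiagram _ _).trans ?_)))
    exact SameMap.of_eq (by rw [e']; rfl)
  · intro f _
    -- Each nontrivial output Pauli is either that of a gadget, triggered by a Z on its tip edge, or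
    -- that of a flip of a single old edge.
    by_cases h0 : cnotCircuitEffect f = 0
    · exact Or.inl h0
    refine Or.inr ?_
    by_cases hr : cnotCircuitEffect f ∈ Set.range cnotGadgetFaults
    · obtain ⟨i, hi⟩ := hr
      exact ⟨_, ZXDiagram.single_mem_edgeFlip _ ((hnoisy _).2 (Or.inr ⟨i, rfl⟩)) (by decide),
        (hψ i).trans hi⟩
    · obtain ⟨e, p, hp, he⟩ := (exists_cnotDiagramEffect_single_iff h0).2 hr
      exact ⟨_, ZXDiagram.single_mem_edgeFlip _ ((hnoisy _).2 (Or.inl ⟨e, trivial, rfl⟩)) hp,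
        (hψ' e p).trans he⟩
  -- Every output Pauli, the trivial one included, is an atomic gate fault of the CNOT.
  · exact fun f _ => Or.inr ⟨_, cnotOutputFault_mem_circuitLevelNoise _,
      cnotCircuitEffect_cnotOutputFault _⟩

/-- Both maps are an output Pauli times the CNOT, so having the same effect as maps reduces to
equality of these Paulis. -/
theorem exists_edgeFlip_sameMap_cnot_iff {Q : Fin 2 → Pauli} (hQ : Q ≠ 0) :
    (∃ f ∈ (cnotDiagram _).edgeFlip,
      SameMap (cnotCircuit.eval (cnotOutputFault Q)) ((cnotDiagram _).eval f)) ↔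
      Q ∉ Set.range cnotGadgetFaults := by
  have h : ∀ f : CnotEdge → Pauli,
      SameMap (cnotCircuit.eval (cnotOutputFault Q)) ((cnotDiagram _).eval f) ↔
        cnotDiagramEffect f = Q := by
    intro f
    have h1 := sameMap_cnotCircuit (cnotOutputFault Q)
    rw [cnotCircuitEffect_cnotOutputFault] at h1
    have h2 := sameMap_cnotDiagram (Empty ⊕ Σ _ : Fin 1, Fin 0) f
    exact ⟨fun h => (sameMap_pauliMat_mul_cnotMat_iff.1 ((h1.symm.trans h).trans h2)).symm,
      fun h => h1.trans ((SameMap.of_eq (by rw [h])).trans h2.symm)⟩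
  rw [← exists_cnotDiagramEffect_single_iff hQ]
  constructor
  · rintro ⟨f, hf, hs⟩
    obtain ⟨e, p, -, hp, rfl⟩ := ZXDiagram.exists_eq_single_of_mem_edgeFlip _ hf
    exact ⟨e, p, hp, (h _).1 hs⟩
  · rintro ⟨e, p, hp, he⟩
    exact ⟨_, ZXDiagram.single_mem_edgeFlip _ trivial hp, (h _).2 he⟩

theorem cnotGadgetFaults_ne_zero (i : Fin 4) : cnotGadgetFaults i ≠ 0 := by
  revert i
  decide

theorem cnotGadgetFaults_injective : Function.Injective cnotGadgetFaults := by
  unfold Function.Injective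
  decide

theorem ncard_ne_zero_pauli : {Q : Fin 2 → Pauli | Q ≠ 0}.ncard = 15 := by
  rw [← Set.compl_singleton_eq, Set.ncard_compl, Set.ncard_singleton]
  simp

theorem mainTheorem11 :
    (∀ {n m : ℕ} {O : Type} (C : Circuit n m O),
      ∃ (D : ZXDiagram n m O) (loc : C.Loc ↪ D.E),
        (∀ e, ¬ D.noisy e) ∧
        (∀ f : C.Loc → Pauli, SameMap (C.eval f) (D.eval (Function.extend loc f 0))) ∧
        ∀ N : Set (C.Loc → Pauli), ∃ (k : ℕ) (a : Fin k → C.Loc → Pauli),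
          Function.Injective a ∧ Set.range a = N ∧
          FaultEquiv (C.under N)
            (D.insertGadgets k fun i => Function.extend loc (a i) 0).underEdgeFlip) ∧
    FaultEquiv (cnotCircuit.under cnotCircuit.circuitLevelNoise)
      ((cnotDiagram _).insertGadgets 4 fun i => cnotEdgeFault (cnotGadgetFaults i)).underEdgeFlip ∧
    {Q : Fin 2 → Pauli | Q ≠ 0}.ncard = 15 ∧
    {Q : Fin 2 → Pauli | Q ≠ 0 ∧ ∃ f ∈ (cnotDiagram _).edgeFlip,
      SameMap (cnotCircuit.eval (cnotOutputFault Q)) ((cnotDiagram _).eval f)}.ncard = 11 ∧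
    {Q : Fin 2 → Pauli | Q ≠ 0 ∧ ¬ ∃ f ∈ (cnotDiagram _).edgeFlip,
      SameMap (cnotCircuit.eval (cnotOutputFault Q)) ((cnotDiagram _).eval f)} =
      Set.range cnotGadgetFaults := by
  refine ⟨fun C => C.exists_idealised_diagram, cnot_faultEquiv, ncard_ne_zero_pauli, ?_, ?_⟩
  · have h : {Q : Fin 2 → Pauli | Q ≠ 0 ∧ ∃ f ∈ (cnotDiagram _).edgeFlip,
        SameMap (cnotCircuit.eval (cnotOutputFault Q)) ((cnotDiagram _).eval f)} =
        {Q | Q ≠ 0} \ Set.range cnotGadgetFaults :=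
      Set.ext fun Q => and_congr_right fun hQ => exists_edgeFlip_sameMap_cnot_iff hQ
    -- The count is 15 - 4, as the four gadget faults are distinct and nontrivial.
    rw [h, Set.ncard_sdiff, ncard_ne_zero_pauli, ← Set.image_univ,
      Set.ncard_image_of_injective _ cnotGadgetFaults_injective, Set.ncard_univ]
    · simp
    · rintro _ ⟨i, rfl⟩
      exact cnotGadgetFaults_ne_zero i
  · ext Q
    constructor
    · rintro ⟨hQ, h⟩
      exact not_not.1 fun hr => h ((exists_edgeFlip_sameMap_cnot_iff hQ).2 hr)
    · rintro ⟨i, rfl⟩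
      exact ⟨cnotGadgetFaults_ne_zero i, fun h =>
        (exists_edgeFlip_sameMap_cnot_iff (cnotGadgetFaults_ne_zero i)).1 h ⟨i, rfl⟩⟩
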